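/- Let $n,p\ge 1$ and let $q$ be an integer coprime to $p$. **Grid.** A twisted grid diagram $G$ with parameters $(n,p,q)$ lives on the torus obtained from $[0,pn]\times[0,n]$ by identifying $(0,t)\sim(pn,t)$ and $(s,n)\sim(s-qn \bmod pn,\,0)$. It has $n$ horizontal circles $\alpha_i$ (height $i$) and $n$ vertical circles $\beta_j$ (first coordinate $\equiv j \bmod n$), all indices running over $0,\dots,n-1$, and markings $\mathbb X_1,\dots,\mathbb X_n$, $\mathbb O_1,\dots,\mathbb O_n$ at the centres of little squares, with exactly one $\mathbb X$ and one $\mathbb O$ in each row and each column and at most one marking in each square. A generator $x\in S(G)=\mathfrak S_n\times(\mathbb Z/p)^n$, $x=(\sigma,(a_i))$, is the set of the $n$ points $(\sigma(i)+na_i,\,i)$, $0\le a_i<p$. **Gradings.** For finite sets $A,B\subset\mathbb R^2$ let $\mathcal I(A,B)$ be the number of pairs $(a,b)\in A\times B$ with $a_1<b_1$ and $a_2<b_2$. For a set $A=\{(c_i,b_i)\}$ of $n$ points let $\widetilde A=\{(c_i+nqk \bmod np,\; b_i+nk): 1\le i\le n,\ 0\le k<p\}$. Let $d(p,0,i)=0$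 and $d(p,q,i)=\frac{pq-(2i+1-p-q)^2}{4pq}+d(q,\,p\bmod q,\,i\bmod q)$ for $q>0$, and put $d_0=d(p,q_0,q_0-1)$ with $q_0=q\bmod p$. Set $$M(x)=\tfrac1p\big[\mathcal I(\tilde x,\tilde x)-\mathcal I(\tilde x,\widetilde{\mathbb O})-\mathcal I(\widetilde{\mathbb O},\tilde x)+\mathcal I(\widetilde{\mathbb O},\widetilde{\mathbb O})\big]+d_0+1,$$ $$A(x)=\tfrac1{2p}\big[\mathcal I(\widetilde{\mathbb O},\widetilde{\mathbb O})-\mathcal I(\widetilde{\mathbb X},\widetilde{\mathbb X})+2\mathcal I(\widetilde{\mathbb X},\tilde x)-2\mathcal I(\widetilde{\mathbb O},\tilde x)\big]+\tfrac{1-n}2,$$ $$S(x)=q-1+\sum_i(a_i-a_i^{\mathbb O})\in\mathbb Z/p,$$ where $a_i^{\mathbb O}=\lfloor c_i/n\rfloor$ if $(c_i,b_i)$ is the lower left vertex of the square of $\mathbb O_i$ in the planar grid. **Rectangles.** $Rect(x,y)$ is the set of immersed rectangles with sides on the $\alpha$ and $\beta$ circles, of width and height strictly between $0$ and $pn$,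 whose lower left and upper right corners are the components of $x$ on two distinct circles $\alpha_i,\alpha_j$, whose lower right and upper left corners are the components of $y$ on $\alpha_i,\alpha_j$, where $x$ and $y$ agree on all other $\alpha$ circles. $Rect^\circ(x,y)$ is the set of those that are embedded (no little square is covered twice) and have no component of $x$ in their interior. An empty polygon $\psi$ from $x$ to $z$ is a function from the little squares to $\mathbb N$ that is the sum of the multiplicity functions of some $r_1\in Rect^\circ(x,y)$ and $r_2\in Rect^\circ(y,z)$, for some generator $y$; such a triple $(y,r_1,r_2)$ is a decomposition of $\psi$. An $\alpha$-strip (respectively $\beta$-strip) is the characteristic function of a row (respectively column). **Complexes.** $GC^-(G)$ is the free module on $S(G)$ over $R=\mathbb F_2[V_1,\dots,V_n]$, and $\widehat{GC}(G)$ the free module on $S(G)$ over $R/(V_1)$. In both cases $\partial$ is the linear map with $$\partial x=\sum_{y\in S(G)}\ \sum_{r\in Rect^\circ(x,y),\; r\cap\mathbb X=\emptyset}\ \Big(\prod_{i=1}^n V_i^{O_i(r)}\Big)\,y,$$ where $O_i(r)$ is the multiplicity of $r$ at $\mathbb O_i$. The gradings are extended to the complexes by giving each $V_i$ Maslov degree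 $-2$, Alexander degree $-1$ and $Spin^c$ degree $0$. **Proposition.** 1. $\partial^2=0$ on $GC^-(G)$ and on $\widehat{GC}(G)$. 2. For all generators $x,z$, every empty polygon from $x$ to $z$ that is not an $\alpha$- or $\beta$-strip has exactly two decompositions. 3. On both complexes $\partial$ preserves the $Spin^c$ and the Alexander degree and lowers the Maslov degree by $1$: it sends homogeneous elements of tridegree $(m,a,s)$ (Maslov, Alexander, $Spin^c$) to homogeneous elements of tridegree $(m-1,a,s)$, where the zero element is homogeneous of every degree. -/

import Mathlib

namespace TwistedGrid

/-- Two points of `ℤ × ℤ` give the same point of the grid torus, the quotient of the plane by the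
lattice generated by `(p n, 0)` and `(q n, n)`; the second generator is the twisted identification
of `(s, n)` with `(s - q n, 0)`. Unit squares are named by their lower left vertices, so that this
is also the identification of little squares. -/
def SamePoint (n p : ℕ) (q : ℤ) (u v : ℤ × ℤ) : Prop :=
  ∃ k m : ℤ, v = (u.1 + q * n * k + p * n * m, u.2 + n * k)

/-- A little square of the grid, in the planar `n × p n` picture: (column position, row). The
square `(c, b)` is `[c, c + 1] × [b, b + 1]`. The same type is used for the points of intersection
of the horizontal and the vertical circles: `(c, b)` is then the point with these coordinates. -/
abbrev Cell (n p : ℕ) : Type := Fin (p * n) × Fin n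

/-- The integral planar coordinates of a square (of its lower left vertex), or of a point. -/
def Cell.toPlane {n p : ℕ} (c : Cell n p) : ℤ × ℤ := ((c.1 : ℕ), (c.2 : ℕ))

/-- The markings of a twisted grid diagram with parameters `(n, p, q)`. The column with label `j`
consists of the squares whose planar column position is congruent to `j` modulo `n`. -/
structure GridDiagram (n p : ℕ) (q : ℤ) where
  /-- the square that contains the `i`-th `X` marking -/
  X : Fin n → Cell n p
  /-- the square that contains the `i`-th `O` marking -/
  O : Fin n → Cell n p
  row_X : ∀ b : Fin n, ∃! i, (X i).2 = b
  row_O : ∀ b : Fin n, ∃! i, (O i).2 = b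
  column_X : ∀ j : Fin n, ∃! i, ((X i).1 : ℕ) % n = j
  column_O : ∀ j : Fin n, ∃! i, ((O i).1 : ℕ) % n = j
  disjoint : ∀ i j, X i ≠ O j

/-- The generating set `S(G)`: permutations together with `p`-coordinates. The component of
`(σ, a)` on the `i`-th horizontal circle is the `a i`-th point of intersection (from the left,
starting from `0`) of this circle with the `σ i`-th vertical circle. -/
abbrev Generator (n p : ℕ) : Type := Equiv.Perm (Fin n) × (Fin n → ZMod p)

/-- The planar coordinates of the component of a generator on the `i`-th horizontal circle. -/
def Generator.point {n p : ℕ} (x : Generator n p) (i : Fin n) : ℤ × ℤ :=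
  (((x.1 i : ℕ) + n * (x.2 i).val : ℕ), (i : ℕ))

/-! ### Gradings -/

/-- The number of pairs `(a, b)` with `a` in the first and `b` in the second family of points of
the plane such that `a` is strictly smaller than `b` in both coordinates. -/
def countPairs {ι κ : Type} [Fintype ι] [Fintype κ] (A : ι → ℚ × ℚ) (B : κ → ℚ × ℚ) : ℕ :=
  (Finset.univ.filter fun s : ι × κ => (A s.1).1 < (B s.2).1 ∧ (A s.1).2 < (B s.2).2).card

/-- The `p n` lifts `(c_i + n q k mod n p, b_i + n k)`, `0 ≤ k < p`, of the points
`(c_i, b_i) + (ε, ε)` with `c_i` and `b_i` integers; used with `ε = 0` for generators and with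
`ε = 1/2` for markings, which sit at the centres of the squares. -/
def lift (n p : ℕ) (q : ℤ) (ε : ℚ) (c : Fin n → ℤ × ℤ) : Fin n × Fin p → ℚ × ℚ := fun s =>
  ((((c s.1).1 + n * q * (s.2 : ℕ)) % (n * p : ℤ) : ℤ) + ε,
    ((c s.1).2 + n * (s.2 : ℕ) : ℤ) + ε)

/-- The correction term `d(p, q, i)` of a lens space, for `0 ≤ q` (where `q = 0` only matters
with `p = 1`). -/
def correctionTerm : ℕ → ℕ → ℤ → ℚ
  | _, 0, _ => 0
  | p, q + 1, i =>
      ((p : ℚ) * ((q + 1 : ℕ) : ℚ) - (2 * (i : ℚ) + 1 - p - ((q + 1 : ℕ) : ℚ)) ^ 2)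
          / (4 * p * ((q + 1 : ℕ) : ℚ))
        + correctionTerm (q + 1) (p % (q + 1)) (i % ((q + 1 : ℕ) : ℤ))
  termination_by _ q _ => q
  decreasing_by exact Nat.mod_lt _ (Nat.succ_pos _)

section Gradings

variable {n p : ℕ} {q : ℤ} (G : GridDiagram n p q)

/-- the lifted generator -/
def liftGen (q : ℤ) (x : Generator n p) : Fin n × Fin p → ℚ × ℚ := lift n p q 0 x.point

/-- the lifted `O` markings -/
def GridDiagram.liftO : Fin n × Fin p → ℚ × ℚ := lift n p q (1 / 2) fun i => (G.O i).toPlane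

/-- the lifted `X` markings -/
def GridDiagram.liftX : Fin n × Fin p → ℚ × ℚ := lift n p q (1 / 2) fun i => (G.X i).toPlane

/-- The Maslov degree. The correction term is the one of `L(p, q) = L(p, q mod p)`. -/
def GridDiagram.maslov (x : Generator n p) : ℚ :=
  (1 / (p : ℚ)) * ((countPairs (liftGen q x) (liftGen q x) : ℚ)
      - countPairs (liftGen q x) G.liftO - countPairs G.liftO (liftGen q x)
      + countPairs G.liftO G.liftO)
    + correctionTerm p (q % p).toNat (q % p - 1) + 1

/-- The Alexander degree. -/
def GridDiagram.alexander (x : Generator n p) : ℚ :=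
  (1 / (2 * (p : ℚ))) * ((countPairs G.liftO G.liftO : ℚ) - countPairs G.liftX G.liftX
      + 2 * countPairs G.liftX (liftGen q x) - 2 * countPairs G.liftO (liftGen q x))
    + (1 - (n : ℚ)) / 2

/-- The `Spin^c` degree. The `p`-coordinate of the lower left vertex `(c, b)` of a square is
`⌊c / n⌋`. -/
def GridDiagram.spinc (x : Generator n p) : ZMod p :=
  (q : ZMod p) - 1 + (∑ i, x.2 i - ∑ i, (((G.O i).1 : ℕ) / n : ℕ))

end Gradings

/-! ### Rectangles -/

/-- An immersed rectangle in the torus with sides on the horizontal and vertical circles: the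
image of `[c, c + w] × [b, b + h]`, where `(c, b)` is the lower left corner, taken in the planar
picture. The sides are arcs of circles of length `p n`, hence `w, h < p n`. -/
structure Rectangle (n p : ℕ) where
  corner : Cell n p
  width : Fin (p * n)
  height : Fin (p * n)
  deriving DecidableEq, Fintype

namespace Rectangle

variable {n p : ℕ}

/-- The point of the plane at position `(u, v)` relative to the lower left corner. -/
def pos (r : Rectangle n p) (u v : ℕ) : ℤ × ℤ :=
  (r.corner.toPlane.1 + u, r.corner.toPlane.2 + v)

/-- The multiplicity with which the (immersed) rectangle covers a little square. -/
noncomputable def mult (q : ℤ) (r : Rectangle n p) (c : Cell n p) : ℕ :=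
  open Classical in
  ((Finset.range r.width ×ˢ Finset.range r.height).filter
    fun s => SamePoint n p q (r.pos s.1 s.2) c.toPlane).card

/-- `r ∈ Rect(x, y)`: the generators `x` and `y` agree except on two horizontal circles `i` and
`j`, the lower left and upper right corners of `r` are the components of `x` on the circles `i`
and `j`, and the lower right and upper left corners are those of `y`. -/
def Connects (q : ℤ) (r : Rectangle n p) (x y : Generator n p) : Prop :=
  0 < (r.width : ℕ) ∧ 0 < (r.height : ℕ) ∧
  ∃ i j : Fin n, i ≠ j ∧
    SamePoint n p q (r.pos 0 0) (x.point i) ∧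
    SamePoint n p q (r.pos r.width r.height) (x.point j) ∧
    SamePoint n p q (r.pos r.width 0) (y.point i) ∧
    SamePoint n p q (r.pos 0 r.height) (y.point j) ∧
    ∀ k, k ≠ i → k ≠ j → x.point k = y.point k

/-- `r ∈ Rect°(x, y)`: the rectangle is embedded (no little square is covered twice), and there is
no component of `x` in its interior. -/
def ConnectsEmpty (q : ℤ) (r : Rectangle n p) (x y : Generator n p) : Prop :=
  r.Connects q x y ∧ (∀ c, r.mult q c ≤ 1) ∧
  ∀ u v : ℕ, 0 < u → u < r.width → 0 < v → v < r.height →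
    ∀ i, ¬ SamePoint n p q (r.pos u v) (x.point i)

end Rectangle

/-- The decompositions of `ψ` (a multiplicity for each little square) as a polygon `r₁ * r₂` that
connects `x` to `z` through some generator `y`, with `r₁ ∈ Rect°(x, y)` and
`r₂ ∈ Rect°(y, z)`. There is one if and only if `ψ` is an empty polygon from `x` to `z`. -/
def decompositions {n p : ℕ} (q : ℤ) (x z : Generator n p) (ψ : Cell n p → ℕ) :
    Set (Generator n p × Rectangle n p × Rectangle n p) :=
  {t | t.2.1.ConnectsEmpty q x t.1 ∧ t.2.2.ConnectsEmpty q t.1 z ∧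
    ∀ c, t.2.1.mult q c + t.2.2.mult q c = ψ c}

/-- `ψ` is an `α`-strip: a horizontal annulus of height one. -/
def IsAlphaStrip {n p : ℕ} (ψ : Cell n p → ℕ) : Prop :=
  ∃ b : Fin n, ∀ c, ψ c = if c.2 = b then 1 else 0

/-- `ψ` is a `β`-strip: a vertical annulus of width one. -/
def IsBetaStrip {n p : ℕ} (ψ : Cell n p → ℕ) : Prop :=
  ∃ j : Fin n, ∀ c, ψ c = if (c.1 : ℕ) % n = j then 1 else 0

/-! ### The complexes -/

/-- The ground ring `𝔽₂[V₁, …, Vₙ]`. -/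
abbrev MinusRing (n : ℕ) : Type := MvPolynomial (Fin n) (ZMod 2)

/-- The ground ring `𝔽₂[V₁, …, Vₙ] / (V₁)`; the variable with label `0` plays the role of
`V₁`. -/
abbrev HatRing (n : ℕ) [NeZero n] : Type :=
  MinusRing n ⧸ Ideal.span {(MvPolynomial.X 0 : MinusRing n)}

/-- The variables in the ground ring of the minus complex. -/
noncomputable def minusVar (n : ℕ) : Fin n → MinusRing n := fun i => MvPolynomial.X i

/-- The variables in the ground ring of the hat complex. -/
noncomputable def hatVar (n : ℕ) [NeZero n] : Fin n → HatRing n :=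
  fun i => Ideal.Quotient.mk _ (MvPolynomial.X i)

section Complex

variable {n p : ℕ} [NeZero p] {q : ℤ} (G : GridDiagram n p q)
  {A : Type} [CommRing A] (V : Fin n → A)

/-- The value of the differential on a generator, with values in the free `A`-module on the
generators, for variables `V i` in the ring `A`. -/
noncomputable def GridDiagram.diffGen (x : Generator n p) : Generator n p →₀ A :=
  open Classical in
  ∑ y : Generator n p,
    ∑ r ∈ Finset.univ.filter (fun r : Rectangle n p =>
        r.ConnectsEmpty q x y ∧ ∀ i, r.mult q (G.X i) = 0),
      Finsupp.single y (∏ i, V i ^ r.mult q (G.O i))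

/-- The differential, extended linearly. -/
noncomputable def GridDiagram.diff : (Generator n p →₀ A) →ₗ[A] (Generator n p →₀ A) :=
  Finsupp.linearCombination A (G.diffGen V)

/-- The elements of tridegree `(m, a, s)` (Maslov, Alexander, `Spin^c`) of the free `A`-module on
the generators: the linear combinations over `𝔽₂` of the elements `V₁^{e₁} ⋯ Vₙ^{eₙ} x` with this
tridegree, where each variable has tridegree `(-2, -1, 0)`. -/
noncomputable def GridDiagram.trigraded [Algebra (ZMod 2) A] (m a : ℚ) (s : ZMod p) :
    Submodule (ZMod 2) (Generator n p →₀ A) :=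
  Submodule.span (ZMod 2)
    {c | ∃ (x : Generator n p) (e : Fin n → ℕ),
      c = Finsupp.single x (∏ i, V i ^ e i) ∧
      G.maslov x - 2 * (∑ i, e i : ℕ) = m ∧ G.alexander x - (∑ i, e i : ℕ) = a ∧
      G.spinc x = s}

end Complex

/-- The differential of the minus complex, the free `𝔽₂[V₁, …, Vₙ]`-module on the generators. -/
noncomputable def GridDiagram.diffMinus {n p : ℕ} [NeZero p] {q : ℤ} (G : GridDiagram n p q) :
    (Generator n p →₀ MinusRing n) →ₗ[MinusRing n] (Generator n p →₀ MinusRing n) :=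
  G.diff (minusVar n)

/-- The differential of the hat complex, the free `𝔽₂[V₁, …, Vₙ] / (V₁)`-module on the
generators. -/
noncomputable def GridDiagram.diffHat {n p : ℕ} [NeZero n] [NeZero p] {q : ℤ}
    (G : GridDiagram n p q) :
    (Generator n p →₀ HatRing n) →ₗ[HatRing n] (Generator n p →₀ HatRing n) :=
  G.diff (hatVar n)

end TwistedGrid

/-!
# The differential of twisted grid diagrams

The points with integral coordinates of the grid torus form a finite abelian group `T`, the quotient
of `ℤ × ℤ` by the lattice of the identifications, with a horizontal unit step `e₁` and a vertical
unit step `e₂`. Since squares are named by their lower left corners, `T` also indexes the squares. A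
generator becomes a state, a subset with one element in each coset of `⟨e₁⟩` and of `⟨e₂⟩`, and for
the function `f` of multiplicities of a rectangle from `X` to `Y` the mixed difference
`f Q - f (Q - e₁) - f (Q - e₂) + f (Q - e₁ - e₂)` is the difference of the indicator functions of
`X` and `Y` (`Joins.ind_sub_cover`). The whole proof lives in this translation invariant setting.

*Empty polygons.* The index of a rectangle from `X` to `Y` counts the points of `X` off its left and
bottom sides and those of `Y` off its right and top sides. It is at least `1`, with equality exactly
for embedded rectangles without points of `X` in the interior (`Joins.index_eq_one`,
`Joins.vacant_of_index_eq_one`). By summation by parts, the sum of the indices of two composable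
rectangles depends only on the total multiplicity and on the two ends (`index_add_index`). Hence, as
soon as a polygon has one decomposition into empty rectangles, all its decompositions into
rectangles consist of empty ones, and emptiness never has to be checked for a new decomposition
(`IsDecomp.exists_of_cover_eq`).

*Exactly two decompositions.* If the rectangles of a decomposition have no common corner in the
intermediate state, the only other decomposition consists of the same rectangles in the other order
(`IsDecomp.exists_unique_of_apart`). Otherwise they lie either beside or above each other, and not
both. The signed lengths of the boundary of the polygon along the circles determine the corners that
are moved and their displacements, so that there is at most one decomposition of each of the two
kinds (`IsDecomp.eq_of_beside`; the exchange of `e₁` and `e₂` exchanges the kinds). There is one of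
each kind unless the polygon is a strip: it is L-shaped and has the two cuts from its reflex
corner, or it is an annulus bounded by two staircases with one step each, for which the rectangles of
the other kind are found with a multiple of its period (`cover_staircase`,
`IsDecomp.exists_above`).

*The square of the differential* has coefficients that are sums over polygons of twice a monomial;
a strip does not occur, as it contains an `X` marking (`diff_comp_diff`).

*Gradings.* The counts of pairs are bilinear in the indicator functions of the lifts to the box
`[0, p n) × [0, p n)`. When `X` is replaced by `Y`, summation by parts turns the mixed difference of
the multiplicities against a discrete double integral into the multiplicities themselves, up to a
boundary term that depends only on the rectangle (`sum_box_by_parts`). In the Maslov and Alexander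
degrees the boundary terms cancel, and what remains is `1 - 2 #O` and `#X - #O`
(`maslov_sub_maslov`, `alexander_sub_alexander`). The `Spin^c` degree is invariant because the two
horizontal displacements along a rectangle are opposite (`spinc_eq`).
-/

set_option linter.unusedSectionVars false

namespace TorusGrid

/-! ### Signed sums over integer intervals -/

/-- The sum of `f` over `[0, w)`, and minus the sum over `[w, 0)` when `w` is negative: the discrete
integral of `f` from `0` to `w`. -/
noncomputable def isum (f : ℤ → ℤ) (w : ℤ) : ℤ :=
  ∑ u ∈ Finset.Ico 0 w, f u - ∑ u ∈ Finset.Ico w 0, f u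

@[simp] lemma isum_zero (f : ℤ → ℤ) : isum f 0 = 0 := by simp [isum]

lemma isum_of_nonneg (f : ℤ → ℤ) {w : ℤ} (hw : 0 ≤ w) :
    isum f w = ∑ u ∈ Finset.Ico 0 w, f u := by
  simp [isum, Finset.Ico_eq_empty_of_le hw]

lemma isum_succ (f : ℤ → ℤ) (w : ℤ) : isum f (w + 1) = isum f w + f w := by
  unfold isum
  rcases le_or_gt 0 w with hw | hw
  · rw [Finset.Ico_eq_empty_of_le hw, Finset.Ico_eq_empty_of_le (by omega : (0 : ℤ) ≤ w + 1)]
    have : Finset.Ico 0 (w + 1) = insert w (Finset.Ico 0 w) := by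
      ext; simp only [Finset.mem_Ico, Finset.mem_insert]; omega
    rw [this, Finset.sum_insert (by simp)]
    simp; ring
  · rw [Finset.Ico_eq_empty_of_le hw.le, Finset.Ico_eq_empty_of_le (by omega : w + 1 ≤ (0 : ℤ))]
    have : Finset.Ico w 0 = insert w (Finset.Ico (w + 1) 0) := by
      ext; simp only [Finset.mem_Ico, Finset.mem_insert]; omega
    rw [this, Finset.sum_insert (by simp)]
    simp

lemma isum_add (f : ℤ → ℤ) (a b : ℤ) :
    isum f (a + b) = isum f a + isum (fun u => f (a + u)) b := by
  induction b using Int.induction_on with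
  | zero => simp
  | succ k ih => rw [← add_assoc, isum_succ, ih, isum_succ]; ring
  | pred k ih =>
    have h1 := isum_succ f (a + (-k - 1))
    have h2 := isum_succ (fun u => f (a + u)) (-k - 1)
    rw [show a + (-(k : ℤ) - 1) + 1 = a + -k by ring, ih] at h1
    rw [show (-(k : ℤ) - 1) + 1 = -k by ring] at h2
    linarith

lemma isum_fun_add (f g : ℤ → ℤ) (w : ℤ) :
    isum (fun u => f u + g u) w = isum f w + isum g w := by
  simp only [isum, Finset.sum_add_distrib]; ring

lemma isum_fun_sub (f g : ℤ → ℤ) (w : ℤ) :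
    isum (fun u => f u - g u) w = isum f w - isum g w := by
  simp only [isum, Finset.sum_sub_distrib]; ring

lemma isum_shift (f : ℤ → ℤ) (w : ℤ) : isum f w - isum (fun u => f (u + 1)) w = f 0 - f w := by
  have h1 := isum_succ f w
  have h2 := isum_add f 1 w
  have h3 := isum_succ f 0
  simp only [add_comm (1 : ℤ)] at h2
  simp at h3
  linarith

lemma isum_comm (f : ℤ → ℤ → ℤ) (w h : ℤ) :
    isum (fun u => isum (fun v => f u v) h) w = isum (fun v => isum (fun u => f u v) w) h := by
  simp only [isum, Finset.sum_sub_distrib]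
  rw [Finset.sum_comm, Finset.sum_comm (s := Finset.Ico w 0),
    Finset.sum_comm (s := Finset.Ico 0 w) (t := Finset.Ico h 0),
    Finset.sum_comm (s := Finset.Ico w 0) (t := Finset.Ico h 0)]
  ring

/-! ### Rectangles in a finite abelian group with two unit steps -/

/-- A rectangle in a finite abelian group with a horizontal and a vertical unit step, given by its
lower left corner, its width and its height. Negative sizes are allowed; they occur only in
identities between covering multiplicities. -/
@[ext] structure Rect (T : Type*) where
  /-- the lower left corner -/
  c : T
  /-- the width -/
  w : ℤ
  /-- the height -/
  h : ℤ

namespace Rect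

variable {T : Type*} [AddCommGroup T] (e₁ e₂ : T)

/-- the lower right corner -/
def lr (r : Rect T) : T := r.c + r.w • e₁

/-- the upper left corner -/
def ul (r : Rect T) : T := r.c + r.h • e₂

/-- the upper right corner -/
def ur (r : Rect T) : T := r.c + r.w • e₁ + r.h • e₂

/-- the rectangle seen after the exchange of the two directions -/
def swap (r : Rect T) : Rect T := ⟨r.c, r.h, r.w⟩

lemma lr_swap (r : Rect T) : r.swap.lr e₂ = r.ul e₂ := rfl
lemma ul_swap (r : Rect T) : r.swap.ul e₁ = r.lr e₁ := rfl
lemma ur_swap (r : Rect T) : r.swap.ur e₂ e₁ = r.ur e₁ e₂ := by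
  simp only [ur, swap]; abel

variable [DecidableEq T]

/-- The (signed) number of times that a rectangle covers the unit square with lower left corner
`C`. -/
noncomputable def cover (r : Rect T) (C : T) : ℤ :=
  isum (fun u => isum (fun v => if r.c + u • e₁ + v • e₂ = C then 1 else 0) r.h) r.w

lemma cover_swap (r : Rect T) (C : T) : r.swap.cover e₂ e₁ C = r.cover e₁ e₂ C := by
  unfold cover swap
  rw [isum_comm]
  simp only [add_right_comm]

lemma cover_add_w (c : T) (w w' h : ℤ) (C : T) :
    cover e₁ e₂ ⟨c, w + w', h⟩ C = cover e₁ e₂ ⟨c, w, h⟩ C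
      + cover e₁ e₂ ⟨c + w • e₁, w', h⟩ C := by
  unfold cover
  rw [isum_add]
  simp only [add_smul, add_assoc]

lemma cover_add_h (c : T) (w h h' : ℤ) (C : T) :
    cover e₁ e₂ ⟨c, w, h + h'⟩ C = cover e₁ e₂ ⟨c, w, h⟩ C
      + cover e₁ e₂ ⟨c + h • e₂, w, h'⟩ C := by
  have := cover_add_w e₂ e₁ c h h' w C
  simpa only [← cover_swap e₁ e₂, swap] using this

@[simp] lemma cover_zero_w (c : T) (h : ℤ) (C : T) : cover e₁ e₂ ⟨c, 0, h⟩ C = 0 := by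
  simp [cover]

@[simp] lemma cover_zero_h (c : T) (w : ℤ) (C : T) : cover e₁ e₂ ⟨c, w, 0⟩ C = 0 := by
  simp [cover, isum]

lemma cover_neg_w (c : T) (w h : ℤ) (C : T) :
    cover e₁ e₂ ⟨c, -w, h⟩ C = - cover e₁ e₂ ⟨c - w • e₁, w, h⟩ C := by
  have := cover_add_w e₁ e₂ c (-w) w h C
  rw [neg_add_cancel, cover_zero_w, neg_smul, ← sub_eq_add_neg] at this
  linarith

lemma cover_neg_h (c : T) (w h : ℤ) (C : T) :
    cover e₁ e₂ ⟨c, w, -h⟩ C = - cover e₁ e₂ ⟨c - h • e₂, w, h⟩ C := by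
  have := cover_add_h e₁ e₂ c w (-h) h C
  rw [neg_add_cancel, cover_zero_h, neg_smul, ← sub_eq_add_neg] at this
  linarith

lemma cover_neg_neg (c : T) (w h : ℤ) (C : T) :
    cover e₁ e₂ ⟨c, -w, -h⟩ C = cover e₁ e₂ ⟨c - w • e₁ - h • e₂, w, h⟩ C := by
  rw [cover_neg_w, cover_neg_h, neg_neg]

lemma cover_of_nonneg {r : Rect T} (hw : 0 ≤ r.w) (hh : 0 ≤ r.h) (C : T) :
    r.cover e₁ e₂ C = ∑ u ∈ Finset.Ico 0 r.w, ∑ v ∈ Finset.Ico 0 r.h,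
      if r.c + u • e₁ + v • e₂ = C then 1 else 0 := by
  unfold cover
  rw [isum_of_nonneg _ hw]
  exact Finset.sum_congr rfl fun u _ => isum_of_nonneg _ hh

/-- Crossing the bottom side of a rectangle changes the multiplicity by one, crossing the top side
by minus one. -/
lemma cover_sub_vertical (r : Rect T) (C : T) :
    r.cover e₁ e₂ C - r.cover e₁ e₂ (C - e₂) =
      isum (fun u => (if r.c + u • e₁ = C then 1 else 0)
        - (if r.c + u • e₁ + r.h • e₂ = C then 1 else 0)) r.w := by
  unfold cover
  rw [← isum_fun_sub]
  congr 1
  funext u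
  have := isum_shift (fun v => if r.c + u • e₁ + v • e₂ = C then 1 else 0) r.h
  simp only [zero_smul, add_zero] at this
  rw [← this]
  congr 2
  funext v
  simp only [add_smul, one_smul, eq_sub_iff_add_eq, add_assoc]

/-- The mixed difference of the multiplicities of a rectangle is supported at the corners. -/
lemma cover_corners (r : Rect T) (C : T) :
    r.cover e₁ e₂ C - r.cover e₁ e₂ (C - e₁) - r.cover e₁ e₂ (C - e₂)
        + r.cover e₁ e₂ (C - e₁ - e₂) =
      (if r.c = C then 1 else 0) + (if r.ur e₁ e₂ = C then 1 else 0)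
        - (if r.lr e₁ = C then 1 else 0) - (if r.ul e₂ = C then 1 else 0) := by
  have h1 := cover_sub_vertical e₁ e₂ r C
  have h2 := cover_sub_vertical e₁ e₂ r (C - e₁)
  have h3 := isum_shift (fun u => (if r.c + u • e₁ = C then 1 else 0)
        - (if r.c + u • e₁ + r.h • e₂ = C then 1 else 0)) r.w
  have h4 : (fun u : ℤ => (if r.c + u • e₁ = C - e₁ then (1 : ℤ) else 0)
        - (if r.c + u • e₁ + r.h • e₂ = C - e₁ then 1 else 0)) =
      fun u => (if r.c + (u + 1) • e₁ = C then 1 else 0)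
        - (if r.c + (u + 1) • e₁ + r.h • e₂ = C then 1 else 0) := by
    funext u
    have h (D : T) : (D = C - e₁) = (D + e₁ = C) := propext eq_sub_iff_add_eq
    simp only [h, add_smul, one_smul, ← add_assoc, add_right_comm _ (r.h • e₂) e₁]
  rw [h4] at h2
  simp only [zero_smul, add_zero] at h3
  unfold ur lr ul
  linarith

end Rect

end TorusGrid

namespace TorusGrid

variable {T : Type*} [AddCommGroup T] [DecidableEq T]

/-! ### States and the rectangles that join them -/

/-- A set of points with exactly one element in each horizontal and in each vertical circle, that
is, in each coset of the subgroups generated by the two unit steps. -/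
structure IsState (e₁ e₂ : T) (S : Finset T) : Prop where
  row_exists : ∀ Q, ∃ s : ℤ, Q + s • e₁ ∈ S
  col_exists : ∀ Q, ∃ t : ℤ, Q + t • e₂ ∈ S
  row_unique : ∀ Q ∈ S, ∀ s : ℤ, Q + s • e₁ ∈ S → s • e₁ = 0
  col_unique : ∀ Q ∈ S, ∀ t : ℤ, Q + t • e₂ ∈ S → t • e₂ = 0

/-- the indicator function of a finite set -/
def ind (S : Finset T) (Q : T) : ℤ := if Q ∈ S then 1 else 0

/-- The rectangle `r` joins the state `X` to the state `Y`: passing from `X` to `Y` replaces its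
lower left and upper right corners by the other two corners. -/
structure Joins (e₁ e₂ : T) (r : Rect T) (X Y : Finset T) : Prop where
  w_pos : 0 < r.w
  h_pos : 0 < r.h
  c_mem : r.c ∈ X
  ur_mem : r.ur e₁ e₂ ∈ X
  ne : r.c ≠ r.ur e₁ e₂
  ind_sub : ∀ Q, ind X Q - ind Y Q = (if r.c = Q then 1 else 0) + (if r.ur e₁ e₂ = Q then 1 else 0)
    - (if r.lr e₁ = Q then 1 else 0) - (if r.ul e₂ = Q then 1 else 0)

/-- The open rectangle contains no point of `X` or `Y`, and its sides are shorter than the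
circles. For a rectangle that joins `X` to `Y` this makes it embedded. -/
structure Vacant (e₁ e₂ : T) (r : Rect T) (X Y : Finset T) : Prop where
  w_lt : r.w < addOrderOf e₁
  h_lt : r.h < addOrderOf e₂
  notMem : ∀ u v : ℤ, 0 < u → u < r.w → 0 < v → v < r.h →
    r.c + u • e₁ + v • e₂ ∉ X ∧ r.c + u • e₁ + v • e₂ ∉ Y

variable {e₁ e₂ : T} {r r₁ r₂ : Rect T} {S X Y Z : Finset T}

lemma ind_nonneg (S : Finset T) (Q : T) : 0 ≤ ind S Q := by unfold ind; split_ifs <;> simp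

lemma ind_of_mem {Q : T} (h : Q ∈ S) : ind S Q = 1 := by simp [ind, h]

lemma ind_of_notMem {Q : T} (h : Q ∉ S) : ind S Q = 0 := by simp [ind, h]

lemma IsState.swap (h : IsState e₁ e₂ S) : IsState e₂ e₁ S :=
  ⟨h.col_exists, h.row_exists, h.col_unique, h.row_unique⟩

lemma Joins.swap (h : Joins e₁ e₂ r X Y) : Joins e₂ e₁ r.swap X Y where
  w_pos := h.h_pos
  h_pos := h.w_pos
  c_mem := h.c_mem
  ur_mem := by rw [Rect.ur_swap]; exact h.ur_mem
  ne := by rw [Rect.ur_swap]; exact h.ne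
  ind_sub Q := by
    rw [h.ind_sub, Rect.ur_swap, Rect.lr_swap, Rect.ul_swap]
    change _ = (if r.c = Q then 1 else 0) + _ - _ - _
    ring

lemma Vacant.swap (h : Vacant e₁ e₂ r X Y) : Vacant e₂ e₁ r.swap X Y where
  w_lt := h.h_lt
  h_lt := h.w_lt
  notMem u v hu hu' hv hv' := by
    rw [add_right_comm]; exact h.notMem v u hv hv' hu hu'

/-- Two points of a state in the same row are equal. -/
lemma IsState.row_eq (hS : IsState e₁ e₂ S) {Q R : T} (hQ : Q ∈ S) (hR : R ∈ S) (s : ℤ)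
    (h : R = Q + s • e₁) : R = Q := by
  subst h; rw [hS.row_unique Q hQ s hR, add_zero]

/-- Two points of a state in the same column are equal. -/
lemma IsState.col_eq (hS : IsState e₁ e₂ S) {Q R : T} (hQ : Q ∈ S) (hR : R ∈ S) (t : ℤ)
    (h : R = Q + t • e₂) : R = Q := by
  subst h; rw [hS.col_unique Q hQ t hR, add_zero]

lemma IsState.w_smul_ne (hX : IsState e₁ e₂ X) (hc : r.c ∈ X) (hu : r.ur e₁ e₂ ∈ X)
    (hne : r.c ≠ r.ur e₁ e₂) : r.w • e₁ ≠ 0 := fun h =>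
  hne (hX.col_eq hc hu r.h (by simp [Rect.ur, h])).symm

lemma IsState.h_smul_ne (hX : IsState e₁ e₂ X) (hc : r.c ∈ X) (hu : r.ur e₁ e₂ ∈ X)
    (hne : r.c ≠ r.ur e₁ e₂) : r.h • e₂ ≠ 0 := fun h =>
  hne (hX.row_eq hc hu r.w (by simp [Rect.ur, h])).symm

namespace Joins

variable (h : Joins e₁ e₂ r X Y) (hX : IsState e₁ e₂ X)
include h hX

lemma w_ne : r.w • e₁ ≠ 0 := hX.w_smul_ne h.c_mem h.ur_mem h.ne

lemma h_ne : r.h • e₂ ≠ 0 := hX.h_smul_ne h.c_mem h.ur_mem h.ne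

lemma c_ne_lr : r.c ≠ r.lr e₁ := by simpa [Rect.lr] using h.w_ne hX
lemma c_ne_ul : r.c ≠ r.ul e₂ := by simpa [Rect.ul] using h.h_ne hX
lemma ur_ne_lr : r.ur e₁ e₂ ≠ r.lr e₁ := by simpa [Rect.lr, Rect.ur] using h.h_ne hX
lemma ur_ne_ul : r.ur e₁ e₂ ≠ r.ul e₂ := by
  simpa [Rect.ul, Rect.ur, add_right_comm] using h.w_ne hX

lemma c_notMem : r.c ∉ Y := by
  have := h.ind_sub r.c
  rw [if_pos rfl, if_neg h.ne.symm, if_neg (h.c_ne_lr hX).symm, if_neg (h.c_ne_ul hX).symm,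
    ind_of_mem h.c_mem] at this
  intro hc
  rw [ind_of_mem hc] at this
  omega

lemma ur_notMem : r.ur e₁ e₂ ∉ Y := by
  have := h.ind_sub (r.ur e₁ e₂)
  rw [if_pos rfl, if_neg h.ne, if_neg (h.ur_ne_lr hX).symm, if_neg (h.ur_ne_ul hX).symm,
    ind_of_mem h.ur_mem] at this
  intro hc
  rw [ind_of_mem hc] at this
  omega

lemma lr_mem_notMem : r.lr e₁ ∈ Y ∧ r.lr e₁ ∉ X ∧ r.lr e₁ ≠ r.ul e₂ := by
  have := h.ind_sub (r.lr e₁)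
  rw [if_pos rfl, if_neg (h.c_ne_lr hX), if_neg (h.ur_ne_lr hX)] at this
  unfold ind at this
  split_ifs at this with h1 h2 h3 h3 <;> simp_all [eq_comm]

lemma ul_mem_notMem : r.ul e₂ ∈ Y ∧ r.ul e₂ ∉ X := by
  have := h.ind_sub (r.ul e₂)
  rw [if_pos rfl, if_neg (h.c_ne_ul hX), if_neg (h.ur_ne_ul hX)] at this
  unfold ind at this
  split_ifs at this with h1 h2 h3 h3 <;> simp_all [eq_comm]

lemma lr_mem : r.lr e₁ ∈ Y := (h.lr_mem_notMem hX).1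
lemma lr_ne_ul : r.lr e₁ ≠ r.ul e₂ := (h.lr_mem_notMem hX).2.2
lemma ul_mem : r.ul e₂ ∈ Y := (h.ul_mem_notMem hX).1

omit hX in
lemma mem_iff_of_ne {Q : T} (h1 : Q ≠ r.c) (h2 : Q ≠ r.ur e₁ e₂) (h3 : Q ≠ r.lr e₁)
    (h4 : Q ≠ r.ul e₂) : Q ∈ X ↔ Q ∈ Y := by
  have := h.ind_sub Q
  rw [if_neg h1.symm, if_neg h2.symm, if_neg h3.symm, if_neg h4.symm] at this
  unfold ind at this
  split_ifs at this with a b b <;> simp_all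

lemma mem_target_iff {Q : T} :
    Q ∈ Y ↔ (Q ∈ X ∧ Q ≠ r.c ∧ Q ≠ r.ur e₁ e₂) ∨ Q = r.lr e₁ ∨ Q = r.ul e₂ := by
  by_cases h1 : Q = r.c
  · simp [h1, h.c_notMem hX, h.c_ne_lr hX, h.c_ne_ul hX]
  by_cases h2 : Q = r.ur e₁ e₂
  · simp [h2, h.ur_notMem hX, h.ur_ne_lr hX, h.ur_ne_ul hX]
  by_cases h3 : Q = r.lr e₁
  · simp [h3, h.lr_mem hX]
  by_cases h4 : Q = r.ul e₂
  · simp [h4, h.ul_mem hX]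
  simp [h.mem_iff_of_ne h1 h2 h3 h4, h1, h2, h3, h4]

end Joins

/-- Replacing two opposite corners of a rectangle in a state by the other two corners leaves one
point in each row. -/
lemma IsState.row_unique_move (hX : IsState e₁ e₂ X) (hc : r.c ∈ X) (hu : r.ur e₁ e₂ ∈ X)
    (hne : r.c ≠ r.ur e₁ e₂)
    (hY : ∀ Q, Q ∈ Y ↔ (Q ∈ X ∧ Q ≠ r.c ∧ Q ≠ r.ur e₁ e₂) ∨ Q = r.lr e₁ ∨ Q = r.ul e₂) :
    (∀ Q, ∃ s : ℤ, Q + s • e₁ ∈ Y) ∧ ∀ Q ∈ Y, ∀ s : ℤ, Q + s • e₁ ∈ Y → s • e₁ = 0 := by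
  have hul : r.ul e₂ = r.ur e₁ e₂ + (-r.w) • e₁ := by simp only [Rect.ul, Rect.ur, neg_smul]; abel
  have hlr : r.lr e₁ = r.c + r.w • e₁ := rfl
  -- each point of `Y` lies in the row of a point of `X`, which determines it
  have key : ∀ Q ∈ Y, ∃ R ∈ X, ∃ a : ℤ, Q = R + a • e₁ ∧
      ((R = r.c → Q = r.lr e₁) ∧ (R = r.ur e₁ e₂ → Q = r.ul e₂) ∧
        (R ≠ r.c → R ≠ r.ur e₁ e₂ → Q = R)) := by
    intro Q hQ
    rcases (hY Q).1 hQ with ⟨h1, h2, h3⟩ | h1 | h1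
    · exact ⟨Q, h1, 0, by simp, by simp [h2], by simp [h3], by simp⟩
    · exact ⟨r.c, hc, r.w, by rw [h1, hlr], by simp [h1], fun h => absurd h hne, by simp⟩
    · exact ⟨r.ur e₁ e₂, hu, -r.w, by rw [h1, hul], fun h => absurd h.symm hne, by simp [h1],
        by simp⟩
  constructor
  · intro Q
    obtain ⟨s, hs⟩ := hX.row_exists Q
    by_cases h1 : Q + s • e₁ = r.c
    · exact ⟨s + r.w, (hY _).2 (Or.inr (Or.inl (by rw [hlr, ← h1, add_smul]; abel)))⟩
    by_cases h2 : Q + s • e₁ = r.ur e₁ e₂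
    · exact ⟨s + -r.w, (hY _).2 (Or.inr (Or.inr (by rw [hul, ← h2, add_smul]; abel)))⟩
    exact ⟨s, (hY _).2 (Or.inl ⟨hs, h1, h2⟩)⟩
  · intro Q hQ s hs
    obtain ⟨R, hR, a, ha, h1, h2, h3⟩ := key Q hQ
    obtain ⟨R', hR', a', ha', h1', h2', h3'⟩ := key _ hs
    have hRR : R' = R := hX.row_eq hR hR' (a + s - a') (by
      have : R' = Q + s • e₁ - a' • e₁ := by rw [ha']; abel
      rw [this, ha, sub_smul, add_smul]; abel)
    subst hRR
    have : Q + s • e₁ = Q := by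
      by_cases c1 : R' = r.c
      · rw [h1' c1, h1 c1]
      by_cases c2 : R' = r.ur e₁ e₂
      · rw [h2' c2, h2 c2]
      rw [h3' c1 c2, ← h3 c1 c2]
    simpa using this

/-- Two different points of a state are the lower left and upper right corners of a rectangle that
joins it to some other state. -/
lemma IsState.exists_joins (hX : IsState e₁ e₂ X) (hw : 0 < r.w) (hh : 0 < r.h) (hc : r.c ∈ X)
    (hu : r.ur e₁ e₂ ∈ X) (hne : r.c ≠ r.ur e₁ e₂) :
    ∃ Y, IsState e₁ e₂ Y ∧ Joins e₁ e₂ r X Y := by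
  let Y : Finset T := insert (r.lr e₁) (insert (r.ul e₂) ((X.erase r.c).erase (r.ur e₁ e₂)))
  have hY : ∀ Q, Q ∈ Y ↔ (Q ∈ X ∧ Q ≠ r.c ∧ Q ≠ r.ur e₁ e₂) ∨ Q = r.lr e₁ ∨ Q = r.ul e₂ := by
    intro Q
    simp only [Y, Finset.mem_insert, Finset.mem_erase]
    tauto
  have h1 := hX.row_unique_move hc hu hne hY
  have h2 := hX.swap.row_unique_move (r := r.swap) (Y := Y) hc
    (by rw [Rect.ur_swap]; exact hu) (by rw [Rect.ur_swap]; exact hne) (by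
      intro Q
      rw [Rect.ur_swap, Rect.lr_swap, Rect.ul_swap, hY, or_comm (a := Q = r.lr e₁)]
      rfl)
  refine ⟨Y, ⟨h1.1, h2.1, h1.2, h2.2⟩, hw, hh, hc, hu, hne, fun Q => ?_⟩
  have hwe := hX.w_smul_ne hc hu hne
  have hhe := hX.h_smul_ne hc hu hne
  have a1 : r.c ≠ r.lr e₁ := by simpa [Rect.lr] using hwe
  have a2 : r.c ≠ r.ul e₂ := by simpa [Rect.ul] using hhe
  have a3 : r.ur e₁ e₂ ≠ r.lr e₁ := by simpa [Rect.lr, Rect.ur] using hhe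
  have a4 : r.ur e₁ e₂ ≠ r.ul e₂ := by simpa [Rect.ul, Rect.ur, add_right_comm] using hwe
  have b1 : r.lr e₁ ∉ X := fun h => a1 (hX.row_eq hc h r.w rfl).symm
  have b2 : r.ul e₂ ∉ X := fun h => a2 (hX.col_eq hc h r.h rfl).symm
  have b3 : r.lr e₁ ≠ r.ul e₂ := by
    intro h
    -- otherwise the two corners in `X` lie in the same row
    refine hne (hX.row_eq hc hu (r.w + r.w) ?_).symm
    have : r.ur e₁ e₂ = r.ul e₂ + r.w • e₁ := by simp only [Rect.ul, Rect.ur]; abel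
    rw [this, ← h, Rect.lr, add_smul]; abel
  unfold ind
  simp only [hY]
  by_cases c1 : r.c = Q
  · subst c1; simp [hc, hne.symm, a1, a2, a1.symm, a2.symm]
  by_cases c2 : r.ur e₁ e₂ = Q
  · subst c2; simp [hu, hne, a3, a4, a3.symm, a4.symm]
  by_cases c3 : r.lr e₁ = Q
  · subst c3; simp [a1, a3, b1, b3.symm]
  by_cases c4 : r.ul e₂ = Q
  · subst c4; simp [a2, a4, b2, b3]
  simp [c1, c2, c3, c4, Ne.symm c1, Ne.symm c2, Ne.symm c3, Ne.symm c4]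

/-- If the mixed difference of the multiplicities of a rectangle is the difference of two states,
then the rectangle joins them. -/
lemma joins_of_ind_sub (hw : 0 < r.w) (hh : 0 < r.h) (hwe : r.w • e₁ ≠ 0) (hhe : r.h • e₂ ≠ 0)
    (hne : r.c ≠ r.ur e₁ e₂)
    (h : ∀ Q, ind X Q - ind Y Q = r.cover e₁ e₂ Q - r.cover e₁ e₂ (Q - e₁)
      - r.cover e₁ e₂ (Q - e₂) + r.cover e₁ e₂ (Q - e₁ - e₂)) : Joins e₁ e₂ r X Y := by
  simp only [Rect.cover_corners] at h
  have a1 : r.lr e₁ ≠ r.c := by simpa [Rect.lr] using hwe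
  have a2 : r.ul e₂ ≠ r.c := by simpa [Rect.ul] using hhe
  have a3 : r.lr e₁ ≠ r.ur e₁ e₂ := by simpa [Rect.lr, Rect.ur] using hhe
  have a4 : r.ul e₂ ≠ r.ur e₁ e₂ := by simpa [Rect.ul, Rect.ur, add_right_comm] using hwe
  refine ⟨hw, hh, ?_, ?_, hne, h⟩
  · by_contra hc
    have := h r.c
    rw [if_pos rfl, if_neg hne.symm, if_neg a1, if_neg a2, ind_of_notMem hc] at this
    have := ind_nonneg Y r.c
    omega
  · by_contra hc
    have := h (r.ur e₁ e₂)
    rw [if_pos rfl, if_neg hne, if_neg a3, if_neg a4, ind_of_notMem hc] at this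
    have := ind_nonneg Y (r.ur e₁ e₂)
    omega

lemma Joins.ind_sub_cover (h : Joins e₁ e₂ r X Y) (Q : T) :
    ind X Q - ind Y Q = r.cover e₁ e₂ Q - r.cover e₁ e₂ (Q - e₁)
      - r.cover e₁ e₂ (Q - e₂) + r.cover e₁ e₂ (Q - e₁ - e₂) := by
  rw [h.ind_sub, Rect.cover_corners]

lemma eq_zero_of_smul {e : T} {s : ℤ} (h : s • e = 0) (hs : |s| < addOrderOf e) : s = 0 :=
  Int.eq_zero_of_abs_lt_dvd (addOrderOf_dvd_iff_zsmul_eq_zero.2 h) hs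

/-! ### The index of a rectangle -/

variable [Fintype T]

/-- The number of points of `X` in the rectangle without its left and bottom sides, plus the number
of points of `Y` in the rectangle without its right and top sides. It is `1` exactly for vacant
rectangles, and its sum over a decomposition of a polygon depends only on the polygon. -/
noncomputable def index (e₁ e₂ : T) (r : Rect T) (X Y : Finset T) : ℤ :=
  ∑ Q ∈ X, r.cover e₁ e₂ (Q - e₁ - e₂) + ∑ Q ∈ Y, r.cover e₁ e₂ Q

lemma sum_mem_eq (S : Finset T) (g : T → ℤ) : ∑ Q ∈ S, g Q = ∑ Q, ind S Q * g Q := by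
  simp [ind, Finset.sum_ite_mem]

lemma sum_shift (g : T → ℤ) (a : T) : ∑ Q, g (Q - a) = ∑ Q, g Q :=
  Fintype.sum_equiv (Equiv.subRight a) _ _ fun _ => rfl

/-- For composable rectangles the sum of the indices depends only on the ends `X` and `Z` and on the
sum of the multiplicities. With `f` and `g` the two multiplicities, the difference of the two sides
is the sum of `(ind Y - ind Z) f` minus the sum of `(ind X - ind Y) g(· - e₁ - e₂)`, which vanishes by
summation by parts. -/
lemma index_add_index (h₁ : Joins e₁ e₂ r₁ X Y) (h₂ : Joins e₁ e₂ r₂ Y Z) :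
    index e₁ e₂ r₁ X Y + index e₁ e₂ r₂ Y Z =
      ∑ Q ∈ X, (r₁.cover e₁ e₂ (Q - e₁ - e₂) + r₂.cover e₁ e₂ (Q - e₁ - e₂))
        + ∑ Q ∈ Z, (r₁.cover e₁ e₂ Q + r₂.cover e₁ e₂ Q) := by
  set f := r₁.cover e₁ e₂
  set g := r₂.cover e₁ e₂
  have d₁ : ∀ Q, ind X Q - ind Y Q = f Q - f (Q - e₁) - f (Q - e₂) + f (Q - e₁ - e₂) :=
    h₁.ind_sub_cover
  have d₂ : ∀ Q, ind Y Q - ind Z Q = g Q - g (Q - e₁) - g (Q - e₂) + g (Q - e₁ - e₂) :=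
    h₂.ind_sub_cover
  have s1 := sum_shift (fun Q => f Q * g (Q - e₂)) e₁
  have s2 := sum_shift (fun Q => f Q * g (Q - e₁)) e₂
  have s3 := sum_shift (fun Q => f Q * g Q) (e₁ + e₂)
  simp only [← sub_sub] at s1 s2 s3
  have s2' : ∑ Q, f (Q - e₂) * g (Q - e₁ - e₂) = ∑ Q, f Q * g (Q - e₁) := by
    rw [← s2]; simp only [sub_right_comm]
  have e1 : ∑ Q, (ind Y Q - ind Z Q) * f Q = ∑ Q, (ind X Q - ind Y Q) * g (Q - e₁ - e₂) := by
    simp only [d₁, d₂, add_mul, sub_mul, Finset.sum_add_distrib, Finset.sum_sub_distrib]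
    rw [s1, s2', s3]
    simp only [mul_comm (g _)]
    ring
  unfold index
  rw [sum_mem_eq X, sum_mem_eq Y, sum_mem_eq Y, sum_mem_eq Z, sum_mem_eq X, sum_mem_eq Z]
  simp only [mul_add, Finset.sum_add_distrib]
  simp only [sub_mul, Finset.sum_sub_distrib] at e1
  linarith

lemma sum_cover (S : Finset T) (hw : 0 ≤ r.w) (hh : 0 ≤ r.h) (D : T) :
    ∑ Q ∈ S, r.cover e₁ e₂ (Q - D) =
      ∑ u ∈ Finset.Ico 0 r.w, ∑ v ∈ Finset.Ico 0 r.h, ind S (r.c + u • e₁ + v • e₂ + D) := by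
  simp only [Rect.cover_of_nonneg e₁ e₂ hw hh]
  rw [Finset.sum_comm]
  refine Finset.sum_congr rfl fun u _ => ?_
  rw [Finset.sum_comm]
  refine Finset.sum_congr rfl fun v _ => ?_
  simp [ind, eq_sub_iff_add_eq]

lemma index_eq (hw : 0 ≤ r.w) (hh : 0 ≤ r.h) : index e₁ e₂ r X Y =
    ∑ u ∈ Finset.Ico 0 r.w, ∑ v ∈ Finset.Ico 0 r.h,
        (ind X (r.c + (u + 1) • e₁ + (v + 1) • e₂) + ind Y (r.c + u • e₁ + v • e₂)) := by
  unfold index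
  have h1 := sum_cover (r := r) (e₁ := e₁) (e₂ := e₂) X hw hh (e₁ + e₂)
  have h2 := sum_cover (r := r) (e₁ := e₁) (e₂ := e₂) Y hw hh 0
  simp only [← sub_sub, sub_zero, add_zero] at h1 h2
  simp only [h1, h2, Finset.sum_add_distrib, add_smul, one_smul]
  congr 1
  refine Finset.sum_congr rfl fun u _ => Finset.sum_congr rfl fun v _ => ?_
  congr 1
  abel

/-- The summand of `index_eq`. -/
def indexTerm (e₁ e₂ : T) (r : Rect T) (X Y : Finset T) (u v : ℤ) : ℤ :=
  ind X (r.c + (u + 1) • e₁ + (v + 1) • e₂) + ind Y (r.c + u • e₁ + v • e₂)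

lemma indexTerm_nonneg (u v : ℤ) : 0 ≤ indexTerm e₁ e₂ r X Y u v :=
  add_nonneg (ind_nonneg _ _) (ind_nonneg _ _)

lemma index_eq_sum (hw : 0 ≤ r.w) (hh : 0 ≤ r.h) : index e₁ e₂ r X Y =
    ∑ s ∈ Finset.Ico 0 r.w ×ˢ Finset.Ico 0 r.h, indexTerm e₁ e₂ r X Y s.1 s.2 := by
  rw [index_eq hw hh, Finset.sum_product]; rfl

lemma Joins.one_le_indexTerm (h : Joins e₁ e₂ r X Y) :
    1 ≤ indexTerm e₁ e₂ r X Y (r.w - 1) (r.h - 1) := by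
  have := ind_nonneg Y (r.c + (r.w - 1) • e₁ + (r.h - 1) • e₂)
  have h2 := ind_of_mem h.ur_mem
  simp only [indexTerm, sub_add_cancel]
  change ind X (r.c + r.w • e₁ + r.h • e₂) = 1 at h2
  omega

lemma Joins.one_le_index (h : Joins e₁ e₂ r X Y) : 1 ≤ index e₁ e₂ r X Y := by
  have h1 := h.w_pos
  have h2 := h.h_pos
  rw [index_eq_sum h1.le h2.le]
  refine h.one_le_indexTerm.trans
    (Finset.single_le_sum (f := fun s : ℤ × ℤ => indexTerm e₁ e₂ r X Y s.1 s.2)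
      (fun s _ => indexTerm_nonneg s.1 s.2) (a := (r.w - 1, r.h - 1)) ?_)
  simp only [Finset.mem_product, Finset.mem_Ico]
  omega

lemma Joins.indexTerm_eq_zero (h : Joins e₁ e₂ r X Y) (hi : index e₁ e₂ r X Y = 1) {u v : ℤ}
    (hu : 0 ≤ u) (hu' : u < r.w) (hv : 0 ≤ v) (hv' : v < r.h)
    (hne : (u, v) ≠ (r.w - 1, r.h - 1)) : indexTerm e₁ e₂ r X Y u v = 0 := by
  have h1 := h.w_pos
  have h2 := h.h_pos
  rw [index_eq_sum h1.le h2.le] at hi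
  have hsub : {(u, v), (r.w - 1, r.h - 1)} ⊆ Finset.Ico 0 r.w ×ˢ Finset.Ico 0 r.h := by
    intro s
    simp only [Finset.mem_insert, Finset.mem_singleton, Finset.mem_product, Finset.mem_Ico]
    rintro (rfl | rfl) <;> simp <;> omega
  have h3 := Finset.sum_le_sum_of_subset_of_nonneg
    (f := fun s : ℤ × ℤ => indexTerm e₁ e₂ r X Y s.1 s.2) hsub
    (fun s _ _ => indexTerm_nonneg s.1 s.2)
  rw [Finset.sum_pair hne] at h3
  have h4 := h.one_le_indexTerm
  have h5 := indexTerm_nonneg (e₁ := e₁) (e₂ := e₂) (r := r) (X := X) (Y := Y) u v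
  simp only at h3
  omega

/-- In a rectangle of index `1` the upper right corner is the only point that is counted. A side
that is longer than its circle would pass this corner a second time. -/
lemma Joins.vacant_of_index_eq_one (h : Joins e₁ e₂ r X Y) (hX : IsState e₁ e₂ X)
    (hi : index e₁ e₂ r X Y = 1) : Vacant e₁ e₂ r X Y := by
  have h1 := h.w_pos
  have h2 := h.h_pos
  have hz : ∀ u v : ℤ, indexTerm e₁ e₂ r X Y u v = 0 →
      r.c + (u + 1) • e₁ + (v + 1) • e₂ ∉ X ∧ r.c + u • e₁ + v • e₂ ∉ Y := by
    intro u v h0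
    have n1 := ind_nonneg X (r.c + (u + 1) • e₁ + (v + 1) • e₂)
    have n2 := ind_nonneg Y (r.c + u • e₁ + v • e₂)
    unfold indexTerm at h0
    constructor
    · intro hm; rw [ind_of_mem hm] at h0; omega
    · intro hm; rw [ind_of_mem hm] at h0; omega
  refine ⟨?_, ?_, fun u v hu hu' hv hv' => ?_⟩
  · by_contra hlt
    have hpos : 0 < addOrderOf e₁ := addOrderOf_pos e₁
    have hne : r.w ≠ addOrderOf e₁ := by
      intro he
      exact h.w_ne hX (by rw [he]; exact_mod_cast addOrderOf_nsmul_eq_zero e₁)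
    refine (hz (r.w - 1 - addOrderOf e₁) (r.h - 1) (h.indexTerm_eq_zero hi (by omega) (by omega)
      (by omega) (by omega) fun he => by have := (Prod.mk.inj he).1; omega)).1 ?_
    have := h.ur_mem
    rw [show r.w - 1 - (addOrderOf e₁ : ℤ) + 1 = r.w - (addOrderOf e₁ : ℤ) by ring,
      show r.h - 1 + 1 = r.h by ring, sub_smul, natCast_zsmul, addOrderOf_nsmul_eq_zero, sub_zero]
    exact this
  · by_contra hlt
    have hpos : 0 < addOrderOf e₂ := addOrderOf_pos e₂
    have hne : r.h ≠ addOrderOf e₂ := by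
      intro he
      exact h.h_ne hX (by rw [he]; exact_mod_cast addOrderOf_nsmul_eq_zero e₂)
    refine (hz (r.w - 1) (r.h - 1 - addOrderOf e₂) (h.indexTerm_eq_zero hi (by omega) (by omega)
      (by omega) (by omega) fun he => by have := (Prod.mk.inj he).2; omega)).1 ?_
    have := h.ur_mem
    rw [show r.h - 1 - (addOrderOf e₂ : ℤ) + 1 = r.h - (addOrderOf e₂ : ℤ) by ring,
      show r.w - 1 + 1 = r.w by ring, sub_smul (r.h), natCast_zsmul, addOrderOf_nsmul_eq_zero,
      sub_zero]
    exact this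
  · constructor
    · have := (hz (u - 1) (v - 1) (h.indexTerm_eq_zero hi (by omega) (by omega)
        (by omega) (by omega) (by simp; omega))).1
      simpa using this
    · by_cases hne : (u, v) = (r.w - 1, r.h - 1)
      · -- the summand of this position already counts the upper right corner
        obtain ⟨rfl, rfl⟩ := Prod.mk.inj hne
        have h3 := hi
        rw [index_eq_sum h1.le h2.le] at h3
        have h4 := Finset.single_le_sum
          (f := fun s : ℤ × ℤ => indexTerm e₁ e₂ r X Y s.1 s.2)
          (s := Finset.Ico 0 r.w ×ˢ Finset.Ico 0 r.h)
          (fun s _ => indexTerm_nonneg s.1 s.2) (a := (r.w - 1, r.h - 1))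
          (by simp only [Finset.mem_product, Finset.mem_Ico]; omega)
        intro hm
        simp only [indexTerm, sub_add_cancel] at h3 h4
        rw [h3, ind_of_mem hm, show r.c + r.w • e₁ + r.h • e₂ = r.ur e₁ e₂ from rfl,
          ind_of_mem h.ur_mem] at h4
        omega
      · exact (hz u v (h.indexTerm_eq_zero hi (by omega) (by omega) (by omega) (by omega) hne)).2

/-- In a vacant rectangle only the upper right corner is counted by the index: a further point of
`X` or `Y` would lie in the interior, or on a side in the row or column of a corner. -/
lemma Joins.index_eq_one (h : Joins e₁ e₂ r X Y) (hX : IsState e₁ e₂ X) (hY : IsState e₁ e₂ Y)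
    (hv : Vacant e₁ e₂ r X Y) : index e₁ e₂ r X Y = 1 := by
  have h1 := h.w_pos
  have h2 := h.h_pos
  have hw := hv.w_lt
  have hh := hv.h_lt
  have hX0 : ∀ u v : ℤ, 0 < u → u ≤ r.w → 0 < v → v ≤ r.h → (u, v) ≠ (r.w, r.h) →
      r.c + u • e₁ + v • e₂ ∉ X := by
    intro u v hu hu' hv1 hv' hne hm
    rcases hu'.lt_or_eq with hu' | rfl
    · rcases hv'.lt_or_eq with hv' | rfl
      · exact (hv.notMem u v hu hu' hv1 hv').1 hm
      · have := hX.row_unique _ hm (r.w - u) (by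
          have := h.ur_mem
          rw [Rect.ur] at this
          convert this using 1
          rw [sub_smul]; abel)
        have := eq_zero_of_smul this (by rw [abs_lt]; omega)
        omega
    · have := hX.col_unique _ hm (r.h - v) (by
          have := h.ur_mem
          rw [Rect.ur] at this
          convert this using 1
          rw [sub_smul]; abel)
      have := eq_zero_of_smul this (by rw [abs_lt]; omega)
      apply hne
      simp; omega
  have hY0 : ∀ u v : ℤ, 0 ≤ u → u < r.w → 0 ≤ v → v < r.h → r.c + u • e₁ + v • e₂ ∉ Y := by
    intro u v hu hu' hv1 hv' hm
    rcases hu.lt_or_eq with hu | rfl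
    · rcases hv1.lt_or_eq with hv1 | rfl
      · exact (hv.notMem u v hu hu' hv1 hv').2 hm
      · have := hY.row_unique _ hm (r.w - u) (by
          have := h.lr_mem hX
          rw [Rect.lr] at this
          convert this using 1
          rw [sub_smul, zero_smul]; abel)
        have := eq_zero_of_smul this (by rw [abs_lt]; omega)
        omega
    · have := hY.col_unique _ hm (r.h - v) (by
          have := h.ul_mem hX
          rw [Rect.ul] at this
          convert this using 1
          rw [sub_smul, zero_smul]; abel)
      have := eq_zero_of_smul this (by rw [abs_lt]; omega)
      omega
  rw [index_eq_sum h1.le h2.le, Finset.sum_eq_single (r.w - 1, r.h - 1)]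
  · simp only [indexTerm, sub_add_cancel]
    rw [ind_of_notMem (hY0 _ _ (by omega) (by omega) (by omega) (by omega)),
      show r.c + r.w • e₁ + r.h • e₂ = r.ur e₁ e₂ from rfl, ind_of_mem h.ur_mem, add_zero]
  · rintro ⟨u, v⟩ hs hne
    simp only [Finset.mem_product, Finset.mem_Ico] at hs
    simp only [indexTerm]
    rw [ind_of_notMem (hX0 _ _ (by omega) (by omega) (by omega) (by omega) ?_),
      ind_of_notMem (hY0 _ _ (by omega) (by omega) (by omega) (by omega)), add_zero]
    intro he
    obtain ⟨he1, he2⟩ := Prod.mk.inj he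
    exact hne (Prod.ext (by simp; omega) (by simp; omega))
  · intro hn
    exact absurd (by simp only [Finset.mem_product, Finset.mem_Ico]; omega) hn

/-- If one decomposition of a polygon consists of vacant rectangles, then all do. -/
lemma vacant_of_cover_eq {Y' : Finset T} {r₁' r₂' : Rect T} (hX : IsState e₁ e₂ X)
    (hY : IsState e₁ e₂ Y) (hY' : IsState e₁ e₂ Y') (hZ : IsState e₁ e₂ Z)
    (h₁ : Joins e₁ e₂ r₁ X Y) (h₂ : Joins e₁ e₂ r₂ Y Z)
    (v₁ : Vacant e₁ e₂ r₁ X Y) (v₂ : Vacant e₁ e₂ r₂ Y Z)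
    (h₁' : Joins e₁ e₂ r₁' X Y') (h₂' : Joins e₁ e₂ r₂' Y' Z)
    (h : ∀ C, r₁'.cover e₁ e₂ C + r₂'.cover e₁ e₂ C = r₁.cover e₁ e₂ C + r₂.cover e₁ e₂ C) :
    Vacant e₁ e₂ r₁' X Y' ∧ Vacant e₁ e₂ r₂' Y' Z := by
  have a := index_add_index h₁ h₂
  have b := index_add_index h₁' h₂'
  simp only [h] at b
  rw [h₁.index_eq_one hX hY v₁, h₂.index_eq_one hY hZ v₂, ← b] at a
  have := h₁'.one_le_index
  have := h₂'.one_le_index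
  exact ⟨h₁'.vacant_of_index_eq_one hX (by omega), h₂'.vacant_of_index_eq_one hY' (by omega)⟩

end TorusGrid

namespace TorusGrid

variable {T : Type*} [AddCommGroup T] [DecidableEq T] {e₁ e₂ : T} {X Y Z : Finset T}
  {ψ : T → ℤ}

/-! ### Decompositions of polygons -/

/-- A state and two rectangles: the data of a decomposition of a polygon. -/
@[ext] structure Decomp (T : Type*) where
  /-- the intermediate state -/
  mid : Finset T
  /-- the first rectangle -/
  fst : Rect T
  /-- the second rectangle -/
  snd : Rect T

/-- `d` is a decomposition of the polygon `ψ` from `X` to `Z` into two vacant rectangles. -/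
structure IsDecomp (e₁ e₂ : T) (X Z : Finset T) (ψ : T → ℤ) (d : Decomp T) : Prop where
  state : IsState e₁ e₂ d.mid
  joins₁ : Joins e₁ e₂ d.fst X d.mid
  joins₂ : Joins e₁ e₂ d.snd d.mid Z
  vacant₁ : Vacant e₁ e₂ d.fst X d.mid
  vacant₂ : Vacant e₁ e₂ d.snd d.mid Z
  cover_add : ∀ C, d.fst.cover e₁ e₂ C + d.snd.cover e₁ e₂ C = ψ C

/-- The two rectangles share a corner in the intermediate state and lie next to each other. -/
def Decomp.Beside (e₁ e₂ : T) (d : Decomp T) : Prop :=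
  d.snd.c = d.fst.lr e₁ ∨ d.snd.ur e₁ e₂ = d.fst.ul e₂

/-- the decomposition seen after the exchange of the two directions -/
def Decomp.swap (d : Decomp T) : Decomp T := ⟨d.mid, d.fst.swap, d.snd.swap⟩

/-- The two rectangles share a corner in the intermediate state and lie above each other. -/
def Decomp.Above (e₁ e₂ : T) (d : Decomp T) : Prop := d.swap.Beside e₂ e₁

lemma IsDecomp.swap {d : Decomp T} (h : IsDecomp e₁ e₂ X Z ψ d) :
    IsDecomp e₂ e₁ X Z ψ d.swap where
  state := h.state.swap
  joins₁ := h.joins₁.swap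
  joins₂ := h.joins₂.swap
  vacant₁ := h.vacant₁.swap
  vacant₂ := h.vacant₂.swap
  cover_add C := by
    rw [← h.cover_add]
    simp only [Decomp.swap, Rect.cover_swap]

lemma Joins.target_unique {r : Rect T} {Y' : Finset T} (h : Joins e₁ e₂ r X Y)
    (h' : Joins e₁ e₂ r X Y') (hX : IsState e₁ e₂ X) : Y = Y' := by
  ext Q
  rw [h.mem_target_iff hX, h'.mem_target_iff hX]

lemma IsDecomp.ext_rects {d d' : Decomp T} (h : IsDecomp e₁ e₂ X Z ψ d)
    (h' : IsDecomp e₁ e₂ X Z ψ d') (hX : IsState e₁ e₂ X) (h1 : d.fst = d'.fst)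
    (h2 : d.snd = d'.snd) : d = d' :=
  Decomp.ext (h.joins₁.target_unique (h1 ▸ h'.joins₁) hX) h1 h2

/-- Two nondegenerate rectangles that start with two points of `X` and have the multiplicities of a
decomposed polygon in total form a decomposition of it. In particular they are vacant. -/
lemma IsDecomp.exists_of_cover_eq [Fintype T] {d : Decomp T} (h : IsDecomp e₁ e₂ X Z ψ d)
    (hX : IsState e₁ e₂ X) (hZ : IsState e₁ e₂ Z) (r₁ r₂ : Rect T)
    (hw₁ : 0 < r₁.w) (hh₁ : 0 < r₁.h) (hw₂ : 0 < r₂.w) (hh₂ : 0 < r₂.h)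
    (hc : r₁.c ∈ X) (hu : r₁.ur e₁ e₂ ∈ X) (hne : r₁.c ≠ r₁.ur e₁ e₂)
    (hwe : r₂.w • e₁ ≠ 0) (hhe : r₂.h • e₂ ≠ 0) (hne₂ : r₂.c ≠ r₂.ur e₁ e₂)
    (hψ : ∀ C, r₁.cover e₁ e₂ C + r₂.cover e₁ e₂ C =
      d.fst.cover e₁ e₂ C + d.snd.cover e₁ e₂ C) :
    ∃ Y, IsDecomp e₁ e₂ X Z ψ ⟨Y, r₁, r₂⟩ := by
  obtain ⟨Y, hY, j₁⟩ := hX.exists_joins hw₁ hh₁ hc hu hne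
  have j₂ : Joins e₁ e₂ r₂ Y Z := by
    refine joins_of_ind_sub hw₂ hh₂ hwe hhe hne₂ fun Q => ?_
    have a1 := h.joins₁.ind_sub_cover Q
    have a2 := h.joins₂.ind_sub_cover Q
    have a3 := j₁.ind_sub_cover Q
    have b1 := hψ Q
    have b2 := hψ (Q - e₁)
    have b3 := hψ (Q - e₂)
    have b4 := hψ (Q - e₁ - e₂)
    linarith
  obtain ⟨v₁, v₂⟩ := vacant_of_cover_eq hX h.state hY hZ h.joins₁ h.joins₂ h.vacant₁ h.vacant₂
    j₁ j₂ hψ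
  exact ⟨Y, hY, j₁, j₂, v₁, v₂, fun C => by rw [← h.cover_add]; exact hψ C⟩

/-! ### Displacements -/

/-- the indicator function of a coset of the subgroup generated by `e` -/
noncomputable def coset (e P Q : T) : ℤ :=
  open Classical in if P - Q ∈ AddSubgroup.zmultiples e then 1 else 0

lemma coset_add (e P Q : T) (s : ℤ) : coset e (P + s • e) Q = coset e P Q := by
  unfold coset
  have : P + s • e - Q = s • e + (P - Q) := by abel
  simp only [this, AddSubgroup.add_mem_cancel_left _ (AddSubgroup.zsmul_mem_zmultiples e s)]

lemma coset_congr {e P P' : T} (s : ℤ) (h : P' = P + s • e) (Q : T) :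
    coset e P' Q = coset e P Q := by rw [h, coset_add]

lemma IsState.coset_row (hS : IsState e₁ e₂ X) {P Q : T} (hP : P ∈ X) (hQ : Q ∈ X) :
    coset e₁ P Q = if P = Q then 1 else 0 := by
  unfold coset
  congr 1
  rw [AddSubgroup.mem_zmultiples_iff]
  refine propext ⟨fun ⟨k, hk⟩ => hS.row_eq hQ hP k (by rw [hk]; abel), ?_⟩
  rintro rfl
  exact ⟨0, by simp⟩

lemma IsState.coset_col (hS : IsState e₁ e₂ X) {P Q : T} (hP : P ∈ X) (hQ : Q ∈ X) :
    coset e₂ P Q = if P = Q then 1 else 0 := hS.swap.coset_row hP hQ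

variable [Fintype T]

/-- The total signed length of the horizontal boundary of `ψ` along the row of `Q`. It is the
displacement of the point in this row under the moves along the rectangles that make up `ψ`. -/
noncomputable def disp (e₁ e₂ : T) (ψ : T → ℤ) (Q : T) : ℤ :=
  ∑ C, coset e₁ C Q * (ψ C - ψ (C - e₂))

lemma disp_cover {r : Rect T} (hw : 0 ≤ r.w) (Q : T) :
    disp e₁ e₂ (r.cover e₁ e₂) Q = r.w * (coset e₁ r.c Q - coset e₁ (r.ur e₁ e₂) Q) := by
  have h1 (s : ℤ) (P : T) : ∑ C, coset e₁ C Q * (if P + s • e₁ = C then 1 else 0)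
      = coset e₁ P Q := by
    simp [coset_add]
  have h2 (s : ℤ) (P P' : T) : ∑ C, coset e₁ C Q * (if P + s • e₁ + P' = C then 1 else 0)
      = coset e₁ (P + P') Q := by
    rw [add_right_comm, h1]
  unfold disp
  simp only [Rect.cover_sub_vertical, isum_of_nonneg _ hw, Finset.mul_sum, mul_sub]
  rw [Finset.sum_comm]
  simp only [Finset.sum_sub_distrib, h1, h2]
  simp only [Finset.sum_const, Int.card_Ico, nsmul_eq_mul]
  have h3 : coset e₁ (r.ur e₁ e₂) Q = coset e₁ (r.c + r.h • e₂) Q := by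
    rw [Rect.ur, add_right_comm, coset_add]
  rw [h3]
  have : ((r.w - 0).toNat : ℤ) = r.w := by omega
  rw [this]

lemma IsDecomp.disp_row {d : Decomp T} (h : IsDecomp e₁ e₂ X Z ψ d) (Q : T) :
    disp e₁ e₂ ψ Q = d.fst.w * (coset e₁ d.fst.c Q - coset e₁ (d.fst.ur e₁ e₂) Q)
      + d.snd.w * (coset e₁ d.snd.c Q - coset e₁ (d.snd.ur e₁ e₂) Q) := by
  rw [← disp_cover h.joins₁.w_pos.le, ← disp_cover h.joins₂.w_pos.le]
  unfold disp
  rw [← Finset.sum_add_distrib]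
  refine Finset.sum_congr rfl fun C _ => ?_
  rw [← h.cover_add, ← h.cover_add]
  ring

lemma IsDecomp.disp_col {d : Decomp T} (h : IsDecomp e₁ e₂ X Z ψ d) (Q : T) :
    disp e₂ e₁ ψ Q = d.fst.h * (coset e₂ d.fst.c Q - coset e₂ (d.fst.ur e₁ e₂) Q)
      + d.snd.h * (coset e₂ d.snd.c Q - coset e₂ (d.snd.ur e₁ e₂) Q) := by
  have := h.swap.disp_row Q
  simp only [Decomp.swap, Rect.ur_swap] at this
  exact this

/-! ### Decompositions into rectangles without a common corner -/

section Apart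

variable {d d' : Decomp T} (hX : IsState e₁ e₂ X) (h : IsDecomp e₁ e₂ X Z ψ d)
include hX h

/-- Only corners of the two rectangles are moved. -/
lemma IsDecomp.notMem_target {Q : T} (hQX : Q ∈ X) (hQZ : Q ∉ Z) :
    Q = d.fst.c ∨ Q = d.fst.ur e₁ e₂ ∨ Q = d.snd.c ∨ Q = d.snd.ur e₁ e₂ := by
  by_contra! hne
  obtain ⟨h1, h2, h3, h4⟩ := hne
  have hY : Q ∈ d.mid := (h.joins₁.mem_target_iff hX).2 (Or.inl ⟨hQX, h1, h2⟩)
  exact hQZ ((h.joins₂.mem_target_iff h.state).2 (Or.inl ⟨hY, h3, h4⟩))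

variable (hc : d.snd.c ∈ X) (hu : d.snd.ur e₁ e₂ ∈ X)
include hc hu

/-- The four moved points are distinct. -/
lemma IsDecomp.apart_ne : d.fst.c ≠ d.snd.c ∧ d.fst.c ≠ d.snd.ur e₁ e₂ ∧
    d.fst.ur e₁ e₂ ≠ d.snd.c ∧ d.fst.ur e₁ e₂ ≠ d.snd.ur e₁ e₂ := by
  have h1 := h.joins₁.c_notMem hX
  have h2 := h.joins₁.ur_notMem hX
  have h3 := h.joins₂.c_mem
  have h4 := h.joins₂.ur_mem
  exact ⟨fun he => h1 (he ▸ h3), fun he => h1 (he ▸ h4), fun he => h2 (he ▸ h3),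
    fun he => h2 (he ▸ h4)⟩

lemma IsDecomp.apart_notMem : d.fst.c ∉ Z ∧ d.fst.ur e₁ e₂ ∉ Z ∧ d.snd.c ∉ Z ∧
    d.snd.ur e₁ e₂ ∉ Z := by
  obtain ⟨n1, n2, n3, n4⟩ := h.apart_ne hX hc hu
  have key : ∀ Q ∈ X, Q ∉ d.mid → Q ≠ d.snd.c → Q ≠ d.snd.ur e₁ e₂ → Q ∉ Z := by
    intro Q hQ hQm hne1 hne2 hQZ
    rcases (h.joins₂.mem_target_iff h.state).1 hQZ with h1 | h1 | h1
    · exact hQm h1.1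
    · exact hne1 (hX.row_eq hc hQ d.snd.w h1)
    · exact hne1 (hX.col_eq hc hQ d.snd.h h1)
  exact ⟨key _ h.joins₁.c_mem (h.joins₁.c_notMem hX) n1 n2,
    key _ h.joins₁.ur_mem (h.joins₁.ur_notMem hX) n3 n4,
    h.joins₂.c_notMem h.state, h.joins₂.ur_notMem h.state⟩

/-- Whether the rectangles have a common corner depends only on the polygon, since it can be read
off from the number of points of `X` that do not lie in `Z`. -/
lemma IsDecomp.apart_of_apart (h' : IsDecomp e₁ e₂ X Z ψ d') :
    d'.snd.c ∈ X ∧ d'.snd.ur e₁ e₂ ∈ X := by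
  obtain ⟨n1, n2, n3, n4⟩ := h.apart_ne hX hc hu
  obtain ⟨m1, m2, m3, m4⟩ := h.apart_notMem hX hc hu
  have n5 := h.joins₁.ne
  have n6 := h.joins₂.ne
  have a1 := h'.notMem_target hX h.joins₁.c_mem m1
  have a2 := h'.notMem_target hX h.joins₁.ur_mem m2
  have a3 := h'.notMem_target hX hc m3
  have a4 := h'.notMem_target hX hu m4
  have b1 := h.joins₁.c_mem
  have b2 := h.joins₁.ur_mem
  -- four distinct points are among the four moved points of `d'`, so all of these lie in `X`
  have hsub : ({d.fst.c, d.fst.ur e₁ e₂, d.snd.c, d.snd.ur e₁ e₂} : Finset T) ⊆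
      {d'.fst.c, d'.fst.ur e₁ e₂, d'.snd.c, d'.snd.ur e₁ e₂} := by
    intro Q
    simp only [Finset.mem_insert, Finset.mem_singleton]
    rintro (rfl | rfl | rfl | rfl) <;> assumption
  have hcard : ({d.fst.c, d.fst.ur e₁ e₂, d.snd.c, d.snd.ur e₁ e₂} : Finset T).card = 4 := by
    rw [Finset.card_insert_of_notMem, Finset.card_insert_of_notMem, Finset.card_pair n6] <;>
    simp [n1, n2, n3, n4, n5]
  have heq := Finset.eq_of_subset_of_card_le hsub (by rw [hcard]; exact Finset.card_le_four)
  have hXs : ∀ Q ∈ ({d'.fst.c, d'.fst.ur e₁ e₂, d'.snd.c, d'.snd.ur e₁ e₂} : Finset T),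
      Q ∈ X := by
    rw [← heq]
    intro Q
    simp only [Finset.mem_insert, Finset.mem_singleton]
    rintro (rfl | rfl | rfl | rfl) <;> assumption
  exact ⟨hXs _ (by simp), hXs _ (by simp)⟩

/-- Two decompositions into rectangles without common corners either agree, or differ by the order
of the rectangles. -/
lemma IsDecomp.apart_unique (h' : IsDecomp e₁ e₂ X Z ψ d') :
    (d'.fst = d.fst ∧ d'.snd = d.snd) ∨ (d'.fst = d.snd ∧ d'.snd = d.fst) := by
  obtain ⟨hc', hu'⟩ := h.apart_of_apart hX hc hu h'
  obtain ⟨n1, n2, n3, n4⟩ := h.apart_ne hX hc hu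
  obtain ⟨n1', n2', n3', n4'⟩ := h'.apart_ne hX hc' hu'
  have n5 := h.joins₁.ne
  have n6 := h.joins₂.ne
  have n5' := h'.joins₁.ne
  have n6' := h'.joins₂.ne
  have w1 := h.joins₁.w_pos
  have w2 := h.joins₂.w_pos
  have w1' := h'.joins₁.w_pos
  have w2' := h'.joins₂.w_pos
  have b1 := h.joins₁.c_mem
  have b2 := h.joins₁.ur_mem
  have b1' := h'.joins₁.c_mem
  have b2' := h'.joins₁.ur_mem
  -- the displacements of the points of `X` in the rows and in the columns determine the rectangles
  have D : ∀ U ∈ X, d.fst.w * ((if d.fst.c = U then 1 else 0)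
      - if d.fst.ur e₁ e₂ = U then 1 else 0) + d.snd.w * ((if d.snd.c = U then 1 else 0)
      - if d.snd.ur e₁ e₂ = U then 1 else 0) = d'.fst.w * ((if d'.fst.c = U then 1 else 0)
      - if d'.fst.ur e₁ e₂ = U then 1 else 0) + d'.snd.w * ((if d'.snd.c = U then 1 else 0)
      - if d'.snd.ur e₁ e₂ = U then 1 else 0) := by
    intro U hU
    simp only [← hX.coset_row, *]
    rw [← h.disp_row, ← h'.disp_row]
  have E : ∀ U ∈ X, d.fst.h * ((if d.fst.c = U then 1 else 0)
      - if d.fst.ur e₁ e₂ = U then 1 else 0) + d.snd.h * ((if d.snd.c = U then 1 else 0)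
      - if d.snd.ur e₁ e₂ = U then 1 else 0) = d'.fst.h * ((if d'.fst.c = U then 1 else 0)
      - if d'.fst.ur e₁ e₂ = U then 1 else 0) + d'.snd.h * ((if d'.snd.c = U then 1 else 0)
      - if d'.snd.ur e₁ e₂ = U then 1 else 0) := by
    intro U hU
    simp only [← hX.coset_col, *]
    rw [← h.disp_col, ← h'.disp_col]
  have D1 := D _ b1
  have D2 := D _ hc
  have E1 := E _ b1
  have E2 := E _ hc
  clear D E
  simp only [Rect.ext_iff]
  generalize d.fst.ur e₁ e₂ = q at *
  generalize d.snd.ur e₁ e₂ = s at *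
  generalize d'.fst.ur e₁ e₂ = q' at *
  generalize d'.snd.ur e₁ e₂ = s' at *
  generalize d.fst.c = p at *
  generalize d.snd.c = r at *
  generalize d'.fst.c = p' at *
  generalize d'.snd.c = r' at *
  clear h h'
  simp only [mul_sub, mul_ite, mul_one, mul_zero] at D1 D2 E1 E2
  grind (splits := 20)

lemma IsDecomp.exists_unique_of_apart (hZ : IsState e₁ e₂ Z) : ∃ d', d' ≠ d ∧
    IsDecomp e₁ e₂ X Z ψ d' ∧ ∀ d'', IsDecomp e₁ e₂ X Z ψ d'' → d'' = d ∨ d'' = d' := by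
  obtain ⟨n1, n2, n3, n4⟩ := h.apart_ne hX hc hu
  obtain ⟨Y, hY⟩ := h.exists_of_cover_eq hX hZ d.snd d.fst h.joins₂.w_pos h.joins₂.h_pos
    h.joins₁.w_pos h.joins₁.h_pos hc hu h.joins₂.ne (h.joins₁.w_ne hX) (h.joins₁.h_ne hX)
    h.joins₁.ne (fun C => add_comm _ _)
  refine ⟨_, ?_, hY, fun d'' h'' => ?_⟩
  · intro he
    exact n1 (congrArg (fun x : Decomp T => x.snd.c) he)
  · rcases h.apart_unique hX hc hu h'' with ⟨a, b⟩ | ⟨a, b⟩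
    · exact Or.inl (h''.ext_rects h hX a b)
    · exact Or.inr (h''.ext_rects hY hX a b)

end Apart

end TorusGrid

namespace TorusGrid

variable {T : Type*} [AddCommGroup T] [DecidableEq T] {e₁ e₂ : T} {X Y Z : Finset T}
  {ψ : T → ℤ} [Fintype T]

/-! ### Decompositions into rectangles with a common corner -/

section Beside

variable {d d' : Decomp T} (hX : IsState e₁ e₂ X) (h : IsDecomp e₁ e₂ X Z ψ d)

include hX h

/-- If the second rectangle begins at the lower right corner of the first, then its upper right
corner is the upper left corner of the first one, or it is a point of `X` that the first rectangle
does not move. -/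
lemma IsDecomp.ur_mem_of_lr (hc : d.snd.c = d.fst.lr e₁)
    (hu : d.snd.ur e₁ e₂ ≠ d.fst.ul e₂) : d.snd.ur e₁ e₂ ∈ X ∧
      d.snd.ur e₁ e₂ ≠ d.fst.c ∧ d.snd.ur e₁ e₂ ≠ d.fst.ur e₁ e₂ := by
  rcases (h.joins₁.mem_target_iff hX).1 h.joins₂.ur_mem with h1 | h1 | h1
  · exact h1
  · exact absurd (h1.trans hc.symm) h.joins₂.ne.symm
  · exact absurd h1 hu

/-- If the second rectangle ends at the upper left corner of the first, then its lower left corner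
is the lower right corner of the first one, or it is a point of `X` that the first rectangle does
not move. -/
lemma IsDecomp.c_mem_of_ul (hu : d.snd.ur e₁ e₂ = d.fst.ul e₂)
    (hc : d.snd.c ≠ d.fst.lr e₁) : d.snd.c ∈ X ∧
      d.snd.c ≠ d.fst.c ∧ d.snd.c ≠ d.fst.ur e₁ e₂ := by
  rcases (h.joins₁.mem_target_iff hX).1 h.joins₂.c_mem with h1 | h1 | h1
  · exact h1
  · exact absurd h1 hc
  · exact absurd (h1.trans hu.symm) h.joins₂.ne

/-- The displacements when the second rectangle begins at the lower right corner of the first. -/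
lemma IsDecomp.disp_of_lr (hc : d.snd.c = d.fst.lr e₁)
    (hu : d.snd.ur e₁ e₂ ≠ d.fst.ul e₂) {U : T} (hU : U ∈ X) :
    disp e₁ e₂ ψ U = (d.fst.w + d.snd.w) * (if d.fst.c = U then 1 else 0)
      - d.fst.w * (if d.fst.ur e₁ e₂ = U then 1 else 0)
      - d.snd.w * (if d.snd.ur e₁ e₂ = U then 1 else 0) ∧
    disp e₂ e₁ ψ U = d.fst.h * (if d.fst.c = U then 1 else 0)
      + (d.snd.h - d.fst.h) * (if d.fst.ur e₁ e₂ = U then 1 else 0)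
      - d.snd.h * (if d.snd.ur e₁ e₂ = U then 1 else 0) := by
  have h1 := (h.ur_mem_of_lr hX hc hu).1
  rw [h.disp_row, h.disp_col, hX.coset_row h.joins₁.c_mem hU, hX.coset_row h.joins₁.ur_mem hU,
    hX.coset_row h1 hU, hX.coset_col h.joins₁.c_mem hU, hX.coset_col h.joins₁.ur_mem hU,
    hX.coset_col h1 hU, coset_congr d.fst.w hc, hX.coset_row h.joins₁.c_mem hU,
    coset_congr (P := d.fst.ur e₁ e₂) (-d.fst.h) (by rw [hc, Rect.lr, Rect.ur]; module),
    hX.coset_col h.joins₁.ur_mem hU]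
  constructor <;> ring

/-- The displacements when the second rectangle ends at the upper left corner of the first. -/
lemma IsDecomp.disp_of_ul (hu : d.snd.ur e₁ e₂ = d.fst.ul e₂)
    (hc : d.snd.c ≠ d.fst.lr e₁) {U : T} (hU : U ∈ X) :
    disp e₁ e₂ ψ U = d.fst.w * (if d.fst.c = U then 1 else 0)
      - (d.fst.w + d.snd.w) * (if d.fst.ur e₁ e₂ = U then 1 else 0)
      + d.snd.w * (if d.snd.c = U then 1 else 0) ∧
    disp e₂ e₁ ψ U = (d.fst.h - d.snd.h) * (if d.fst.c = U then 1 else 0)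
      - d.fst.h * (if d.fst.ur e₁ e₂ = U then 1 else 0)
      + d.snd.h * (if d.snd.c = U then 1 else 0) := by
  have h1 := (h.c_mem_of_ul hX hu hc).1
  rw [h.disp_row, h.disp_col, hX.coset_row h.joins₁.c_mem hU, hX.coset_row h.joins₁.ur_mem hU,
    hX.coset_row h1 hU, hX.coset_col h.joins₁.c_mem hU, hX.coset_col h.joins₁.ur_mem hU,
    hX.coset_col h1 hU, coset_congr (P := d.fst.c) d.fst.h hu, hX.coset_col h.joins₁.c_mem hU,
    coset_congr (P := d.fst.ur e₁ e₂) (-d.fst.w) (by rw [hu, Rect.ul, Rect.ur]; module),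
    hX.coset_row h.joins₁.ur_mem hU]
  constructor <;> ring

/-- The displacements in the annular case. -/
lemma IsDecomp.disp_of_both (hc : d.snd.c = d.fst.lr e₁)
    (hu : d.snd.ur e₁ e₂ = d.fst.ul e₂) {U : T} (hU : U ∈ X) :
    disp e₁ e₂ ψ U = (d.fst.w + d.snd.w) * ((if d.fst.c = U then 1 else 0)
      - (if d.fst.ur e₁ e₂ = U then 1 else 0)) ∧
    disp e₂ e₁ ψ U = (d.fst.h - d.snd.h) * ((if d.fst.c = U then 1 else 0)
      - (if d.fst.ur e₁ e₂ = U then 1 else 0)) := by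
  rw [h.disp_row, h.disp_col, hX.coset_row h.joins₁.c_mem hU, hX.coset_row h.joins₁.ur_mem hU,
    hX.coset_col h.joins₁.c_mem hU, hX.coset_col h.joins₁.ur_mem hU,
    coset_congr (e := e₁) d.fst.w hc, hX.coset_row h.joins₁.c_mem hU,
    coset_congr (e := e₂) (P := d.fst.ur e₁ e₂) (-d.fst.h) (by rw [hc, Rect.lr, Rect.ur]; module),
    hX.coset_col h.joins₁.ur_mem hU,
    coset_congr (e := e₂) (P := d.fst.c) d.fst.h hu, hX.coset_col h.joins₁.c_mem hU,
    coset_congr (e := e₁) (P := d.fst.ur e₁ e₂) (-d.fst.w) (by rw [hu, Rect.ul, Rect.ur]; module),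
    hX.coset_row h.joins₁.ur_mem hU]
  constructor <;> ring

/-- The annular case: both corners of the intermediate state are common to the two rectangles. A
wider first rectangle would contain a point of `X`, or the second rectangle a point of `Z`. -/
lemma IsDecomp.not_lt_of_both (h' : IsDecomp e₁ e₂ X Z ψ d')
    (hc : d.snd.c = d.fst.lr e₁) (hP : d'.fst.c = d.fst.c) (hQ : d'.fst.ur e₁ e₂ = d.fst.ur e₁ e₂)
    (hw : d.fst.w + d.snd.w = d'.fst.w + d'.snd.w)
    (hh : d.fst.h - d.snd.h = d'.fst.h - d'.snd.h) : ¬ d.fst.w < d'.fst.w := by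
  intro hlt
  have p1 := h.joins₁.w_pos
  have p2 := h.joins₂.w_pos
  have p3 := h'.joins₁.w_pos
  have p4 := h'.joins₂.w_pos
  have p5 := h.joins₁.h_pos
  have p6 := h.joins₂.h_pos
  have p7 := h'.joins₁.h_pos
  have p8 := h'.joins₂.h_pos
  have q1 := h'.vacant₁.w_lt
  have hQ' := hQ
  unfold Rect.ur at hQ'
  rw [hP] at hQ'
  rcases lt_trichotomy d.fst.h d'.fst.h with hlt' | he | hgt
  · refine (h'.vacant₁.notMem d.fst.w d.fst.h p1 hlt p5 hlt').1 ?_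
    rw [hP]
    exact h.joins₁.ur_mem
  · rw [he] at hQ'
    have : (d'.fst.w - d.fst.w) • e₁ = 0 := by
      rw [sub_smul]
      have := add_right_cancel hQ'
      rw [add_left_cancel this, sub_self]
    have := eq_zero_of_smul this (by rw [abs_lt]; omega)
    omega
  · -- both decompositions have the same corner in `Z` on this column
    refine (h.vacant₂.notMem (d'.fst.w - d.fst.w) d'.snd.h (by omega) (by omega) p8
      (by omega)).2 ?_
    have hul := h.joins₂.ul_mem h.state
    have : d.snd.h = d'.snd.h + (d.fst.h - d'.fst.h) := by omega
    unfold Rect.ul at hul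
    rw [this] at hul
    rw [hc] at hul ⊢
    unfold Rect.lr at hul ⊢
    convert hul using 1
    linear_combination (norm := module) hQ'

omit h in
/-- A polygon has at most one decomposition into two rectangles next to each other. -/
lemma IsDecomp.eq_of_beside (h : IsDecomp e₁ e₂ X Z ψ d)
    (h' : IsDecomp e₁ e₂ X Z ψ d') (hb : d.Beside e₁ e₂) (hb' : d'.Beside e₁ e₂) : d = d' := by
  have p1 := h.joins₁.w_pos
  have p2 := h.joins₂.w_pos
  have p1' := h'.joins₁.w_pos
  have p2' := h'.joins₂.w_pos
  have P := h.joins₁.c_mem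
  have Q := h.joins₁.ur_mem
  have P' := h'.joins₁.c_mem
  have Q' := h'.joins₁.ur_mem
  have n := h.joins₁.ne
  have n' := h'.joins₁.ne
  -- the number of points of `X` with positive and with negative row displacement tells the type
  have key1 : ∀ {d d' : Decomp T}, IsDecomp e₁ e₂ X Z ψ d → IsDecomp e₁ e₂ X Z ψ d' →
      d.snd.c = d.fst.lr e₁ → d.snd.ur e₁ e₂ ≠ d.fst.ul e₂ →
      d'.snd.ur e₁ e₂ = d'.fst.ul e₂ → False := by
    intro d d' h h' hc hu hu'
    obtain ⟨R, nP, nQ⟩ := h.ur_mem_of_lr hX hc hu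
    have p1 := h.joins₁.w_pos
    have p2 := h.joins₂.w_pos
    have p1' := h'.joins₁.w_pos
    have p2' := h'.joins₂.w_pos
    have n := h.joins₁.ne
    have D1 := (h.disp_of_lr hX hc hu h.joins₁.ur_mem).1
    have D2 := (h.disp_of_lr hX hc hu R).1
    by_cases hc' : d'.snd.c = d'.fst.lr e₁
    · rw [(h'.disp_of_both hX hc' hu' h.joins₁.ur_mem).1] at D1
      rw [(h'.disp_of_both hX hc' hu' R).1] at D2
      simp only [mul_sub, mul_ite, mul_one, mul_zero] at D1 D2
      clear * - D1 D2 nP nQ n p1 p2 p1' p2'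
      grind (splits := 20)
    · rw [(h'.disp_of_ul hX hu' hc' h.joins₁.ur_mem).1] at D1
      rw [(h'.disp_of_ul hX hu' hc' R).1] at D2
      simp only [mul_ite, mul_one, mul_zero] at D1 D2
      clear * - D1 D2 nP nQ n p1 p2 p1' p2'
      grind (splits := 20)
  have key2 : ∀ {d d' : Decomp T}, IsDecomp e₁ e₂ X Z ψ d → IsDecomp e₁ e₂ X Z ψ d' →
      d.snd.ur e₁ e₂ = d.fst.ul e₂ → d.snd.c ≠ d.fst.lr e₁ →
      d'.snd.c = d'.fst.lr e₁ → False := by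
    intro d d' h h' hu hc hc'
    by_cases hu' : d'.snd.ur e₁ e₂ = d'.fst.ul e₂
    · obtain ⟨R, nP, nQ⟩ := h.c_mem_of_ul hX hu hc
      have p1 := h.joins₁.w_pos
      have p2 := h.joins₂.w_pos
      have p1' := h'.joins₁.w_pos
      have p2' := h'.joins₂.w_pos
      have n := h.joins₁.ne
      have D1 := (h.disp_of_ul hX hu hc h.joins₁.c_mem).1
      have D2 := (h.disp_of_ul hX hu hc R).1
      rw [(h'.disp_of_both hX hc' hu' h.joins₁.c_mem).1] at D1
      rw [(h'.disp_of_both hX hc' hu' R).1] at D2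
      simp only [mul_sub, mul_ite, mul_one, mul_zero] at D1 D2
      clear * - D1 D2 nP nQ n p1 p2 p1' p2'
      grind (splits := 20)
    · exact key1 h' h hc' hu' hu
  -- decompositions of the same type: the displacements determine the moved points and the sizes,
  -- except in the annular case, where only `w₁ + w₂` and `h₁ - h₂` are determined
  by_cases hc : d.snd.c = d.fst.lr e₁
  · by_cases hu : d.snd.ur e₁ e₂ = d.fst.ul e₂
    · have hc' : d'.snd.c = d'.fst.lr e₁ := by
        by_contra hc'
        exact key2 h' h (hb'.resolve_left hc') hc' hc
      have hu' : d'.snd.ur e₁ e₂ = d'.fst.ul e₂ := by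
        by_contra hu'
        exact key1 h' h hc' hu' hu
      have D1 := h.disp_of_both hX hc hu P
      have D2 := h.disp_of_both hX hc hu Q
      rw [(h'.disp_of_both hX hc' hu' P).1, (h'.disp_of_both hX hc' hu' P).2] at D1
      rw [(h'.disp_of_both hX hc' hu' Q).1, (h'.disp_of_both hX hc' hu' Q).2] at D2
      have hPP : d'.fst.c = d.fst.c := by
        have := D1.1
        simp only [mul_sub, mul_ite, mul_one, mul_zero] at this
        clear * - this n n' p1 p2 p1' p2'
        grind (splits := 20)
      have hQQ : d'.fst.ur e₁ e₂ = d.fst.ur e₁ e₂ := by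
        have := D2.1
        simp only [mul_sub, mul_ite, mul_one, mul_zero] at this
        clear * - this n n' p1 p2 p1' p2'
        grind (splits := 20)
      rw [hPP, hQQ] at D1
      simp only [if_true, if_neg n.symm, sub_zero, mul_one] at D1
      obtain ⟨hw, hh⟩ := D1
      have a1 := h.not_lt_of_both hX h' hc hPP hQQ hw.symm hh.symm
      have a2 := h'.not_lt_of_both hX h hc' hPP.symm hQQ.symm hw hh
      have ew : d'.fst.w = d.fst.w := by omega
      have eh : d'.fst.h = d.fst.h := by
        have : (d'.fst.h - d.fst.h) • e₂ = 0 := by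
          unfold Rect.ur at hQQ
          rw [hPP, ew] at hQQ
          rw [sub_smul, add_left_cancel hQQ, sub_self]
        have b1 := h.vacant₁.h_lt
        have b2 := h'.vacant₁.h_lt
        have b3 := h.joins₁.h_pos
        have b4 := h'.joins₁.h_pos
        have := eq_zero_of_smul this (by rw [abs_lt]; omega)
        omega
      have e1 : d'.fst = d.fst := Rect.ext hPP ew eh
      have e2 : d'.snd = d.snd := Rect.ext (by rw [hc, hc', e1]) (by omega) (by omega)
      exact (h'.ext_rects h hX e1 e2).symm
    · have hc' : d'.snd.c = d'.fst.lr e₁ := by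
        by_contra hc'
        exact key2 h' h (hb'.resolve_left hc') hc' hc
      have hu' : d'.snd.ur e₁ e₂ ≠ d'.fst.ul e₂ := fun hu' => key1 h h' hc hu hu'
      obtain ⟨R, nP, nQ⟩ := h.ur_mem_of_lr hX hc hu
      obtain ⟨R', nP', nQ'⟩ := h'.ur_mem_of_lr hX hc' hu'
      have D1 := h.disp_of_lr hX hc hu P
      have D2 := h.disp_of_lr hX hc hu R
      rw [(h'.disp_of_lr hX hc' hu' P).1, (h'.disp_of_lr hX hc' hu' P).2] at D1
      rw [(h'.disp_of_lr hX hc' hu' R).1, (h'.disp_of_lr hX hc' hu' R).2] at D2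
      have hPP : d'.fst.c = d.fst.c := by
        have := D1.1
        simp only [mul_ite, mul_one, mul_zero] at this
        clear * - this n n' nP nP' p1 p2 p1' p2'
        grind (splits := 20)
      have hw : d'.fst.w + d'.snd.w = d.fst.w + d.snd.w := by
        have := D1.1
        rw [hPP] at this n' nP'
        simpa [n'.symm, nP', n.symm, nP] using this
      have hRR : d'.snd.ur e₁ e₂ = d.snd.ur e₁ e₂ := by
        refine hX.col_eq R R' (d'.snd.h - d.snd.h) ?_
        simp only [Rect.ur, hc, hc', Rect.lr, hPP]
        linear_combination (norm := module) hw • e₁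
      rw [hPP] at n' nP'
      rw [hPP, hRR] at D1 D2
      rw [hRR] at nP' nQ'
      obtain ⟨D1a, D1b⟩ := D1
      obtain ⟨D2a, D2b⟩ := D2
      simp only [if_true, if_neg n.symm, if_neg n'.symm, if_neg nP, if_neg nP.symm,
        if_neg nQ.symm, if_neg nQ'.symm] at D1b D2a D2b
      have e1 : d'.fst = d.fst := Rect.ext hPP (by omega) (by omega)
      have e2 : d'.snd = d.snd := Rect.ext (by rw [hc, hc', e1]) (by omega) (by omega)
      exact (h'.ext_rects h hX e1 e2).symm
  · have hu := hb.resolve_left hc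
    have hc' : d'.snd.c ≠ d'.fst.lr e₁ := fun hc' => key2 h h' hu hc hc'
    have hu' := hb'.resolve_left hc'
    obtain ⟨R, nP, nQ⟩ := h.c_mem_of_ul hX hu hc
    obtain ⟨R', nP', nQ'⟩ := h'.c_mem_of_ul hX hu' hc'
    have D1 := h.disp_of_ul hX hu hc Q
    have D2 := h.disp_of_ul hX hu hc R
    rw [(h'.disp_of_ul hX hu' hc' Q).1, (h'.disp_of_ul hX hu' hc' Q).2] at D1
    rw [(h'.disp_of_ul hX hu' hc' R).1, (h'.disp_of_ul hX hu' hc' R).2] at D2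
    have hQQ : d'.fst.ur e₁ e₂ = d.fst.ur e₁ e₂ := by
      have := D1.1
      simp only [mul_ite, mul_one, mul_zero] at this
      clear * - this n n' nQ nQ' p1 p2 p1' p2'
      grind (splits := 20)
    have hw : d'.fst.w + d'.snd.w = d.fst.w + d.snd.w := by
      have := D1.1
      rw [hQQ] at this n' nQ'
      simp [n', nQ', n, nQ] at this
      omega
    have hcR : ∀ d : Decomp T, d.snd.ur e₁ e₂ = d.fst.ul e₂ →
        d.snd.c = d.fst.ur e₁ e₂ - (d.fst.w + d.snd.w) • e₁ - d.snd.h • e₂ := by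
      intro d hu
      unfold Rect.ur Rect.ul at hu
      unfold Rect.ur
      linear_combination (norm := module) hu
    have hRR : d'.snd.c = d.snd.c := by
      refine hX.col_eq R R' (d.snd.h - d'.snd.h) ?_
      rw [hcR d' hu', hcR d hu, hw, hQQ]
      module
    rw [hQQ] at n' nQ'
    rw [hQQ, hRR] at D1 D2
    rw [hRR] at nP' nQ'
    obtain ⟨D1a, D1b⟩ := D1
    obtain ⟨D2a, D2b⟩ := D2
    simp only [if_true, if_neg n, if_neg n', if_neg nP.symm, if_neg nQ, if_neg nP'.symm,
      if_neg nQ.symm] at D1b D2a D2b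
    have ew : d'.fst.w = d.fst.w := by omega
    have eh : d'.fst.h = d.fst.h := by omega
    have e1 : d'.fst = d.fst := by
      refine Rect.ext ?_ ew eh
      unfold Rect.ur at hQQ
      rw [ew, eh] at hQQ
      exact add_right_cancel (add_right_cancel hQQ)
    have e2 : d'.snd = d.snd := Rect.ext hRR (by omega) (by omega)
    exact (h'.ext_rects h hX e1 e2).symm

end Beside

end TorusGrid

namespace TorusGrid

variable {T : Type*} [AddCommGroup T] [DecidableEq T] {e₁ e₂ : T} {X Y Z : Finset T}
  {ψ : T → ℤ}

/-! ### The second decomposition -/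

/-- Two adjacent rectangles that close up to a staircase-shaped annulus, whose period is
`(w₁ + w₂, h₂ - h₁)`, can be cut along `j` periods of the staircase instead. For one sign of `j`
both rectangles on the left hand side have negative sizes. -/
lemma cover_staircase (P : T) (w₁ w₂ h₁ h₂ : ℤ)
    (hper : (w₁ + w₂) • e₁ + (h₂ - h₁) • e₂ = 0) (j : ℤ) (C : T) :
    Rect.cover e₁ e₂ ⟨P, w₁ + j * (w₁ + w₂), h₁ + j * (h₂ - h₁)⟩ C
      + Rect.cover e₁ e₂ ⟨P + (h₁ + j * (h₂ - h₁)) • e₂, w₁ + (j - 1) * (w₁ + w₂),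
          -(h₁ + (j + 1) * (h₂ - h₁))⟩ C =
      Rect.cover e₁ e₂ ⟨P, w₁, h₁⟩ C + Rect.cover e₁ e₂ ⟨P + w₁ • e₁, w₂, h₂⟩ C := by
  -- the left hand side does not depend on `j`
  have step : ∀ j : ℤ,
      Rect.cover e₁ e₂ ⟨P, w₁ + (j + 1) * (w₁ + w₂), h₁ + (j + 1) * (h₂ - h₁)⟩ C
      + Rect.cover e₁ e₂ ⟨P + (h₁ + (j + 1) * (h₂ - h₁)) • e₂, w₁ + j * (w₁ + w₂),
          -(h₁ + (j + 2) * (h₂ - h₁))⟩ C =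
      Rect.cover e₁ e₂ ⟨P, w₁ + j * (w₁ + w₂), h₁ + j * (h₂ - h₁)⟩ C
      + Rect.cover e₁ e₂ ⟨P + (h₁ + j * (h₂ - h₁)) • e₂, w₁ + (j - 1) * (w₁ + w₂),
          -(h₁ + (j + 1) * (h₂ - h₁))⟩ C := by
    intro j
    set L := w₁ + w₂
    set m := h₂ - h₁
    -- the part of the new first rectangle to the right of the old width
    have a1 := Rect.cover_add_w e₁ e₂ P (w₁ + j * L) L (h₁ + (j + 1) * m) C
    have a2 := Rect.cover_add_h e₁ e₂ P (w₁ + j * L) (h₁ + j * m) m C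
    have a3 := Rect.cover_add_w e₁ e₂ (P + (h₁ + j * m) • e₂) (w₁ + (j - 1) * L) L
      (-(h₁ + (j + 1) * m)) C
    have a4 := Rect.cover_add_h e₁ e₂ (P + (h₁ + j * m) • e₂) (w₁ + j * L) m
      (-(h₁ + (j + 2) * m)) C
    have a5 := Rect.cover_neg_h e₁ e₂ (P + (h₁ + j * m) • e₂ + (w₁ + (j - 1) * L) • e₁) L
      (h₁ + (j + 1) * m) C
    have b1 : P + (h₁ + j * m) • e₂ + (w₁ + (j - 1) * L) • e₁ - (h₁ + (j + 1) * m) • e₂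
        = P + (w₁ + j * L) • e₁ := by
      linear_combination (norm := module) -hper
    have b2 : P + (h₁ + j * m) • e₂ + m • e₂ = P + (h₁ + (j + 1) * m) • e₂ := by module
    rw [b1] at a5
    rw [b2] at a4
    rw [show w₁ + j * L + L = w₁ + (j + 1) * L by ring] at a1
    rw [show h₁ + j * m + m = h₁ + (j + 1) * m by ring] at a2
    rw [show w₁ + (j - 1) * L + L = w₁ + j * L by ring] at a3
    rw [show m + -(h₁ + (j + 2) * m) = -(h₁ + (j + 1) * m) by ring] at a4
    linarith
  have base : Rect.cover e₁ e₂ ⟨P + h₁ • e₂, -w₂, -h₂⟩ C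
      = Rect.cover e₁ e₂ ⟨P + w₁ • e₁, w₂, h₂⟩ C := by
    rw [Rect.cover_neg_neg]
    congr 2
    linear_combination (norm := module) -hper
  induction j using Int.induction_on with
  | zero =>
    rw [← base]
    simp only [zero_mul, add_zero, zero_sub, zero_add, one_mul, neg_mul]
    rw [show w₁ + -(w₁ + w₂) = -w₂ by ring, show h₁ + (h₂ - h₁) = h₂ by ring]
  | succ k ih =>
    rw [← ih, ← step k, show (k : ℤ) + 1 - 1 = k by ring, show (k : ℤ) + 1 + 1 = k + 2 by ring]
  | pred k ih =>
    have := step (-k - 1)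
    rw [show -(k : ℤ) - 1 + 1 = -k by ring, show -(k : ℤ) - 1 + 2 = -k + 1 by ring] at this
    rw [← ih, this, show -(k : ℤ) - 1 + 1 = -k by ring]

variable [Fintype T] {d : Decomp T}

/-- An annulus that consists of two rectangles of the same height is a horizontal strip of height
one: the intermediate state has a point in each row, but none in the interior of the annulus. -/
lemma IsDecomp.eq_strip (hX : IsState e₁ e₂ X) (h : IsDecomp e₁ e₂ X Z ψ d)
    (hc : d.snd.c = d.fst.lr e₁) (hu : d.snd.ur e₁ e₂ = d.fst.ul e₂)
    (hh : d.snd.h = d.fst.h) (C : T) : ψ C = coset e₁ C d.fst.c := by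
  have p1 := h.joins₁.w_pos
  have p2 := h.joins₂.w_pos
  have p3 := h.joins₁.h_pos
  have q1 := h.vacant₁.w_lt
  have q2 := h.vacant₁.h_lt
  have q3 := h.vacant₂.w_lt
  have hper : (d.fst.w + d.snd.w) • e₁ = 0 := by
    unfold Rect.ur Rect.ul at hu
    rw [hc, hh] at hu
    unfold Rect.lr at hu
    linear_combination (norm := module) hu
  have hN : d.fst.w + d.snd.w = addOrderOf e₁ := by
    obtain ⟨k, hk⟩ := addOrderOf_dvd_iff_zsmul_eq_zero.2 hper
    have k0 : 0 < k := by nlinarith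
    have k2 : k < 2 := by nlinarith
    obtain rfl : k = 1 := by omega
    omega
  have h1 : d.fst.h = 1 := by
    by_contra hne
    -- the row above the bottom side contains no point of the intermediate state
    obtain ⟨s, hs⟩ := h.state.row_exists (d.fst.c + e₂)
    have e0 : d.fst.c + e₂ + (s % addOrderOf e₁) • e₁ ∈ d.mid := by
      convert hs using 2
      rw [mod_addOrderOf_zsmul]
    have hpos : (0 : ℤ) < addOrderOf e₁ := by omega
    have s0 := Int.emod_nonneg s hpos.ne'
    have s1 := Int.emod_lt_of_pos s hpos
    set t := s % addOrderOf e₁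
    rcases s0.eq_or_lt with ht0 | ht0
    · -- the column of the upper left corner
      rw [← ht0] at e0
      have := h.state.col_unique _ e0 (d.fst.h - 1) (by
        convert h.joins₁.ul_mem hX using 1
        unfold Rect.ul
        module)
      have := eq_zero_of_smul this (by rw [abs_lt]; omega)
      omega
    rcases lt_trichotomy t d.fst.w with hlt | heq | hgt
    · refine (h.vacant₁.notMem t 1 ht0 hlt one_pos (by omega)).2 ?_
      convert e0 using 1
      module
    · rw [heq] at e0
      have := h.state.col_unique _ e0 (-1) (by
        convert h.joins₁.lr_mem hX using 1
        unfold Rect.lr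
        module)
      have := eq_zero_of_smul this (by rw [abs_lt]; omega)
      omega
    · refine (h.vacant₂.notMem (t - d.fst.w) 1 (by omega) (by omega) one_pos (by omega)).1 ?_
      convert e0 using 1
      rw [hc, Rect.lr]
      module
  have hcov := Rect.cover_add_w e₁ e₂ d.fst.c d.fst.w d.snd.w 1 C
  rw [hN] at hcov
  rw [← h.cover_add]
  have e1 : d.fst = ⟨d.fst.c, d.fst.w, 1⟩ := Rect.ext rfl rfl h1
  have e2 : d.snd = ⟨d.fst.c + d.fst.w • e₁, d.snd.w, 1⟩ := Rect.ext hc rfl (by rw [hh, h1])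
  rw [show d.fst.cover e₁ e₂ C = Rect.cover e₁ e₂ ⟨d.fst.c, d.fst.w, 1⟩ C by rw [← e1],
    show d.snd.cover e₁ e₂ C = Rect.cover e₁ e₂ ⟨d.fst.c + d.fst.w • e₁, d.snd.w, 1⟩ C by
      rw [← e2], ← hcov, Rect.cover_of_nonneg _ _ (by simp) (by simp)]
  have hI : Finset.Ico (0 : ℤ) 1 = {0} := rfl
  simp only [hI, Finset.sum_singleton, zero_smul, add_zero]
  unfold coset
  split_ifs with hC
  · obtain ⟨k, hk⟩ := AddSubgroup.mem_zmultiples_iff.1 hC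
    have hpos : (0 : ℤ) < addOrderOf e₁ := by omega
    rw [Finset.sum_eq_single (k % addOrderOf e₁)]
    · rw [if_pos]
      rw [mod_addOrderOf_zsmul, hk]
      abel
    · intro u hu hne
      rw [if_neg]
      intro he
      refine hne ?_
      have h2 : (u - k % addOrderOf e₁) • e₁ = 0 := by
        rw [sub_smul, mod_addOrderOf_zsmul, hk, ← he]
        abel
      have := Int.emod_nonneg k hpos.ne'
      have := Int.emod_lt_of_pos k hpos
      rw [Finset.mem_Ico] at hu
      have := eq_zero_of_smul h2 (by rw [abs_lt]; omega)
      omega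
    · intro hn
      exact absurd (Finset.mem_Ico.2 ⟨Int.emod_nonneg k hpos.ne', Int.emod_lt_of_pos k hpos⟩) hn
  · refine Finset.sum_eq_zero fun u _ => if_neg fun he => hC ?_
    rw [← he]
    exact AddSubgroup.mem_zmultiples_iff.2 ⟨u, by abel⟩

lemma Decomp.above_iff : d.Above e₁ e₂ ↔
    d.snd.c = d.fst.ul e₂ ∨ d.snd.ur e₁ e₂ = d.fst.lr e₁ := by
  unfold Decomp.Above Decomp.Beside Decomp.swap
  rw [Rect.ur_swap, Rect.lr_swap, Rect.ul_swap]
  rfl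

/-- The other cut of an L-shaped polygon, when the bottom sides of the rectangles are aligned. -/
lemma IsDecomp.exists_above_of_lr (hX : IsState e₁ e₂ X) (hZ : IsState e₁ e₂ Z)
    (h : IsDecomp e₁ e₂ X Z ψ d) (hc : d.snd.c = d.fst.lr e₁)
    (hu : d.snd.ur e₁ e₂ ≠ d.fst.ul e₂) :
    ∃ d', IsDecomp e₁ e₂ X Z ψ d' ∧ d'.Above e₁ e₂ := by
  have p1 := h.joins₁.w_pos
  have p2 := h.joins₂.w_pos
  have p3 := h.joins₁.h_pos
  have p4 := h.joins₂.h_pos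
  have hP := h.joins₁.c_mem
  have hQ := h.joins₁.ur_mem
  have n := h.joins₁.ne
  have we := h.joins₁.w_ne hX
  have he := h.joins₁.h_ne hX
  obtain ⟨hR, nP, nQ⟩ := h.ur_mem_of_lr hX hc hu
  have E := fun r₁ r₂ => h.exists_of_cover_eq hX hZ r₁ r₂
  clear h
  obtain ⟨Y, ⟨P, w₁, h₁⟩, ⟨P₂, w₂, h₂⟩⟩ := d
  change P₂ = P + w₁ • e₁ at hc
  subst hc
  simp only [Rect.ur, Rect.ul] at *
  rcases lt_trichotomy h₁ h₂ with hlt | heq | hgt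
  · -- the second rectangle is higher: cut along the extension of the top side of the first one
    have a1 : P + w₁ • e₁ + h₁ • e₂ + w₂ • e₁ + (h₂ - h₁) • e₂
        = P + w₁ • e₁ + w₂ • e₁ + h₂ • e₂ := by module
    obtain ⟨Y', hY'⟩ := E ⟨P + w₁ • e₁ + h₁ • e₂, w₂, h₂ - h₁⟩ ⟨P, w₁ + w₂, h₁⟩ p2
      (by simpa using hlt) (by simp only; omega) p3 hQ (by simp only [a1]; exact hR)
      (by simp only [a1]; exact nQ.symm)
      (fun h0 => nP (hX.col_eq hP hR h₂ (by linear_combination (norm := module) h0))) he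
      (fun h0 => n (hX.row_eq hP hQ (-w₂) (by linear_combination (norm := module) -h0)).symm)
      (fun C => by
        have b1 := Rect.cover_add_w e₁ e₂ P w₁ w₂ h₁ C
        have b2 := Rect.cover_add_h e₁ e₂ (P + w₁ • e₁) w₂ h₁ (h₂ - h₁) C
        rw [add_sub_cancel] at b2
        linarith)
    refine ⟨_, hY', Decomp.above_iff.2 (Or.inr ?_)⟩
    simp only [Rect.ur, Rect.lr]
    module
  · subst heq
    exact absurd (hX.row_eq hQ hR w₂ (by module)) nQ
  · -- the first rectangle is higher: cut along the extension of the top side of the second one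
    have a1 : P + (w₁ + w₂) • e₁ + h₂ • e₂ = P + w₁ • e₁ + w₂ • e₁ + h₂ • e₂ := by module
    obtain ⟨Y', hY'⟩ := E ⟨P, w₁ + w₂, h₂⟩ ⟨P + h₂ • e₂, w₁, h₁ - h₂⟩ (by simp only; omega)
      p4 p1 (by simp only; omega) hP (by simp only [a1]; exact hR)
      (by simp only [a1]; exact nP.symm) we
      (fun h0 => nQ (hX.row_eq hQ hR w₂ (by linear_combination (norm := module) -h0)))
      (fun h0 => n (hX.col_eq hP hQ h₂ (by linear_combination (norm := module) -h0)).symm)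
      (fun C => by
        have b1 := Rect.cover_add_w e₁ e₂ P w₁ w₂ h₂ C
        have b2 := Rect.cover_add_h e₁ e₂ P w₁ h₂ (h₁ - h₂) C
        rw [add_sub_cancel] at b2
        linarith)
    exact ⟨_, hY', Decomp.above_iff.2 (Or.inl rfl)⟩

/-- The other cut of an L-shaped polygon, when the top sides of the rectangles are aligned. -/
lemma IsDecomp.exists_above_of_ul (hX : IsState e₁ e₂ X) (hZ : IsState e₁ e₂ Z)
    (h : IsDecomp e₁ e₂ X Z ψ d) (hu : d.snd.ur e₁ e₂ = d.fst.ul e₂)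
    (hc : d.snd.c ≠ d.fst.lr e₁) :
    ∃ d', IsDecomp e₁ e₂ X Z ψ d' ∧ d'.Above e₁ e₂ := by
  have p1 := h.joins₁.w_pos
  have p2 := h.joins₂.w_pos
  have p3 := h.joins₁.h_pos
  have p4 := h.joins₂.h_pos
  have hP := h.joins₁.c_mem
  have hQ := h.joins₁.ur_mem
  have n := h.joins₁.ne
  have we := h.joins₁.w_ne hX
  have he := h.joins₁.h_ne hX
  obtain ⟨hR, nP, nQ⟩ := h.c_mem_of_ul hX hu hc
  have E := fun r₁ r₂ => h.exists_of_cover_eq hX hZ r₁ r₂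
  clear h hc
  obtain ⟨Y, ⟨P, w₁, h₁⟩, ⟨R, w₂, h₂⟩⟩ := d
  simp only [Rect.ur, Rect.ul] at *
  rcases lt_trichotomy h₁ h₂ with hlt | heq | hgt
  · -- the second rectangle is higher: cut along the extension of the bottom side of the first one
    have a1 : R + w₂ • e₁ + (h₂ - h₁) • e₂ = P := by
      linear_combination (norm := module) hu
    obtain ⟨Y', hY'⟩ := E ⟨R, w₂, h₂ - h₁⟩ ⟨P - w₂ • e₁, w₁ + w₂, h₁⟩ p2
      (by simpa using hlt) (by simp only; omega) p3 hR (by simp only [a1]; exact hP)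
      (by simp only [a1]; exact nP)
      (fun h0 => nQ (hX.col_eq hR hQ h₂
        (by linear_combination (norm := module) h0 - hu)).symm) he
      (fun h0 => n (hX.row_eq hP hQ (-w₂) (by linear_combination (norm := module) -h0)).symm)
      (fun C => by
        have b1 := Rect.cover_add_w e₁ e₂ (P - w₂ • e₁) w₂ w₁ h₁ C
        have b2 := Rect.cover_add_h e₁ e₂ R w₂ (h₂ - h₁) h₁ C
        rw [sub_add_cancel] at b1 b2
        rw [show R + (h₂ - h₁) • e₂ = P - w₂ • e₁ by
          linear_combination (norm := module) hu, add_comm w₂ w₁] at *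
        linarith)
    refine ⟨_, hY', Decomp.above_iff.2 (Or.inl ?_)⟩
    simp only [Rect.ul]
    linear_combination (norm := module) -hu
  · subst heq
    exact absurd (hX.row_eq hR hP w₂ (by linear_combination (norm := module) -hu)) nP.symm
  · -- the first rectangle is higher: cut along the extension of the bottom side of the second one
    have a1 : R + (w₁ + w₂) • e₁ + h₂ • e₂ = P + w₁ • e₁ + h₁ • e₂ := by
      linear_combination (norm := module) hu
    obtain ⟨Y', hY'⟩ := E ⟨R, w₁ + w₂, h₂⟩ ⟨P, w₁, h₁ - h₂⟩ (by simp only; omega)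
      p4 p1 (by simp only; omega) hR (by simp only [a1]; exact hQ)
      (by simp only [a1]; exact nQ) we
      (fun h0 => nP (hX.row_eq hR hP w₂
        (by linear_combination (norm := module) -hu - h0)).symm)
      (fun h0 => n (hX.col_eq hP hQ h₂ (by linear_combination (norm := module) -h0)).symm)
      (fun C => by
        have b1 := Rect.cover_add_w e₁ e₂ R w₂ w₁ h₂ C
        have b2 := Rect.cover_add_h e₁ e₂ P w₁ (h₁ - h₂) h₂ C
        rw [sub_add_cancel] at b2
        rw [show R + w₂ • e₁ = P + (h₁ - h₂) • e₂ by
          linear_combination (norm := module) hu, add_comm w₂ w₁] at *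
        linarith)
    refine ⟨_, hY', Decomp.above_iff.2 (Or.inr ?_)⟩
    simp only [Rect.ur, Rect.lr]
    linear_combination (norm := module) -hu

/-- The other cut of a staircase-shaped annulus. -/
lemma IsDecomp.exists_above_of_both (hX : IsState e₁ e₂ X) (hZ : IsState e₁ e₂ Z)
    (h : IsDecomp e₁ e₂ X Z ψ d) (hc : d.snd.c = d.fst.lr e₁)
    (hu : d.snd.ur e₁ e₂ = d.fst.ul e₂) (hh : d.snd.h ≠ d.fst.h) :
    ∃ d', IsDecomp e₁ e₂ X Z ψ d' ∧ d'.Above e₁ e₂ := by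
  have p1 := h.joins₁.w_pos
  have p2 := h.joins₂.w_pos
  have p3 := h.joins₁.h_pos
  have p4 := h.joins₂.h_pos
  have hP := h.joins₁.c_mem
  have hQ := h.joins₁.ur_mem
  have n := h.joins₁.ne
  have E := fun r₁ r₂ => h.exists_of_cover_eq hX hZ r₁ r₂
  clear h
  obtain ⟨Y, ⟨P, w₁, h₁⟩, ⟨P₂, w₂, h₂⟩⟩ := d
  change P₂ = P + w₁ • e₁ at hc
  subst hc
  simp only [Rect.ur, Rect.ul] at *
  have hper : (w₁ + w₂) • e₁ + (h₂ - h₁) • e₂ = 0 := by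
    linear_combination (norm := module) hu
  have hcov := cover_staircase P w₁ w₂ h₁ h₂ hper
  obtain ⟨L, hL⟩ : ∃ L, L = w₁ + w₂ := ⟨_, rfl⟩
  obtain ⟨m, hm⟩ : ∃ m, m = h₂ - h₁ := ⟨_, rfl⟩
  rw [← hL, ← hm] at hper hcov
  -- nondegeneracy of the two rectangles, from the fact that the points `P` and `Q` of `X` lie in
  -- different rows and columns
  have nrow : ∀ s : ℤ, P + w₁ • e₁ + h₁ • e₂ ≠ P + s • e₁ := fun s h0 =>
    n (hX.row_eq hP hQ s h0).symm
  have ncol : ∀ s : ℤ, P + w₁ • e₁ + h₁ • e₂ ≠ P + s • e₂ := fun s h0 =>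
    n (hX.col_eq hP hQ s h0).symm
  have d1 : ∀ j : ℤ, (w₁ + (j - 1) * L) • e₁ ≠ 0 := fun j h0 =>
    ncol (h₁ + (j - 1) * m) (by linear_combination (norm := module) h0 - (j - 1) • hper)
  have d2 : ∀ j : ℤ, (h₁ + (j + 1) * m) • e₂ ≠ 0 := fun j h0 =>
    nrow (w₁ + (j + 1) * L) (by linear_combination (norm := module) h0 - (j + 1) • hper)
  have d3 : ∀ j : ℤ, (w₁ + (j - 1) * L) • e₁ ≠ (h₁ + (j + 1) * m) • e₂ := fun j h0 =>
    nrow (2 * w₁ + 2 * j * L)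
      (by linear_combination (norm := module) -h0 - (j + 1) • hper)
  rcases lt_or_gt_of_ne (show m ≠ 0 by omega) with hneg | hpos
  · -- cut along the largest number of periods for which the first height remains positive
    obtain ⟨j, j0, j1⟩ : ∃ j : ℤ, 0 < h₁ + j * m ∧ h₁ + (j + 1) * m ≤ 0 := by
      have a1 := Int.emod_add_mul_ediv (h₁ - 1) (-m)
      have a2 := Int.emod_nonneg (h₁ - 1) (show -m ≠ 0 by omega)
      have a3 := Int.emod_lt_of_pos (h₁ - 1) (show 0 < -m by omega)
      refine ⟨(h₁ - 1) / (-m), ?_, ?_⟩ <;> nlinarith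
    have j2 : h₁ + (j + 1) * m ≠ 0 := fun h0 => d2 j (by rw [h0, zero_smul])
    have j3 : 1 ≤ j := by
      by_contra hj
      have : h₁ + m ≤ h₁ + (j + 1) * m := by nlinarith
      omega
    have j4 : 0 ≤ (j - 1) * L := mul_nonneg (by omega) (by omega)
    have a1 : P + (w₁ + j * L) • e₁ + (h₁ + j * m) • e₂ = P + w₁ • e₁ + h₁ • e₂ := by
      linear_combination (norm := module) j • hper
    obtain ⟨Y', hY'⟩ := E ⟨P, w₁ + j * L, h₁ + j * m⟩
      ⟨P + (h₁ + j * m) • e₂, w₁ + (j - 1) * L, -(h₁ + (j + 1) * m)⟩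
      (by simp only; nlinarith) j0 (by simp only; omega) (by simp only; omega) hP
      (by simp only [a1]; exact hQ) (by simp only [a1]; exact n) (d1 j)
      (by simpa only [neg_smul, ne_eq, neg_eq_zero] using d2 j)
      (fun h0 => d3 j (by linear_combination (norm := module) -h0)) (fun C => hcov j C)
    exact ⟨_, hY', Decomp.above_iff.2 (Or.inl rfl)⟩
  · -- cut along `-k` periods; the first rectangle has negative sizes in `cover_staircase` and starts
    -- at the opposite corner
    obtain ⟨k, j0, j1⟩ : ∃ k : ℤ, 0 ≤ k * m - h₁ ∧ 0 < h₁ - (k - 1) * m := by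
      have a1 := Int.emod_add_mul_ediv (h₁ - 1) m
      have a2 := Int.emod_nonneg (h₁ - 1) (show m ≠ 0 by omega)
      have a3 := Int.emod_lt_of_pos (h₁ - 1) (show 0 < m by omega)
      refine ⟨(h₁ - 1) / m + 1, ?_, ?_⟩ <;> nlinarith
    have j2 : k * m - h₁ ≠ 0 := fun h0 => d2 (-k - 1) (by
      rw [show h₁ + (-k - 1 + 1) * m = -(k * m - h₁) by ring, h0, neg_zero, zero_smul])
    have j3 : 1 ≤ k := by
      by_contra hj
      have : k * m ≤ 0 := by nlinarith
      omega
    have j4 : 0 ≤ (k - 1) * L := mul_nonneg (by omega) (by omega)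
    have j5 : (k - 1) * L = k * L - L := by ring
    have a1 : P + w₁ • e₁ + h₁ • e₂ + (k * L - w₁) • e₁ + (k * m - h₁) • e₂ = P := by
      linear_combination (norm := module) k • hper
    obtain ⟨Y', hY'⟩ := E ⟨P + w₁ • e₁ + h₁ • e₂, k * L - w₁, k * m - h₁⟩
      ⟨P + w₁ • e₁ + (k * m) • e₂, (k + 1) * L - w₁, h₁ - (k - 1) * m⟩
      (by simp only; omega) (by simp only; omega) (by simp only; nlinarith) j1 hQ
      (by simp only [a1]; exact hP) (by simp only [a1]; exact n.symm)
      (fun h0 => d1 (-k) (by linear_combination (norm := module) -h0))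
      (fun h0 => d2 (-k) (by linear_combination (norm := module) h0))
      (fun h0 => d3 (-k) (by linear_combination (norm := module) h0)) (fun C => by
        rw [← hcov (-k) C]
        have b1 := Rect.cover_neg_neg e₁ e₂ P (k * L - w₁) (k * m - h₁) C
        have b2 := Rect.cover_neg_w e₁ e₂ (P + (h₁ + -k * m) • e₂) ((k + 1) * L - w₁)
          (-(h₁ + (-k + 1) * m)) C
        have b3 := Rect.cover_neg_h e₁ e₂
          (P + (h₁ + -k * m) • e₂ - ((k + 1) * L - w₁) • e₁) ((k + 1) * L - w₁)
          (h₁ + (-k + 1) * m) C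
        rw [show P - (k * L - w₁) • e₁ - (k * m - h₁) • e₂ = P + w₁ • e₁ + h₁ • e₂ by
          linear_combination (norm := module) -k • hper] at b1
        rw [show P + (h₁ + -k * m) • e₂ - ((k + 1) * L - w₁) • e₁ - (h₁ + (-k + 1) * m) • e₂
          = P + w₁ • e₁ + (k * m) • e₂ by
            linear_combination (norm := module) (-k - 1) • hper] at b3
        rw [show -(k * L - w₁) = w₁ + -k * L by ring,
          show -(k * m - h₁) = h₁ + -k * m by ring] at b1
        rw [show -((k + 1) * L - w₁) = w₁ + (-k - 1) * L by ring] at b2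
        rw [show h₁ - (k - 1) * m = h₁ + (-k + 1) * m by ring]
        linarith)
    refine ⟨_, hY', Decomp.above_iff.2 (Or.inl ?_)⟩
    simp only [Rect.ul]
    module

/-- A polygon that is decomposed into two rectangles next to each other can also be decomposed into
two rectangles above each other, unless it is a horizontal strip. It is L-shaped and has a
second cut from its reflex corner, or it is an annulus bounded by two staircases. -/
lemma IsDecomp.exists_above (hX : IsState e₁ e₂ X) (hZ : IsState e₁ e₂ Z)
    (h : IsDecomp e₁ e₂ X Z ψ d) (hb : d.Beside e₁ e₂)
    (hs : ¬ ∃ P, ∀ C, ψ C = coset e₁ C P) :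
    ∃ d', IsDecomp e₁ e₂ X Z ψ d' ∧ d'.Above e₁ e₂ := by
  by_cases hc : d.snd.c = d.fst.lr e₁
  · by_cases hu : d.snd.ur e₁ e₂ = d.fst.ul e₂
    · exact h.exists_above_of_both hX hZ hc hu fun hh =>
        hs ⟨d.fst.c, h.eq_strip hX hc hu hh⟩
    · exact h.exists_above_of_lr hX hZ hc hu
  · exact h.exists_above_of_ul hX hZ (hb.resolve_left hc) hc

/-- A polygon that is not a strip and has a decomposition has exactly two of them. -/
theorem IsDecomp.exists_unique_other (hX : IsState e₁ e₂ X) (hZ : IsState e₁ e₂ Z)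
    (h : IsDecomp e₁ e₂ X Z ψ d) (hs₁ : ¬ ∃ P, ∀ C, ψ C = coset e₁ C P)
    (hs₂ : ¬ ∃ P, ∀ C, ψ C = coset e₂ C P) :
    ∃ d', d' ≠ d ∧ IsDecomp e₁ e₂ X Z ψ d' ∧
      ∀ d'', IsDecomp e₁ e₂ X Z ψ d'' → d'' = d ∨ d'' = d' := by
  by_cases hA : ∃ d', IsDecomp e₁ e₂ X Z ψ d' ∧ d'.snd.c ∈ X ∧ d'.snd.ur e₁ e₂ ∈ X
  · obtain ⟨d', h', hc, hu⟩ := hA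
    obtain ⟨hc', hu'⟩ := h'.apart_of_apart hX hc hu h
    exact h.exists_unique_of_apart hX hc' hu' hZ
  -- every decomposition consists of rectangles that are beside each other, or above each other
  have hor : ∀ d', IsDecomp e₁ e₂ X Z ψ d' → d'.Beside e₁ e₂ ∨ d'.Above e₁ e₂ := by
    intro d' h'
    rw [Decomp.above_iff]
    unfold Decomp.Beside
    by_contra! hne
    obtain ⟨⟨h1, h2⟩, h3, h4⟩ := hne
    refine hA ⟨d', h', ?_, ?_⟩
    · rcases (h'.joins₁.mem_target_iff hX).1 h'.joins₂.c_mem with h5 | h5 | h5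
      · exact h5.1
      · exact absurd h5 h1
      · exact absurd h5 h3
    · rcases (h'.joins₁.mem_target_iff hX).1 h'.joins₂.ur_mem with h5 | h5 | h5
      · exact h5.1
      · exact absurd h5 h4
      · exact absurd h5 h2
  have hnot : ∀ d', IsDecomp e₁ e₂ X Z ψ d' → d'.Beside e₁ e₂ → d'.Above e₁ e₂ → False := by
    intro d' h' hb ha
    rw [Decomp.above_iff] at ha
    have n1 := h'.joins₁.lr_ne_ul hX
    have n2 := h'.joins₂.ne
    rcases hb with hb | hb <;> rcases ha with ha | ha
    · exact n1 (hb.symm.trans ha)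
    · exact n2 (hb.trans ha.symm)
    · exact n2 (ha.trans hb.symm)
    · exact n1 (ha.symm.trans hb)
  have habove : ∀ {d₁ d₂}, IsDecomp e₁ e₂ X Z ψ d₁ → IsDecomp e₁ e₂ X Z ψ d₂ →
      d₁.Above e₁ e₂ → d₂.Above e₁ e₂ → d₁ = d₂ := by
    intro d₁ d₂ h₁ h₂ a₁ a₂
    exact congrArg Decomp.swap (h₁.swap.eq_of_beside hX.swap h₂.swap a₁ a₂)
  rcases hor d h with hb | ha
  · obtain ⟨d', h', ha'⟩ := h.exists_above hX hZ hb hs₁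
    refine ⟨d', fun he => hnot d h hb (he ▸ ha'), h', fun d'' h'' => ?_⟩
    rcases hor d'' h'' with hb'' | ha''
    · exact Or.inl (h''.eq_of_beside hX h hb'' hb)
    · exact Or.inr (habove h'' h' ha'' ha')
  · obtain ⟨d', h', ha'⟩ := h.swap.exists_above hX.swap hZ.swap ha hs₂
    refine ⟨d'.swap, fun he => hnot d h (he ▸ ha') ha, h'.swap, fun d'' h'' => ?_⟩
    rcases hor d'' h'' with hb'' | ha''
    · exact Or.inr (h''.eq_of_beside hX h'.swap hb'' ha')
    · exact Or.inl (habove h'' h ha'' ha)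

end TorusGrid

namespace TorusGrid

/-! ### Vacant rectangles are the embedded ones -/

section Embedded

variable {T : Type*} [AddCommGroup T] [DecidableEq T] {e₁ e₂ : T} {X Y : Finset T} {r : Rect T}

lemma isum_natCast (f : ℤ → ℤ) (w : ℕ) : isum f w = ∑ u ∈ Finset.range w, f u := by
  induction w with
  | zero => simp
  | succ w ih => rw [Nat.cast_succ, isum_succ, ih, Finset.sum_range_succ]

/-- Two positions in a vacant rectangle are different points. -/
lemma Vacant.position_injective (hv : Vacant e₁ e₂ r X Y) (hc : r.c ∈ X) (hul : r.ul e₂ ∈ Y)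
    {u v u' v' : ℤ} (hu : 0 ≤ u) (hu' : u' < r.w) (hv0 : 0 ≤ v) (hv1 : v < r.h) (hv0' : 0 ≤ v')
    (hv1' : v' < r.h) (hle : u ≤ u')
    (h : r.c + u • e₁ + v • e₂ = r.c + u' • e₁ + v' • e₂) : u = u' ∧ v = v' := by
  have hw := hv.w_lt
  have hh := hv.h_lt
  rcases hle.lt_or_eq with hlt | rfl
  · exfalso
    rcases lt_trichotomy v v' with h1 | rfl | h1
    · refine (hv.notMem (u' - u) (v' - v) (by omega) (by omega) (by omega) (by omega)).1 ?_
      convert hc using 1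
      linear_combination (norm := module) -h
    · have : (u' - u) • e₁ = 0 := by linear_combination (norm := module) -h
      have := eq_zero_of_smul this (by rw [abs_lt]; omega)
      omega
    · refine (hv.notMem (u' - u) (r.h + (v' - v)) (by omega) (by omega) (by omega)
        (by omega)).2 ?_
      convert hul using 1
      rw [Rect.ul]
      linear_combination (norm := module) -h
  · have : (v' - v) • e₂ = 0 := by linear_combination (norm := module) -h
    have := eq_zero_of_smul this (by rw [abs_lt]; omega)
    exact ⟨rfl, by omega⟩

/-- the positions in a rectangle that name the square `C` -/
noncomputable def positions (e₁ e₂ : T) (r : Rect T) (C : T) : Finset (ℤ × ℤ) :=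
  (Finset.Ico 0 r.w ×ˢ Finset.Ico 0 r.h).filter fun s => r.c + s.1 • e₁ + s.2 • e₂ = C

lemma cover_eq_card (hw : 0 ≤ r.w) (hh : 0 ≤ r.h) (C : T) :
    r.cover e₁ e₂ C = (positions e₁ e₂ r C).card := by
  rw [Rect.cover_of_nonneg e₁ e₂ hw hh, positions, Finset.card_filter, Finset.sum_product]
  push_cast
  rfl

/-- Vacant rectangles are embedded: if two positions in the rectangle gave the same square, then
some translate of a corner would be a point of `X` or `Y` in the interior. -/
lemma Vacant.cover_le_one (hv : Vacant e₁ e₂ r X Y) (h : Joins e₁ e₂ r X Y)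
    (hX : IsState e₁ e₂ X) (C : T) : r.cover e₁ e₂ C ≤ 1 := by
  rw [cover_eq_card h.w_pos.le h.h_pos.le]
  have : (positions e₁ e₂ r C).card ≤ 1 := by
    refine Finset.card_le_one.2 ?_
    rintro ⟨u, v⟩ hs ⟨u', v'⟩ hs'
    simp only [positions, Finset.mem_filter, Finset.mem_product, Finset.mem_Ico] at hs hs'
    have hc := h.c_mem
    have hul := h.ul_mem hX
    rcases le_total u u' with hle | hle
    · obtain ⟨rfl, rfl⟩ := hv.position_injective hc hul (by omega) (by omega) (by omega)
        (by omega) (by omega) (by omega) hle (hs.2.trans hs'.2.symm)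
      rfl
    · obtain ⟨rfl, rfl⟩ := hv.position_injective hc hul (by omega) (by omega) (by omega)
        (by omega) (by omega) (by omega) hle (hs'.2.trans hs.2.symm)
      rfl
  exact_mod_cast this

lemma eq_of_cover_le_one (hC : ∀ C, r.cover e₁ e₂ C ≤ 1) {u v u' v' : ℤ}
    (hu : 0 ≤ u) (hu1 : u < r.w) (hv : 0 ≤ v) (hv1 : v < r.h)
    (hu' : 0 ≤ u') (hu1' : u' < r.w) (hv' : 0 ≤ v') (hv1' : v' < r.h)
    (h : r.c + u • e₁ + v • e₂ = r.c + u' • e₁ + v' • e₂) : u = u' ∧ v = v' := by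
  have h1 := hC (r.c + u • e₁ + v • e₂)
  rw [cover_eq_card (by omega) (by omega)] at h1
  have h2 := Finset.card_le_one.1 (by exact_mod_cast h1) (u, v) (by
    simp only [positions, Finset.mem_filter, Finset.mem_product, Finset.mem_Ico]; simp; omega)
    (u', v') (by
    simp only [positions, Finset.mem_filter, Finset.mem_product, Finset.mem_Ico, h]; simp; omega)
  exact Prod.mk.inj h2

/-- In an embedded rectangle an interior point of `Y` that is not in `X` would be a corner, which
then appears at two positions. -/
lemma Joins.vacant_of_cover_le_one (h : Joins e₁ e₂ r X Y) (hX : IsState e₁ e₂ X)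
    (hw : r.w < addOrderOf e₁) (hh : r.h < addOrderOf e₂) (hC : ∀ C, r.cover e₁ e₂ C ≤ 1)
    (hint : ∀ u v : ℤ, 0 < u → u < r.w → 0 < v → v < r.h → r.c + u • e₁ + v • e₂ ∉ X) :
    Vacant e₁ e₂ r X Y := by
  have p1 := h.w_pos
  have p2 := h.h_pos
  refine ⟨hw, hh, fun u v h1 h2 h3 h4 => ⟨hint u v h1 h2 h3 h4, fun hY => ?_⟩⟩
  rcases (h.mem_target_iff hX).1 hY with h5 | h5 | h5
  · exact hint u v h1 h2 h3 h4 h5.1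
  · -- the squares to the left of the two positions agree
    have := (eq_of_cover_le_one hC (u := u - 1) (v := v) (u' := r.w - 1) (v' := 0) (by omega)
      (by omega) (by omega) (by omega) (by omega) (by omega) (by omega) (by omega) (by
        rw [Rect.lr] at h5
        linear_combination (norm := module) h5)).1
    omega
  · have := (eq_of_cover_le_one hC (u := u) (v := v - 1) (u' := 0) (v' := r.h - 1) (by omega)
      (by omega) (by omega) (by omega) (by omega) (by omega) (by omega) (by omega) (by
        rw [Rect.ul] at h5
        linear_combination (norm := module) h5)).1
    omega

end Embedded

/-! ### The grid torus -/

open TwistedGrid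

/-- The lattice of the grid torus. -/
def lattice (n p : ℕ) (q : ℤ) : AddSubgroup (ℤ × ℤ) where
  carrier := {v | ∃ k m : ℤ, v = (q * n * k + p * n * m, n * k)}
  zero_mem' := ⟨0, 0, by ext <;> simp⟩
  add_mem' := by
    rintro _ _ ⟨k, m, rfl⟩ ⟨k', m', rfl⟩
    exact ⟨k + k', m + m', by ext <;> simp <;> ring⟩
  neg_mem' := by
    rintro _ ⟨k, m, rfl⟩
    exact ⟨-k, -m, by ext <;> simp; ring⟩

/-- The group of points with integral coordinates of the grid torus; it also names the squares, by
their lower left corners. -/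
abbrev Torus (n p : ℕ) (q : ℤ) : Type := (ℤ × ℤ) ⧸ lattice n p q

section Torus

variable {n p : ℕ} {q : ℤ}

/-- the point of the torus with given planar coordinates -/
def pt (n p : ℕ) (q : ℤ) (v : ℤ × ℤ) : Torus n p q := QuotientAddGroup.mk v

/-- the horizontal unit step -/
def hStep (n p : ℕ) (q : ℤ) : Torus n p q := pt n p q (1, 0)

/-- the vertical unit step -/
def vStep (n p : ℕ) (q : ℤ) : Torus n p q := pt n p q (0, 1)

lemma pt_add (u v : ℤ × ℤ) : pt n p q (u + v) = pt n p q u + pt n p q v := rfl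

lemma pt_sub (u v : ℤ × ℤ) : pt n p q (u - v) = pt n p q u - pt n p q v := rfl

lemma pt_smul (s : ℤ) (v : ℤ × ℤ) : pt n p q (s • v) = s • pt n p q v := rfl

lemma smul_hStep (s : ℤ) : s • hStep n p q = pt n p q (s, 0) := by
  rw [hStep, ← pt_smul]; simp

lemma smul_vStep (s : ℤ) : s • vStep n p q = pt n p q (0, s) := by
  rw [vStep, ← pt_smul]; simp

lemma pt_add_steps (v : ℤ × ℤ) (s t : ℤ) :
    pt n p q v + s • hStep n p q + t • vStep n p q = pt n p q (v.1 + s, v.2 + t) := by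
  rw [smul_hStep, smul_vStep, ← pt_add, ← pt_add]
  congr 1
  ext <;> simp

lemma pt_eq_iff (u v : ℤ × ℤ) : pt n p q u = pt n p q v ↔ SamePoint n p q u v := by
  unfold pt SamePoint
  rw [QuotientAddGroup.eq]
  refine exists_congr fun k => exists_congr fun m => ?_
  rw [Prod.ext_iff, Prod.ext_iff]
  simp only [Prod.fst_add, Prod.snd_add, Prod.fst_neg, Prod.snd_neg]
  constructor <;> rintro ⟨h1, h2⟩ <;> constructor <;> linarith

lemma pt_eq_zero_iff (v : ℤ × ℤ) :
    pt n p q v = 0 ↔ ∃ k m : ℤ, v = (q * n * k + p * n * m, n * k) := by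
  unfold pt
  rw [QuotientAddGroup.eq_zero_iff]
  rfl

lemma exists_pt (Q : Torus n p q) : ∃ v, Q = pt n p q v := by
  obtain ⟨v, rfl⟩ := QuotientAddGroup.mk_surjective Q
  exact ⟨v, rfl⟩

lemma smul_hStep_eq_zero [NeZero n] (s : ℤ) : s • hStep n p q = 0 ↔ ((p * n : ℕ) : ℤ) ∣ s := by
  rw [smul_hStep, pt_eq_zero_iff]
  constructor
  · rintro ⟨k, m, h⟩
    rw [Prod.mk.injEq] at h
    have hk : k = 0 := by
      have : (n : ℤ) ≠ 0 := by exact_mod_cast NeZero.ne n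
      rcases mul_eq_zero.1 h.2.symm with h | h
      · exact absurd h this
      · exact h
    exact ⟨m, by rw [h.1, hk]; push_cast; ring⟩
  · rintro ⟨m, rfl⟩
    exact ⟨0, m, by simp⟩

lemma smul_vStep_eq_zero [NeZero n] (hpq : IsCoprime (p : ℤ) q) (t : ℤ) :
    t • vStep n p q = 0 ↔ ((p * n : ℕ) : ℤ) ∣ t := by
  have hn : (n : ℤ) ≠ 0 := by exact_mod_cast NeZero.ne n
  rw [smul_vStep, pt_eq_zero_iff]
  constructor
  · rintro ⟨k, m, h⟩
    rw [Prod.mk.injEq] at h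
    have h1 : q * k = p * -m := by
      apply mul_left_cancel₀ hn
      linarith [h.1]
    obtain ⟨k', hk'⟩ := hpq.dvd_of_dvd_mul_left ⟨-m, h1⟩
    exact ⟨k', by rw [h.2, hk']; push_cast; ring⟩
  · rintro ⟨k', rfl⟩
    exact ⟨p * k', -(q * k'), by ext <;> simp <;> ring⟩

lemma addOrderOf_hStep [NeZero n] : addOrderOf (hStep n p q) = p * n :=
  Nat.dvd_antisymm
    (by
      rw [← Int.natCast_dvd_natCast, addOrderOf_dvd_iff_zsmul_eq_zero, smul_hStep_eq_zero])
    (by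
      rw [← Int.natCast_dvd_natCast, ← smul_hStep_eq_zero (q := q), natCast_zsmul]
      exact addOrderOf_nsmul_eq_zero _)

lemma addOrderOf_vStep [NeZero n] (hpq : IsCoprime (p : ℤ) q) :
    addOrderOf (vStep n p q) = p * n :=
  Nat.dvd_antisymm
    (by
      rw [← Int.natCast_dvd_natCast, addOrderOf_dvd_iff_zsmul_eq_zero, smul_vStep_eq_zero hpq])
    (by
      rw [← Int.natCast_dvd_natCast, ← smul_vStep_eq_zero (q := q) hpq, natCast_zsmul]
      exact addOrderOf_nsmul_eq_zero _)

lemma sub_mem_zmultiples_hStep (u v : ℤ × ℤ) :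
    pt n p q u - pt n p q v ∈ AddSubgroup.zmultiples (hStep n p q) ↔ (n : ℤ) ∣ u.2 - v.2 := by
  rw [AddSubgroup.mem_zmultiples_iff]
  constructor
  · rintro ⟨s, hs⟩
    rw [smul_hStep, ← pt_sub, pt_eq_iff] at hs
    obtain ⟨k, m, h⟩ := hs
    have := congrArg Prod.snd h
    simp only [Prod.snd_sub] at this
    exact ⟨k, by linarith⟩
  · rintro ⟨k, hk⟩
    refine ⟨u.1 - v.1 - q * n * k, ?_⟩
    rw [smul_hStep, ← pt_sub, pt_eq_iff]
    exact ⟨k, 0, by ext <;> simp [hk]⟩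

lemma sub_mem_zmultiples_vStep (hpq : IsCoprime (p : ℤ) q) (u v : ℤ × ℤ) :
    pt n p q u - pt n p q v ∈ AddSubgroup.zmultiples (vStep n p q) ↔ (n : ℤ) ∣ u.1 - v.1 := by
  rw [AddSubgroup.mem_zmultiples_iff]
  constructor
  · rintro ⟨s, hs⟩
    rw [smul_vStep, ← pt_sub, pt_eq_iff] at hs
    obtain ⟨k, m, h⟩ := hs
    have := congrArg Prod.fst h
    simp only [Prod.fst_sub] at this
    exact ⟨q * k + p * m, by linarith⟩
  · rintro ⟨d, hd⟩
    obtain ⟨a, b, hab⟩ := hpq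
    refine ⟨u.2 - v.2 - n * (b * d), ?_⟩
    rw [smul_vStep, ← pt_sub, pt_eq_iff]
    refine ⟨b * d, a * d, ?_⟩
    ext
    · simp only [Prod.fst_sub, hd]
      linear_combination (-(n : ℤ) * d) * hab
    · simp

/-- The squares of the planar picture are representatives of the points of the torus. -/
lemma existsUnique_cell [NeZero n] [NeZero p] (Q : Torus n p q) :
    ∃! c : Cell n p, pt n p q c.toPlane = Q := by
  have hn : (0 : ℤ) < n := by exact_mod_cast NeZero.pos n
  have hN : (0 : ℤ) < (p * n : ℕ) := by exact_mod_cast NeZero.pos (p * n)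
  obtain ⟨v, rfl⟩ := exists_pt Q
  have a1 := Int.emod_nonneg v.2 hn.ne'
  have a2 := Int.emod_lt_of_pos v.2 hn
  have b1 := Int.emod_nonneg (v.1 - q * n * (v.2 / n)) hN.ne'
  have b2 := Int.emod_lt_of_pos (v.1 - q * n * (v.2 / n)) hN
  have a3 := Int.emod_add_mul_ediv v.2 n
  have b3 := Int.emod_add_mul_ediv (v.1 - q * n * (v.2 / n)) (p * n : ℕ)
  refine ⟨(⟨((v.1 - q * n * (v.2 / n)) % (p * n : ℕ)).toNat, by omega⟩,
    ⟨(v.2 % n).toNat, by omega⟩), ?_, ?_⟩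
  · refine (pt_eq_iff _ _).2 ?_
    refine ⟨v.2 / n, (v.1 - q * n * (v.2 / n)) / (p * n : ℕ), ?_⟩
    simp only [Cell.toPlane, Int.toNat_of_nonneg a1, Int.toNat_of_nonneg b1]
    ext
    · simp only; push_cast at b3 ⊢; linarith
    · simp only; linarith
  · rintro ⟨⟨c, hc⟩, ⟨b, hb⟩⟩ h
    rw [pt_eq_iff] at h
    obtain ⟨k, m, h⟩ := h
    obtain ⟨v1, v2⟩ := v
    simp only [Cell.toPlane, Prod.mk.injEq] at h a1 a2 a3 b1 b2 b3 ⊢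
    obtain ⟨rfl, rfl⟩ := h
    have c1 : ((b : ℤ) + n * k) / n = k := by
      rw [Int.add_mul_ediv_left _ _ hn.ne', Int.ediv_eq_zero_of_lt (by omega) (by omega), zero_add]
    have c2 : ((b : ℤ) + n * k) % n = b := by
      rw [Int.add_mul_emod_self_left, Int.emod_eq_of_lt (by omega) (by omega)]
    have c3 : ((c : ℤ) + q * n * k + p * n * m - q * n * k) % (p * n : ℕ) = c := by
      rw [show (c : ℤ) + q * n * k + p * n * m - q * n * k = c + (p * n : ℕ) * m by
        push_cast; ring, Int.add_mul_emod_self_left, Int.emod_eq_of_lt (by omega) (by omega)]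
    simp only [c1, c2, c3, Fin.ext_iff]
    exact ⟨rfl, rfl⟩

variable [NeZero n] [NeZero p]

/-- the square with a given lower left corner -/
noncomputable def cellOf (Q : Torus n p q) : Cell n p := (existsUnique_cell Q).choose

@[simp] lemma pt_cellOf (Q : Torus n p q) : pt n p q (cellOf Q).toPlane = Q :=
  (existsUnique_cell Q).choose_spec.1

@[simp] lemma cellOf_pt (c : Cell n p) : cellOf (pt n p q c.toPlane) = c :=
  ((existsUnique_cell (pt n p q c.toPlane)).choose_spec.2 c rfl).symm

/-- the identification of the points of the torus with the squares of the planar picture -/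
noncomputable def cellEquiv (n p : ℕ) (q : ℤ) [NeZero n] [NeZero p] : Torus n p q ≃ Cell n p where
  toFun := cellOf
  invFun c := pt n p q c.toPlane
  left_inv := pt_cellOf
  right_inv := cellOf_pt

noncomputable instance : Fintype (Torus n p q) := Fintype.ofEquiv _ (cellEquiv n p q).symm

noncomputable instance : DecidableEq (Torus n p q) := Classical.decEq _

end Torus

end TorusGrid

namespace TorusGrid
open TwistedGrid

/-! ### Generators as states of the grid torus -/

variable {n p : ℕ} {q : ℤ} [NeZero n] [NeZero p]

/-- the image in the torus of a family of points of the plane -/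
noncomputable def ptSet (n p : ℕ) (q : ℤ) (c : Fin n → ℤ × ℤ) : Finset (Torus n p q) :=
  open Classical in Finset.univ.image fun i => pt n p q (c i)

lemma mem_ptSet {c : Fin n → ℤ × ℤ} {Q : Torus n p q} :
    Q ∈ ptSet n p q c ↔ ∃ i, pt n p q (c i) = Q := by simp [ptSet]

lemma pt_mem_ptSet (c : Fin n → ℤ × ℤ) (i : Fin n) : pt n p q (c i) ∈ ptSet n p q c :=
  mem_ptSet.2 ⟨i, rfl⟩

/-- The family `c` of points of the plane has one point in each row (in the fundamental domain) and
one point in each column of the grid. -/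
structure IsTransversal (c : Fin n → ℤ × ℤ) : Prop where
  row : ∃ f : Fin n → Fin n, Function.Bijective f ∧ ∀ i, (c i).2 = (f i : ℕ)
  column : ∃ f : Fin n → Fin n, Function.Bijective f ∧ ∀ i, (c i).1 % n = (f i : ℕ)

lemma fin_eq_of_dvd {a b : Fin n} (h : (n : ℤ) ∣ (a : ℕ) - (b : ℕ)) : a = b := by
  have := Int.eq_zero_of_abs_lt_dvd h (by rw [abs_lt]; omega)
  exact Fin.ext (by omega)

namespace IsTransversal

variable {c : Fin n → ℤ × ℤ} (hc : IsTransversal c)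
include hc

lemma eq_of_row {i j : Fin n} (h : (n : ℤ) ∣ (c i).2 - (c j).2) : i = j := by
  obtain ⟨f, hf, hfc⟩ := hc.row
  rw [hfc, hfc] at h
  exact hf.1 (fin_eq_of_dvd h)

lemma exists_row (t : ℤ) : ∃ i, (n : ℤ) ∣ (c i).2 - t := by
  have hn : (0 : ℤ) < n := by exact_mod_cast NeZero.pos n
  obtain ⟨f, hf, hfc⟩ := hc.row
  have h1 := Int.emod_nonneg t hn.ne'
  have h2 := Int.emod_lt_of_pos t hn
  obtain ⟨i, hi⟩ := hf.2 ⟨(t % n).toNat, by omega⟩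
  refine ⟨i, ?_⟩
  rw [hfc, hi]
  simp only [Int.toNat_of_nonneg h1]
  exact ⟨-(t / n), by have := Int.emod_add_mul_ediv t n; linarith⟩

lemma eq_of_column {i j : Fin n} (h : (n : ℤ) ∣ (c i).1 - (c j).1) : i = j := by
  obtain ⟨f, hf, hfc⟩ := hc.column
  refine hf.1 (Fin.ext ?_)
  have h1 : (c j).1 % n = (c i).1 % n := (Int.modEq_iff_dvd.2 h)
  rw [hfc, hfc] at h1
  omega

lemma exists_column (s : ℤ) : ∃ i, (n : ℤ) ∣ (c i).1 - s := by
  have hn : (0 : ℤ) < n := by exact_mod_cast NeZero.pos n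
  obtain ⟨f, hf, hfc⟩ := hc.column
  have h1 := Int.emod_nonneg s hn.ne'
  have h2 := Int.emod_lt_of_pos s hn
  obtain ⟨i, hi⟩ := hf.2 ⟨(s % n).toNat, by omega⟩
  refine ⟨i, ?_⟩
  have h3 := hfc i
  rw [hi] at h3
  simp only [Int.toNat_of_nonneg h1] at h3
  exact Int.ModEq.dvd h3.symm

lemma pt_injective {i j : Fin n} (h : pt n p q (c i) = pt n p q (c j)) : i = j := by
  refine hc.eq_of_row ((sub_mem_zmultiples_hStep (p := p) (q := q) _ _).1 ?_)
  rw [h, sub_self]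
  exact zero_mem _

lemma isState (hpq : IsCoprime (p : ℤ) q) :
    IsState (hStep n p q) (vStep n p q) (ptSet n p q c) where
  row_exists Q := by
    obtain ⟨v, rfl⟩ := exists_pt Q
    obtain ⟨i, hi⟩ := hc.exists_row v.2
    obtain ⟨s, hs⟩ := AddSubgroup.mem_zmultiples_iff.1
      ((sub_mem_zmultiples_hStep (p := p) (q := q) (c i) v).2 hi)
    exact ⟨s, by rw [hs, add_sub_cancel]; exact pt_mem_ptSet c i⟩
  col_exists Q := by
    obtain ⟨v, rfl⟩ := exists_pt Q
    obtain ⟨i, hi⟩ := hc.exists_column v.1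
    obtain ⟨s, hs⟩ := AddSubgroup.mem_zmultiples_iff.1
      ((sub_mem_zmultiples_vStep hpq (c i) v).2 hi)
    exact ⟨s, by rw [hs, add_sub_cancel]; exact pt_mem_ptSet c i⟩
  row_unique Q hQ s hs := by
    obtain ⟨i, rfl⟩ := mem_ptSet.1 hQ
    obtain ⟨j, hj⟩ := mem_ptSet.1 hs
    have hji : j = i := hc.eq_of_row ((sub_mem_zmultiples_hStep (p := p) (q := q) _ _).1
      (AddSubgroup.mem_zmultiples_iff.2 ⟨s, by rw [hj]; abel⟩))
    subst hji
    simpa using hj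
  col_unique Q hQ s hs := by
    obtain ⟨i, rfl⟩ := mem_ptSet.1 hQ
    obtain ⟨j, hj⟩ := mem_ptSet.1 hs
    have hji : j = i := hc.eq_of_column ((sub_mem_zmultiples_vStep hpq _ _).1
      (AddSubgroup.mem_zmultiples_iff.2 ⟨s, by rw [hj]; abel⟩))
    subst hji
    simpa using hj

lemma ind_ptSet (Q : Torus n p q) :
    ind (ptSet n p q c) Q = ∑ i, if pt n p q (c i) = Q then 1 else 0 := by
  by_cases hQ : Q ∈ ptSet n p q c
  · rw [ind_of_mem hQ]
    obtain ⟨i, rfl⟩ := mem_ptSet.1 hQ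
    rw [Finset.sum_eq_single i]
    · simp
    · intro j _ hj
      exact if_neg fun he => hj (hc.pt_injective he)
    · simp
  · rw [ind_of_notMem hQ, Finset.sum_eq_zero]
    intro i _
    exact if_neg fun he => hQ (mem_ptSet.2 ⟨i, he⟩)

end IsTransversal

/-- the state of the torus that corresponds to a generator -/
noncomputable def genSet (q : ℤ) (x : Generator n p) : Finset (Torus n p q) := ptSet n p q x.point

lemma isTransversal_point (x : Generator n p) : IsTransversal x.point where
  row := ⟨id, Function.bijective_id, fun _ => rfl⟩
  column := ⟨x.1, x.1.bijective, fun i => by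
    simp only [Generator.point]
    push_cast
    rw [Int.add_mul_emod_self_left]
    exact_mod_cast Nat.mod_eq_of_lt (x.1 i).2⟩

lemma point_mem_genSet (x : Generator n p) (i : Fin n) : pt n p q (x.point i) ∈ genSet q x :=
  pt_mem_ptSet _ i

lemma isState_genSet (hpq : IsCoprime (p : ℤ) q) (x : Generator n p) :
    IsState (hStep n p q) (vStep n p q) (genSet q x) := (isTransversal_point x).isState hpq

lemma point_fst_lt (x : Generator n p) (i : Fin n) : (x.point i).1 < (p * n : ℕ) := by
  have h1 := (x.1 i).2
  have h2 := ZMod.val_lt (x.2 i)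
  have h3 : (x.1 i : ℕ) + n * (x.2 i).val < p * n := by nlinarith
  simp only [Generator.point]
  exact_mod_cast h3

lemma point_eq_of_pt {x y : Generator n p} {i j : Fin n}
    (h : pt n p q (x.point i) = pt n p q (y.point j)) :
    i = j ∧ x.1 i = y.1 j ∧ x.2 i = y.2 j := by
  rw [pt_eq_iff] at h
  obtain ⟨k, m, h⟩ := h
  have hn : (0 : ℤ) < n := by exact_mod_cast NeZero.pos n
  have h2 : ((j : ℕ) : ℤ) = (i : ℕ) + n * k := congrArg Prod.snd h
  have hij : j = i := fin_eq_of_dvd ⟨k, by linarith⟩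
  subst hij
  have hk : k = 0 := by
    have : (n : ℤ) * k = 0 := by linarith
    exact (mul_eq_zero.1 this).resolve_left hn.ne'
  subst hk
  have h1 : (y.point j).1 = (x.point j).1 + q * n * 0 + p * n * m := congrArg Prod.fst h
  have hx := point_fst_lt x j
  have hy := point_fst_lt y j
  have hx0 : 0 ≤ (x.point j).1 := by simp only [Generator.point]; positivity
  have hy0 : 0 ≤ (y.point j).1 := by simp only [Generator.point]; positivity
  have hd : (x.point j).1 = (y.point j).1 := by
    have := Int.eq_zero_of_abs_lt_dvd (m := (p * n : ℕ)) (x := (y.point j).1 - (x.point j).1)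
      ⟨m, by push_cast; linarith⟩ (by rw [abs_lt]; omega)
    omega
  simp only [Generator.point] at hd
  have hd' : (x.1 j : ℕ) + n * (x.2 j).val = (y.1 j : ℕ) + n * (y.2 j).val := by exact_mod_cast hd
  have e1 : (x.1 j : ℕ) = y.1 j := by
    have := congrArg (· % n) hd'
    simpa [Nat.add_mul_mod_self_left, Nat.mod_eq_of_lt] using this
  refine ⟨rfl, Fin.ext e1, ZMod.val_injective p ?_⟩
  rw [e1] at hd'
  exact Nat.eq_of_mul_eq_mul_left (NeZero.pos n) (by omega)

lemma genSet_injective : Function.Injective (genSet (n := n) (p := p) q) := by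
  intro x y h
  have key : ∀ i, x.1 i = y.1 i ∧ x.2 i = y.2 i := by
    intro i
    obtain ⟨j, hj⟩ := mem_ptSet.1 (h ▸ point_mem_genSet x i : pt n p q (x.point i) ∈ genSet q y)
    obtain ⟨rfl, h2⟩ := point_eq_of_pt hj.symm
    exact h2
  exact Prod.ext (Equiv.ext fun i => (key i).1) (funext fun i => (key i).2)

/-- Every state of the torus comes from a generator. -/
lemma exists_genSet_eq (hpq : IsCoprime (p : ℤ) q) {S : Finset (Torus n p q)}
    (hS : IsState (hStep n p q) (vStep n p q) S) : ∃ x : Generator n p, genSet q x = S := by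
  have hN : (0 : ℤ) < (p * n : ℕ) := by exact_mod_cast NeZero.pos (p * n)
  have hrow : ∀ i : Fin n, ∃ s : ℕ, s < p * n ∧ pt n p q ((s : ℤ), ((i : ℕ) : ℤ)) ∈ S := by
    intro i
    obtain ⟨s, hs⟩ := hS.row_exists (pt n p q (0, (i : ℕ)))
    have h1 := Int.emod_nonneg s hN.ne'
    have h2 := Int.emod_lt_of_pos s hN
    refine ⟨(s % (p * n : ℕ)).toNat, by omega, ?_⟩
    rw [Int.toNat_of_nonneg h1]
    have h3 := mod_addOrderOf_zsmul (hStep n p q) s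
    rw [addOrderOf_hStep] at h3
    rw [← h3, smul_hStep, ← pt_add] at hs
    simpa using hs
  choose s hs hsS using hrow
  have hinj : ∀ i j : Fin n, s i % n = s j % n → i = j := by
    intro i j h
    have hd : (n : ℤ) ∣ (s j : ℤ) - s i := (Nat.modEq_iff_dvd.1 h)
    obtain ⟨t, ht⟩ := AddSubgroup.mem_zmultiples_iff.1 ((sub_mem_zmultiples_vStep hpq
      ((s j : ℤ), ((j : ℕ) : ℤ)) ((s i : ℤ), ((i : ℕ) : ℤ))).2 hd)
    have he := hS.col_eq (hsS i) (hsS j) t (by rw [ht]; abel)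
    have h0 : pt n p q ((s j : ℤ), ((j : ℕ) : ℤ)) - pt n p q ((s i : ℤ), ((i : ℕ) : ℤ)) ∈
        AddSubgroup.zmultiples (hStep n p q) := by rw [he, sub_self]; exact zero_mem _
    exact (fin_eq_of_dvd ((sub_mem_zmultiples_hStep _ _).1 h0)).symm
  let σ : Fin n → Fin n := fun i => ⟨s i % n, Nat.mod_lt _ (NeZero.pos n)⟩
  have hσ : Function.Bijective σ :=
    Finite.injective_iff_bijective.1 fun i j h => hinj i j (congrArg Fin.val h)
  let x : Generator n p := (Equiv.ofBijective σ hσ, fun i => ((s i / n : ℕ) : ZMod p))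
  have hx : ∀ i, x.point i = ((s i : ℤ), ((i : ℕ) : ℤ)) := by
    intro i
    have h1 : s i / n < p := Nat.div_lt_of_lt_mul (by rw [mul_comm]; exact hs i)
    have h2 : (((s i / n : ℕ) : ZMod p)).val = s i / n := ZMod.val_cast_of_lt h1
    have h3 := Nat.mod_add_div (s i) n
    simp only [Generator.point, x, h2, Equiv.ofBijective_apply, σ, h3]
  refine ⟨x, Finset.ext fun Q => ⟨fun hQ => ?_, fun hQ => ?_⟩⟩
  · obtain ⟨i, rfl⟩ := mem_ptSet.1 hQ
    rw [hx]
    exact hsS i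
  · obtain ⟨t, ht⟩ := (isState_genSet hpq x).row_exists Q
    obtain ⟨i, hi⟩ := mem_ptSet.1 ht
    have := hS.row_eq hQ (by rw [hx]; exact hsS i) t hi
    rw [← this]
    exact point_mem_genSet x i

/-! ### The rectangles of the grid torus -/

/-- the rectangle of the torus with the given corner and size -/
def torusRect (q : ℤ) (r : Rectangle n p) : Rect (Torus n p q) :=
  ⟨pt n p q r.corner.toPlane, ((r.width : ℕ) : ℤ), ((r.height : ℕ) : ℤ)⟩

lemma torusRect_injective : Function.Injective (torusRect (n := n) (p := p) q) := by
  rintro ⟨c, w, h⟩ ⟨c', w', h'⟩ he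
  simp only [torusRect, Rect.mk.injEq, Nat.cast_inj] at he
  obtain ⟨h1, h2, h3⟩ := he
  have := congrArg cellOf h1
  simp only [cellOf_pt] at this
  rw [this, Fin.ext h2, Fin.ext h3]

lemma exists_torusRect_eq (r : Rect (Torus n p q)) (hw : 0 ≤ r.w) (hw' : r.w < (p * n : ℕ))
    (hh : 0 ≤ r.h) (hh' : r.h < (p * n : ℕ)) : ∃ s : Rectangle n p, torusRect q s = r := by
  refine ⟨⟨cellOf r.c, ⟨r.w.toNat, by omega⟩, ⟨r.h.toNat, by omega⟩⟩, ?_⟩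
  simp only [torusRect, pt_cellOf, Int.toNat_of_nonneg hw, Int.toNat_of_nonneg hh]

lemma pt_pos (r : Rectangle n p) (u v : ℕ) : pt n p q (r.pos u v) =
    (torusRect q r).c + (u : ℤ) • hStep n p q + (v : ℤ) • vStep n p q := by
  rw [torusRect, pt_add_steps]; rfl

lemma pt_pos_ll (r : Rectangle n p) : pt n p q (r.pos 0 0) = (torusRect q r).c := by
  rw [pt_pos]; simp

lemma pt_pos_lr (r : Rectangle n p) :
    pt n p q (r.pos r.width 0) = (torusRect q r).lr (hStep n p q) := by
  rw [pt_pos]; simp [Rect.lr, torusRect]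

lemma pt_pos_ul (r : Rectangle n p) :
    pt n p q (r.pos 0 r.height) = (torusRect q r).ul (vStep n p q) := by
  rw [pt_pos]; simp [Rect.ul, torusRect]

lemma pt_pos_ur (r : Rectangle n p) :
    pt n p q (r.pos r.width r.height) = (torusRect q r).ur (hStep n p q) (vStep n p q) := by
  rw [pt_pos]; rfl

lemma mult_eq_cover (r : Rectangle n p) (c : Cell n p) :
    (r.mult q c : ℤ) =
      (torusRect q r).cover (hStep n p q) (vStep n p q) (pt n p q c.toPlane) := by
  unfold Rectangle.mult Rect.cover
  rw [Finset.card_filter, Finset.sum_product]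
  push_cast
  change _ = isum _ ((r.width : ℕ) : ℤ)
  rw [isum_natCast]
  refine Finset.sum_congr rfl fun u _ => ?_
  change _ = isum _ ((r.height : ℕ) : ℤ)
  rw [isum_natCast]
  refine Finset.sum_congr rfl fun v _ => ?_
  rw [← pt_pos]
  by_cases hs : SamePoint n p q (r.pos u v) c.toPlane
  · rw [if_pos hs, if_pos ((pt_eq_iff _ _).2 hs)]
  · rw [if_neg hs, if_neg fun he => hs ((pt_eq_iff _ _).1 he)]

lemma connects_iff_joins (hpq : IsCoprime (p : ℤ) q) (r : Rectangle n p) (x y : Generator n p) :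
    r.Connects q x y ↔
      Joins (hStep n p q) (vStep n p q) (torusRect q r) (genSet q x) (genSet q y) := by
  have hX := isState_genSet hpq x
  constructor
  · rintro ⟨hw, hh, i, j, hij, h1, h2, h3, h4, h5⟩
    rw [← pt_eq_iff, pt_pos_ll] at h1
    rw [← pt_eq_iff, pt_pos_ur] at h2
    rw [← pt_eq_iff, pt_pos_lr] at h3
    rw [← pt_eq_iff, pt_pos_ul] at h4
    refine ⟨Int.natCast_pos.2 hw, Int.natCast_pos.2 hh, h1 ▸ point_mem_genSet x i,
      h2 ▸ point_mem_genSet x j, fun he => hij ?_, fun Q => ?_⟩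
    · rw [h1, h2] at he
      exact (point_eq_of_pt he).1
    · rw [genSet, genSet, (isTransversal_point x).ind_ptSet, (isTransversal_point y).ind_ptSet,
        ← Finset.sum_sub_distrib, h1, h2, h3, h4]
      have hz : ∀ k ∈ Finset.univ, k ∉ ({i, j} : Finset (Fin n)) →
          ((if pt n p q (x.point k) = Q then (1 : ℤ) else 0)
            - if pt n p q (y.point k) = Q then 1 else 0) = 0 := by
        intro k _ hk
        simp only [Finset.mem_insert, Finset.mem_singleton, not_or] at hk
        rw [h5 k hk.1 hk.2, sub_self]
      rw [← Finset.sum_subset (Finset.subset_univ {i, j}) hz, Finset.sum_pair hij]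
      ring
  · intro h
    have hY := isState_genSet hpq y
    obtain ⟨i, hi⟩ := mem_ptSet.1 h.c_mem
    obtain ⟨j, hj⟩ := mem_ptSet.1 h.ur_mem
    obtain ⟨i', hi'⟩ := mem_ptSet.1 (h.lr_mem hX)
    obtain ⟨j', hj'⟩ := mem_ptSet.1 (h.ul_mem hX)
    have hrow : ∀ {k l : Fin n}, pt n p q (x.point k) - pt n p q (y.point l) ∈
        AddSubgroup.zmultiples (hStep n p q) → k = l := fun {k l} hkl =>
      fin_eq_of_dvd ((sub_mem_zmultiples_hStep _ _).1 hkl)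
    have ei : i = i' := hrow (AddSubgroup.mem_zmultiples_iff.2
      ⟨-(torusRect q r).w, by rw [hi, hi', Rect.lr]; module⟩)
    have ej : j = j' := hrow (AddSubgroup.mem_zmultiples_iff.2
      ⟨(torusRect q r).w, by rw [hj, hj', Rect.ur, Rect.ul]; module⟩)
    subst ei ej
    refine ⟨Int.natCast_pos.1 h.w_pos, Int.natCast_pos.1 h.h_pos, i, j, ?_, ?_, ?_, ?_, ?_, ?_⟩
    · rintro rfl
      exact h.ne (hi.symm.trans hj)
    · rw [← pt_eq_iff, pt_pos_ll]; exact hi.symm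
    · rw [← pt_eq_iff, pt_pos_ur]; exact hj.symm
    · rw [← pt_eq_iff, pt_pos_lr]; exact hi'.symm
    · rw [← pt_eq_iff, pt_pos_ul]; exact hj'.symm
    · intro k hki hkj
      have hk : pt n p q (x.point k) ∈ genSet q y :=
        (h.mem_target_iff hX).2 (Or.inl ⟨point_mem_genSet x k,
          fun he => hki (point_eq_of_pt (he.trans hi.symm)).1,
          fun he => hkj (point_eq_of_pt (he.trans hj.symm)).1⟩)
      obtain ⟨l, hl⟩ := mem_ptSet.1 hk
      obtain ⟨rfl, e1, e2⟩ := point_eq_of_pt hl.symm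
      simp only [Generator.point, e1, e2]

/-- Embedded rectangles without points of `x` in the interior have no points of `y` there either,
and are the vacant ones. -/
lemma connectsEmpty_iff (hpq : IsCoprime (p : ℤ) q) (r : Rectangle n p) (x y : Generator n p) :
    r.ConnectsEmpty q x y ↔
      Joins (hStep n p q) (vStep n p q) (torusRect q r) (genSet q x) (genSet q y) ∧
      Vacant (hStep n p q) (vStep n p q) (torusRect q r) (genSet q x) (genSet q y) := by
  have hX := isState_genSet hpq x
  unfold Rectangle.ConnectsEmpty
  rw [connects_iff_joins hpq]
  refine and_congr_right fun h => ⟨fun ⟨h1, h2⟩ => ?_, fun hv => ⟨fun c => ?_, ?_⟩⟩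
  · refine h.vacant_of_cover_le_one hX ?_ ?_ (fun C => ?_) ?_
    · rw [addOrderOf_hStep]; exact Int.ofNat_lt.2 r.width.2
    · rw [addOrderOf_vStep hpq]; exact Int.ofNat_lt.2 r.height.2
    · rw [← pt_cellOf C, ← mult_eq_cover]
      exact_mod_cast h1 _
    · intro u v hu hu' hv hv' hm
      obtain ⟨u, rfl⟩ := Int.eq_ofNat_of_zero_le hu.le
      obtain ⟨v, rfl⟩ := Int.eq_ofNat_of_zero_le hv.le
      rw [← pt_pos] at hm
      obtain ⟨i, hi⟩ := mem_ptSet.1 hm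
      exact h2 u v (by exact_mod_cast hu) (Int.ofNat_lt.1 hu') (by exact_mod_cast hv)
        (Int.ofNat_lt.1 hv') i ((pt_eq_iff _ _).1 hi.symm)
  · have := hv.cover_le_one h hX (pt n p q c.toPlane)
    rw [← mult_eq_cover] at this
    exact_mod_cast this
  · intro u v hu hu' hv1 hv' i hi
    rw [← pt_eq_iff, pt_pos] at hi
    refine (hv.notMem u v (by exact_mod_cast hu) (Int.ofNat_lt.2 hu') (by exact_mod_cast hv1)
      (Int.ofNat_lt.2 hv')).1 ?_
    rw [hi]
    exact point_mem_genSet x i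

/-- A pair of rectangles in the planar picture, as a pair of rectangles of the torus. -/
noncomputable def torusDecomp (q : ℤ) (t : Generator n p × Rectangle n p × Rectangle n p) :
    Decomp (Torus n p q) := ⟨genSet q t.1, torusRect q t.2.1, torusRect q t.2.2⟩

lemma mem_decompositions_iff (hpq : IsCoprime (p : ℤ) q) (x z : Generator n p) (ψ : Cell n p → ℕ)
    (t : Generator n p × Rectangle n p × Rectangle n p) :
    t ∈ decompositions q x z ψ ↔ IsDecomp (hStep n p q) (vStep n p q) (genSet q x) (genSet q z)
      (fun Q => (ψ (cellOf Q) : ℤ)) (torusDecomp q t) := by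
  unfold decompositions
  rw [Set.mem_ofPred_eq, connectsEmpty_iff hpq, connectsEmpty_iff hpq]
  constructor
  · rintro ⟨⟨h1, h2⟩, ⟨h3, h4⟩, h5⟩
    refine ⟨isState_genSet hpq _, h1, h3, h2, h4, fun C => ?_⟩
    rw [← h5]
    push_cast
    rw [mult_eq_cover, mult_eq_cover, pt_cellOf]
    rfl
  · rintro ⟨-, h1, h3, h2, h4, h5⟩
    refine ⟨⟨h1, h2⟩, ⟨h3, h4⟩, fun c => ?_⟩
    have := h5 (pt n p q c.toPlane)
    simp only [torusDecomp, ← mult_eq_cover, cellOf_pt] at this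
    exact_mod_cast this

/-- Each polygon that is not a strip has exactly two decompositions if it has one. -/
theorem ncard_decompositions (hpq : IsCoprime (p : ℤ) q) (x z : Generator n p)
    (ψ : Cell n p → ℕ) (hne : (decompositions q x z ψ).Nonempty) (hα : ¬ IsAlphaStrip ψ)
    (hβ : ¬ IsBetaStrip ψ) : (decompositions q x z ψ).ncard = 2 := by
  have hn : (0 : ℤ) < n := by exact_mod_cast NeZero.pos n
  obtain ⟨t, ht⟩ := hne
  have hX := isState_genSet hpq x
  have hZ := isState_genSet hpq z
  have key : ∀ s : ℤ, ∀ b : ℕ, b < n → ((n : ℤ) ∣ b - s ↔ b = (s % n).toNat) := by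
    intro s b hb
    have h1 := Int.emod_nonneg s hn.ne'
    rw [← Int.modEq_iff_dvd, Int.ModEq, Int.emod_eq_of_lt (a := (b : ℤ)) (by omega) (by omega)]
    omega
  obtain ⟨d', hne, hd', huniq⟩ := ((mem_decompositions_iff hpq x z ψ t).1 ht).exists_unique_other
    hX hZ
    (by
      rintro ⟨P, hP⟩
      obtain ⟨v, rfl⟩ := exists_pt P
      have h1 := Int.emod_nonneg v.2 hn.ne'
      have h2 := Int.emod_lt_of_pos v.2 hn
      refine hα ⟨⟨(v.2 % n).toNat, by omega⟩, fun c => ?_⟩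
      have := hP (pt n p q c.toPlane)
      simp only [cellOf_pt, coset, sub_mem_zmultiples_hStep] at this
      simp only [Cell.toPlane, key v.2 _ c.2.2] at this
      rw [← Nat.cast_inj (R := ℤ), this]
      simp only [Fin.ext_iff]
      split_ifs <;> rfl)
    (by
      rintro ⟨P, hP⟩
      obtain ⟨v, rfl⟩ := exists_pt P
      have h1 := Int.emod_nonneg v.1 hn.ne'
      have h2 := Int.emod_lt_of_pos v.1 hn
      refine hβ ⟨⟨(v.1 % n).toNat, by omega⟩, fun c => ?_⟩
      have := hP (pt n p q c.toPlane)
      simp only [cellOf_pt, coset, sub_mem_zmultiples_vStep hpq] at this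
      have h3 : (n : ℤ) ∣ c.toPlane.1 - v.1 ↔ (n : ℤ) ∣ ((c.1 : ℕ) % n : ℕ) - v.1 := by
        have e := Nat.mod_add_div (c.1 : ℕ) n
        have e2 : c.toPlane.1 - v.1 = (((c.1 : ℕ) % n : ℕ) - v.1) + n * ((c.1 : ℕ) / n : ℕ) := by
          simp only [Cell.toPlane]
          conv_lhs => rw [← e]
          push_cast
          ring
        rw [e2]
        exact (Int.dvd_add_left (Dvd.intro _ rfl))
      simp only [h3, key v.1 _ (Nat.mod_lt _ (NeZero.pos n))] at this
      rw [← Nat.cast_inj (R := ℤ), this]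
      split_ifs <;> rfl)
  obtain ⟨y, hy⟩ := exists_genSet_eq hpq hd'.state
  have w1 := hd'.vacant₁.w_lt
  have w2 := hd'.vacant₁.h_lt
  have w3 := hd'.vacant₂.w_lt
  have w4 := hd'.vacant₂.h_lt
  rw [addOrderOf_hStep] at w1 w3
  rw [addOrderOf_vStep hpq] at w2 w4
  obtain ⟨r₁, hr₁⟩ := exists_torusRect_eq d'.fst hd'.joins₁.w_pos.le w1 hd'.joins₁.h_pos.le w2
  obtain ⟨r₂, hr₂⟩ := exists_torusRect_eq d'.snd hd'.joins₂.w_pos.le w3 hd'.joins₂.h_pos.le w4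
  have hinj : Function.Injective (torusDecomp (n := n) (p := p) q) := by
    rintro ⟨a, b, c⟩ ⟨a', b', c'⟩ he
    simp only [torusDecomp, Decomp.mk.injEq] at he
    rw [genSet_injective he.1, torusRect_injective he.2.1, torusRect_injective he.2.2]
  have ht' : torusDecomp q (y, r₁, r₂) = d' := Decomp.ext hy hr₁ hr₂
  have hset : decompositions q x z ψ = {t, (y, r₁, r₂)} := by
    ext s
    rw [mem_decompositions_iff hpq, Set.mem_insert_iff, Set.mem_singleton_iff]
    constructor
    · intro hs
      rcases huniq _ hs with h1 | h1
      · exact Or.inl (hinj h1)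
      · exact Or.inr (hinj (h1.trans ht'.symm))
    · rintro (rfl | rfl)
      · exact (mem_decompositions_iff hpq x z ψ _).1 ht
      · rw [ht']; exact hd'
  rw [hset, Set.ncard_pair]
  rintro rfl
  exact hne ht'.symm

end TorusGrid

namespace TorusGrid
open TwistedGrid

/-! ### The square of the differential -/

section Square

variable {n p : ℕ} {q : ℤ} [NeZero n] [NeZero p] (G : GridDiagram n p q)
  {A : Type} [CommRing A] (V : Fin n → A)

/-- The rectangle `r` contributes to the coefficient of `y` in the differential of `x`. -/
def Contributes (r : Rectangle n p) (x y : Generator n p) : Prop :=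
  r.ConnectsEmpty q x y ∧ ∀ i, r.mult q (G.X i) = 0

/-- The monomial that records how often a domain covers the `O` markings. -/
noncomputable def monomialO (ψ : Cell n p → ℕ) : A := ∏ i, V i ^ ψ (G.O i)

lemma diffGen_eq (x : Generator n p) : G.diffGen V x =
    open Classical in ∑ y : Generator n p, ∑ r : Rectangle n p,
      if Contributes G r x y then Finsupp.single y (monomialO G V (r.mult q)) else 0 := by
  unfold GridDiagram.diffGen
  refine Finset.sum_congr rfl fun y _ => ?_
  rw [Finset.sum_filter]
  refine Finset.sum_congr rfl fun r _ => ?_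
  congr 1

lemma diff_single (x : Generator n p) (a : A) :
    G.diff V (Finsupp.single x a) = a • G.diffGen V x := by
  simp [GridDiagram.diff]

lemma diffGen_apply (x z : Generator n p) : G.diffGen V x z =
    open Classical in ∑ r : Rectangle n p,
      if Contributes G r x z then monomialO G V (r.mult q) else 0 := by
  classical
  rw [diffGen_eq, Finsupp.finsetSum_apply, Finset.sum_eq_single z]
  · rw [Finsupp.finsetSum_apply]
    refine Finset.sum_congr rfl fun r _ => ?_
    split_ifs <;> simp
  · intro y _ hy
    rw [Finsupp.finsetSum_apply]
    refine Finset.sum_eq_zero fun r _ => ?_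
    split_ifs <;> simp [hy]
  · simp

/-- The intermediate generator and the rectangles of a two-step contribution to the square of the
differential. -/
noncomputable def twoSteps (x z : Generator n p) :
    Finset (Generator n p × Rectangle n p × Rectangle n p) :=
  open Classical in
  Finset.univ.filter fun t => Contributes G t.2.1 x t.1 ∧ Contributes G t.2.2 t.1 z

lemma mem_twoSteps {x z : Generator n p} {t : Generator n p × Rectangle n p × Rectangle n p} :
    t ∈ twoSteps G x z ↔ Contributes G t.2.1 x t.1 ∧ Contributes G t.2.2 t.1 z := by
  simp [twoSteps]

lemma diff_diffGen_apply (x z : Generator n p) : G.diff V (G.diffGen V x) z =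
    ∑ t ∈ twoSteps G x z, monomialO G V fun c => t.2.1.mult q c + t.2.2.mult q c := by
  classical
  rw [twoSteps, Finset.sum_filter, Fintype.sum_prod_type, diffGen_eq, map_sum,
    Finsupp.finsetSum_apply]
  refine Finset.sum_congr rfl fun y _ => ?_
  rw [map_sum, Finsupp.finsetSum_apply, Fintype.sum_prod_type]
  refine Finset.sum_congr rfl fun r _ => ?_
  by_cases h : Contributes G r x y
  · rw [if_pos h, diff_single, Finsupp.smul_apply, diffGen_apply, smul_eq_mul, Finset.mul_sum]
    refine Finset.sum_congr rfl fun r' _ => ?_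
    simp only [h, true_and, mul_ite, mul_zero, monomialO, pow_add, Finset.prod_mul_distrib]
  · simp [h]

lemma not_isAlphaStrip {ψ : Cell n p → ℕ} (h : ∀ i, ψ (G.X i) = 0) : ¬ IsAlphaStrip ψ := by
  rintro ⟨b, hb⟩
  obtain ⟨i, hi, -⟩ := G.row_X b
  have := hb (G.X i)
  rw [h, if_pos hi] at this
  omega

lemma not_isBetaStrip {ψ : Cell n p → ℕ} (h : ∀ i, ψ (G.X i) = 0) : ¬ IsBetaStrip ψ := by
  rintro ⟨b, hb⟩
  obtain ⟨i, hi, -⟩ := G.column_X b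
  have := hb (G.X i)
  rw [h, if_pos hi] at this
  omega

/-- The two-step contributions with a given underlying polygon come in pairs. -/
lemma card_twoSteps_fiber (hpq : IsCoprime (p : ℤ) q) {x z : Generator n p}
    {t : Generator n p × Rectangle n p × Rectangle n p} (ht : t ∈ twoSteps G x z) :
    open Classical in ((twoSteps G x z).filter fun s =>
      (fun c => s.2.1.mult q c + s.2.2.mult q c) = fun c => t.2.1.mult q c + t.2.2.mult q c).card
        = 2 := by
  classical
  set ψ : Cell n p → ℕ := fun c => t.2.1.mult q c + t.2.2.mult q c with hψ
  rw [mem_twoSteps] at ht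
  have hX : ∀ i, ψ (G.X i) = 0 := fun i => by rw [hψ]; simp only [ht.1.2, ht.2.2]
  rw [← ncard_decompositions hpq x z ψ ⟨t, ht.1.1, ht.2.1, fun _ => rfl⟩ (not_isAlphaStrip G hX)
    (not_isBetaStrip G hX), ← Set.ncard_coe_finset]
  congr 1
  ext s
  rw [Finset.mem_coe, Finset.mem_filter, mem_twoSteps, decompositions, Set.mem_ofPred_eq]
  constructor
  · rintro ⟨⟨h1, h2⟩, h3⟩
    exact ⟨h1.1, h2.1, fun c => congrFun h3 c⟩
  · rintro ⟨h1, h2, h3⟩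
    have h4 : ∀ i, s.2.1.mult q (G.X i) + s.2.2.mult q (G.X i) = 0 := fun i => (h3 _).trans (hX i)
    exact ⟨⟨⟨h1, fun i => (Nat.add_eq_zero_iff.1 (h4 i)).1⟩, h2,
      fun i => (Nat.add_eq_zero_iff.1 (h4 i)).2⟩, funext h3⟩

theorem diff_comp_diff [Algebra (ZMod 2) A] (hpq : IsCoprime (p : ℤ) q) :
    G.diff V ∘ₗ G.diff V = 0 := by
  classical
  have h2 : ∀ a : A, (2 : ℕ) • a = 0 := fun a => by
    have : ((2 : ℕ) : A) = 0 := by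
      rw [← map_natCast (algebraMap (ZMod 2) A)]
      exact (congrArg _ (by decide : ((2 : ℕ) : ZMod 2) = 0)).trans (map_zero _)
    rw [nsmul_eq_mul, this, zero_mul]
  refine Finsupp.lhom_ext fun x a => ?_
  rw [LinearMap.comp_apply, diff_single, map_smul, LinearMap.zero_apply]
  refine smul_eq_zero_of_right a (Finsupp.ext fun z => ?_)
  rw [diff_diffGen_apply, Finsupp.zero_apply, ← Finset.sum_fiberwise_of_maps_to
    (g := fun t c => t.2.1.mult q c + t.2.2.mult q c)
    (fun t ht => Finset.mem_image_of_mem _ ht)]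
  refine Finset.sum_eq_zero fun ψ hψ => ?_
  obtain ⟨t, ht, rfl⟩ := Finset.mem_image.1 hψ
  rw [Finset.sum_congr rfl fun s hs => congrArg (monomialO G V) (Finset.mem_filter.1 hs).2,
    Finset.sum_const, card_twoSteps_fiber G hpq ht, h2]

end Square

end TorusGrid

namespace TorusGrid

/-! ### Summation by parts on a periodic box -/

section Abel

/-- The box `[0, N) × [0, N)`. -/
noncomputable def box (N : ℤ) : Finset (ℤ × ℤ) := Finset.Ico 0 N ×ˢ Finset.Ico 0 N

lemma mem_box {N : ℤ} {v : ℤ × ℤ} : v ∈ box N ↔ (0 ≤ v.1 ∧ v.1 < N) ∧ 0 ≤ v.2 ∧ v.2 < N := by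
  simp [box]

/-- A function on the plane whose sum over any `N` consecutive points of a row or column is
`1`. -/
structure Balanced (N : ℤ) (f : ℤ → ℤ → ℤ) : Prop where
  row : ∀ s t, isum (fun u => f (s + u) t) N = 1
  column : ∀ s t, isum (fun v => f s (t + v)) N = 1

/-- The discrete integral of `f` over `[0, s) × [0, t)`. -/
noncomputable def cumul (f : ℤ → ℤ → ℤ) (s t : ℤ) : ℤ := isum (fun u => isum (f u) t) s

lemma cumul_succ_left (f : ℤ → ℤ → ℤ) (s t : ℤ) :
    cumul f (s + 1) t = cumul f s t + isum (f s) t := isum_succ _ _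

lemma cumul_succ_right (f : ℤ → ℤ → ℤ) (s t : ℤ) :
    cumul f s (t + 1) = cumul f s t + isum (fun u => f u t) s := by
  simp only [cumul, isum_succ, isum_fun_add]

lemma cumul_zero_right (f : ℤ → ℤ → ℤ) (s : ℤ) : cumul f s 0 = 0 := by
  simp only [cumul, isum_zero]; simp [isum]

lemma Balanced.isum_row {N : ℤ} {f : ℤ → ℤ → ℤ} (hf : Balanced N f) (s t : ℤ) :
    isum (fun u => f u t) (s + N) = isum (fun u => f u t) s + 1 := by
  rw [isum_add, hf.row]

lemma Balanced.isum_column {N : ℤ} {f : ℤ → ℤ → ℤ} (hf : Balanced N f) (s t : ℤ) :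
    isum (f s) (t + N) = isum (f s) t + 1 := by
  rw [isum_add, hf.column]

lemma sum_Ico_telescope {N : ℤ} (hN : 0 ≤ N) (g : ℤ → ℤ) :
    ∑ s ∈ Finset.Ico 0 N, (g (s + 1) - g s) = g N - g 0 := by
  have := isum_shift g N
  rw [isum_of_nonneg _ hN, isum_of_nonneg _ hN] at this
  rw [Finset.sum_sub_distrib]
  linarith

/-- Summation by parts for a periodic function `M`. -/
lemma sum_Ico_by_parts {N : ℤ} (hN : 0 ≤ N) (M F : ℤ → ℤ) (hM : M (N - 1) = M (-1)) :
    ∑ s ∈ Finset.Ico 0 N, (M s - M (s - 1)) * F s =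
      ∑ s ∈ Finset.Ico 0 N, M s * (F s - F (s + 1)) + M (-1) * (F N - F 0) := by
  have := sum_Ico_telescope hN fun s => M (s - 1) * F s
  simp only [add_sub_cancel_right, hM, zero_sub] at this
  rw [mul_sub, ← this, ← Finset.sum_add_distrib]
  exact Finset.sum_congr rfl fun s _ => by ring

/-- The boundary terms of the summation by parts against a discrete integral of a balanced function:
they do not depend on the latter. -/
noncomputable def boundaryTerm (N : ℤ) (M : ℤ → ℤ → ℤ) : ℤ :=
  N * M (-1) (-1) - ∑ t ∈ Finset.Ico 0 N, M (-1) t - ∑ s ∈ Finset.Ico 0 N, M s (-1)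

/-- Summation by parts in two variables: the mixed difference of a periodic function `M`, summed
against a (shifted) discrete integral of a balanced function `f`. -/
lemma sum_box_by_parts {N : ℤ} (hN : 0 ≤ N) {M f : ℤ → ℤ → ℤ} (hf : Balanced N f) (a : ℤ)
    (hM₁ : ∀ t, M (N - 1) t = M (-1) t) (hM₂ : ∀ s, M s (N - 1) = M s (-1)) :
    ∑ v ∈ box N, (M v.1 v.2 - M (v.1 - 1) v.2 - M v.1 (v.2 - 1) + M (v.1 - 1) (v.2 - 1))
        * cumul f (v.1 + a) (v.2 + a) =
      ∑ v ∈ box N, M v.1 v.2 * f (v.1 + a) (v.2 + a) + boundaryTerm N M := by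
  set F : ℤ → ℤ → ℤ := fun s t => cumul f (s + a) (t + a) with hF
  have hF₁ : ∀ s t, F (s + 1) t = F s t + isum (f (s + a)) (t + a) := fun s t => by
    simp only [hF]; rw [add_right_comm, cumul_succ_left]
  have hF₂ : ∀ s t, F s (t + 1) = F s t + isum (fun u => f u (t + a)) (s + a) := fun s t => by
    simp only [hF]; rw [add_right_comm, cumul_succ_right]
  have hFN₁ : ∀ t, F N (t + 1) - F 0 (t + 1) = F N t - F 0 t + 1 := fun t => by
    have := hf.isum_row a (t + a)
    rw [hF₂, hF₂, zero_add, add_comm N a, this]; ring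
  have hFN₂ : ∀ s, F (s + 1) N - F (s + 1) 0 = F s N - F s 0 + 1 := fun s => by
    have := hf.isum_column (s + a) a
    rw [hF₁, hF₁, zero_add, add_comm N a, this]; ring
  have hFf : ∀ s t, F s t - F s (t + 1) - (F (s + 1) t - F (s + 1) (t + 1)) =
      f (s + a) (t + a) := fun s t => by
    rw [hF₂, hF₂, add_right_comm, isum_succ]; ring
  have hFNN : F N N - F N 0 - (F 0 N - F 0 0) = N := by
    rw [← sum_Ico_telescope hN fun s => F s N - F s 0]
    simp only [hFN₂, add_sub_cancel_left]
    simp [hN]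
  have inner : ∀ s, ∑ t ∈ Finset.Ico 0 N,
      (M s t - M (s - 1) t - M s (t - 1) + M (s - 1) (t - 1)) * F s t =
        ∑ t ∈ Finset.Ico 0 N, (M s t - M (s - 1) t) * (F s t - F s (t + 1))
          + (M s (-1) - M (s - 1) (-1)) * (F s N - F s 0) := fun s => by
    rw [← sum_Ico_by_parts hN (fun t => M s t - M (s - 1) t) (F s) (by simp only [hM₂])]
    exact Finset.sum_congr rfl fun t _ => by ring
  simp only [box, Finset.sum_product, boundaryTerm]
  change ∑ s ∈ Finset.Ico 0 N, ∑ t ∈ Finset.Ico 0 N,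
    (M s t - M (s - 1) t - M s (t - 1) + M (s - 1) (t - 1)) * F s t = _
  simp only [inner]
  rw [Finset.sum_add_distrib, Finset.sum_comm,
    sum_Ico_by_parts hN (fun s => M s (-1)) (fun s => F s N - F s 0) (hM₁ _)]
  have outer : ∀ t, ∑ s ∈ Finset.Ico 0 N, (M s t - M (s - 1) t) * (F s t - F s (t + 1)) =
      ∑ s ∈ Finset.Ico 0 N, M s t * f (s + a) (t + a) - M (-1) t := fun t => by
    rw [sum_Ico_by_parts hN (fun s => M s t) (fun s => F s t - F s (t + 1)) (hM₁ _)]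
    simp only [hFf]
    linear_combination (-M (-1) t) * hFN₁ t
  simp only [outer, hFN₂, hFNN]
  rw [Finset.sum_sub_distrib, Finset.sum_comm (s := Finset.Ico 0 N) (t := Finset.Ico 0 N)]
  have : ∀ s, M s (-1) * (F s N - F s 0 - (F s N - F s 0 + 1)) = - M s (-1) := fun s => by ring
  simp only [this, Finset.sum_neg_distrib]
  ring

end Abel

/-! ### Counting pairs of points of two balanced functions -/

section Forms

variable {N : ℤ} {f g : ℤ → ℤ → ℤ}

/-- The number of pairs of points in the box with both coordinates related by `R`, weighted by `f`
and `g`. -/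
noncomputable def pairSum (N : ℤ) (R : ℤ → ℤ → Prop) (f g : ℤ → ℤ → ℤ) : ℤ :=
  open Classical in
  ∑ v ∈ box N, ∑ w ∈ box N, if R v.1 w.1 ∧ R v.2 w.2 then f v.1 v.2 * g w.1 w.2 else 0

lemma pairSum_lt_right : pairSum N (· < ·) f g =
    ∑ w ∈ box N, g w.1 w.2 * cumul f w.1 w.2 := by
  classical
  rw [pairSum, Finset.sum_comm]
  refine Finset.sum_congr rfl fun w hw => ?_
  rw [mem_box] at hw
  have h1 : cumul f w.1 w.2 = ∑ v ∈ Finset.Ico 0 w.1 ×ˢ Finset.Ico 0 w.2, f v.1 v.2 := by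
    rw [Finset.sum_product, cumul, isum_of_nonneg _ hw.1.1]
    exact Finset.sum_congr rfl fun u _ => isum_of_nonneg _ hw.2.1
  have h2 : (box N).filter (fun v => v.1 < w.1 ∧ v.2 < w.2) =
      Finset.Ico 0 w.1 ×ˢ Finset.Ico 0 w.2 := by
    ext v
    simp only [Finset.mem_filter, mem_box, Finset.mem_product, Finset.mem_Ico]
    omega
  rw [h1, Finset.mul_sum, ← h2, Finset.sum_filter]
  refine Finset.sum_congr rfl fun v _ => ?_
  split_ifs <;> ring

/-- The sum over the upper right part of the box, by inclusion and exclusion. -/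
lemma Balanced.sum_upper (hg : Balanced N g) {s t : ℤ} (hs : 0 ≤ s) (hs' : s ≤ N) (ht : 0 ≤ t)
    (ht' : t ≤ N) : ∑ v ∈ Finset.Ico s N ×ˢ Finset.Ico t N, g v.1 v.2 =
      N - s - t + cumul g s t := by
  have split : ∀ (φ : ℤ → ℤ) {a : ℤ}, 0 ≤ a → a ≤ N →
      ∑ u ∈ Finset.Ico a N, φ u = isum φ N - isum φ a := fun φ a ha ha' => by
    rw [isum_of_nonneg _ ha, isum_of_nonneg _ (ha.trans ha'),
      ← Finset.Ico_union_Ico_eq_Ico ha ha',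
      Finset.sum_union (Finset.Ico_disjoint_Ico_consecutive _ _ _)]
    ring
  have hrow : ∀ t : ℕ, cumul g N t = t := fun t => by
    induction t with
    | zero => rw [Nat.cast_zero, cumul_zero_right]
    | succ t ih =>
      have := hg.isum_row 0 t
      rw [zero_add, isum_zero, zero_add] at this
      rw [Nat.cast_succ, cumul_succ_right, ih, this]
  have hcol : ∀ u, isum (g u) N = 1 := fun u => by
    have := hg.isum_column u 0
    rwa [zero_add, isum_zero, zero_add] at this
  rw [Finset.sum_product]
  simp only [split _ ht ht', hcol]
  rw [split _ hs hs', isum_fun_sub, isum_fun_sub]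
  obtain ⟨k, rfl⟩ := Int.eq_ofNat_of_zero_le ht
  change _ - cumul g N _ - (_ - cumul g s _) = _
  rw [hrow, isum_of_nonneg _ hs, isum_of_nonneg _ (hs.trans hs')]
  simp only [Finset.sum_const, Int.card_Ico, sub_zero, mul_one, nsmul_eq_mul]
  rw [Int.toNat_of_nonneg hs, Int.toNat_of_nonneg (hs.trans hs')]
  ring

/-- For a balanced function, an affine weight does not see the function. -/
lemma Balanced.sum_affine (hN : 0 ≤ N) (hf : Balanced N f) (a : ℤ) :
    ∑ v ∈ box N, f v.1 v.2 * (a - v.1 - v.2) =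
      N * a - 2 * ∑ s ∈ Finset.Ico 0 N, s := by
  have hrow : ∀ t, ∑ s ∈ Finset.Ico 0 N, f s t = 1 := fun t => by
    have := hf.row 0 t
    rw [isum_of_nonneg _ hN] at this
    simpa only [zero_add] using this
  have hcol : ∀ s, ∑ t ∈ Finset.Ico 0 N, f s t = 1 := fun s => by
    have := hf.column s 0
    rw [isum_of_nonneg _ hN] at this
    simpa only [zero_add] using this
  have h1 : ∑ v ∈ box N, f v.1 v.2 * v.1 = ∑ s ∈ Finset.Ico 0 N, s := by
    rw [box, Finset.sum_product]
    refine Finset.sum_congr rfl fun s _ => ?_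
    rw [← Finset.sum_mul, hcol, one_mul]
  have h2 : ∑ v ∈ box N, f v.1 v.2 * v.2 = ∑ s ∈ Finset.Ico 0 N, s := by
    rw [box, Finset.sum_product_right]
    refine Finset.sum_congr rfl fun s _ => ?_
    rw [← Finset.sum_mul, hrow, one_mul]
  have h3 : ∑ v ∈ box N, f v.1 v.2 * a = N * a := by
    rw [← Finset.sum_mul, box, Finset.sum_product]
    simp only [hcol]
    simp [hN]
  simp only [mul_sub, Finset.sum_sub_distrib, h1, h2, h3]
  ring

lemma pairSum_lt_left (hN : 0 ≤ N) (hf : Balanced N f) (hg : Balanced N g) :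
    pairSum N (· < ·) f g = ∑ v ∈ box N, f v.1 v.2 * cumul g (v.1 + 1) (v.2 + 1)
      + (N * (N - 2) - 2 * ∑ s ∈ Finset.Ico 0 N, s) := by
  classical
  rw [← hf.sum_affine hN, ← Finset.sum_add_distrib, pairSum]
  refine Finset.sum_congr rfl fun v hv => ?_
  rw [mem_box] at hv
  have h1 := hg.sum_upper (s := v.1 + 1) (t := v.2 + 1) (by omega) (by omega) (by omega) (by omega)
  have h2 : (box N).filter (fun w => v.1 < w.1 ∧ v.2 < w.2) =
      Finset.Ico (v.1 + 1) N ×ˢ Finset.Ico (v.2 + 1) N := by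
    ext w
    simp only [Finset.mem_filter, mem_box, Finset.mem_product, Finset.mem_Ico]
    omega
  rw [show ∀ a b c : ℤ, a * b + a * c = a * (c + b) from fun a b c => by ring,
    show N - 2 - v.1 - v.2 = N - (v.1 + 1) - (v.2 + 1) by ring, ← h1, ← h2,
    Finset.mul_sum, Finset.sum_filter]
  refine Finset.sum_congr rfl fun w _ => ?_
  split_ifs <;> ring

lemma pairSum_le_left (hN : 0 ≤ N) (hf : Balanced N f) (hg : Balanced N g) :
    pairSum N (· ≤ ·) f g = ∑ v ∈ box N, f v.1 v.2 * cumul g v.1 v.2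
      + (N * N - 2 * ∑ s ∈ Finset.Ico 0 N, s) := by
  classical
  rw [← hf.sum_affine hN, ← Finset.sum_add_distrib, pairSum]
  refine Finset.sum_congr rfl fun v hv => ?_
  rw [mem_box] at hv
  have h1 := hg.sum_upper (s := v.1) (t := v.2) (by omega) (by omega) (by omega) (by omega)
  have h2 : (box N).filter (fun w => v.1 ≤ w.1 ∧ v.2 ≤ w.2) =
      Finset.Ico v.1 N ×ˢ Finset.Ico v.2 N := by
    ext w
    simp only [Finset.mem_filter, mem_box, Finset.mem_product, Finset.mem_Ico]
    omega
  rw [show ∀ a b c : ℤ, a * b + a * c = a * (c + b) from fun a b c => by ring, ← h1, ← h2,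
    Finset.mul_sum, Finset.sum_filter]
  refine Finset.sum_congr rfl fun w _ => ?_
  split_ifs <;> ring

end Forms

end TorusGrid

namespace TorusGrid
open TwistedGrid

/-! ### Lifts to the box -/

section Lifts

variable {n p : ℕ} {q : ℤ} [NeZero n] [NeZero p]

/-- A function on the torus as a function of the planar coordinates. -/
def pull (f : Torus n p q → ℤ) (s t : ℤ) : ℤ := f (pt n p q (s, t))

lemma pt_add_hStep (s t u : ℤ) :
    pt n p q (s + u, t) = pt n p q (s, t) + u • hStep n p q := by
  rw [smul_hStep, ← pt_add]; simp

lemma pt_add_vStep (s t u : ℤ) :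
    pt n p q (s, t + u) = pt n p q (s, t) + u • vStep n p q := by
  rw [smul_vStep, ← pt_add]; simp

/-- A circle meets a state once. -/
lemma isum_ind {T : Type*} [AddCommGroup T] [DecidableEq T] {S : Finset T} {e Q : T}
    (he : 0 < addOrderOf e) (h1 : ∃ s : ℤ, Q + s • e ∈ S)
    (h2 : ∀ P ∈ S, ∀ s : ℤ, P + s • e ∈ S → s • e = 0) :
    isum (fun u => ind S (Q + u • e)) (addOrderOf e) = 1 := by
  have he' : (0 : ℤ) < addOrderOf e := by exact_mod_cast he
  obtain ⟨s, hs⟩ := h1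
  have h3 := Int.emod_nonneg s he'.ne'
  have h4 := Int.emod_lt_of_pos s he'
  rw [← mod_addOrderOf_zsmul] at hs
  rw [isum_of_nonneg _ he'.le, Finset.sum_eq_single (s % addOrderOf e)]
  · exact ind_of_mem hs
  · intro u hu hne
    rw [Finset.mem_Ico] at hu
    refine ind_of_notMem fun hm => hne ?_
    have := h2 _ hs (u - s % addOrderOf e) (by
      rw [sub_smul]
      convert hm using 1
      abel)
    have := eq_zero_of_smul this (by rw [abs_lt]; omega)
    omega
  · intro hn
    exact absurd (Finset.mem_Ico.2 ⟨h3, h4⟩) hn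

lemma balanced_pull (hpq : IsCoprime (p : ℤ) q) {S : Finset (Torus n p q)}
    (hS : IsState (hStep n p q) (vStep n p q) S) : Balanced (p * n : ℕ) (pull (ind S)) where
  row s t := by
    have := isum_ind (Q := pt n p q (s, t)) (by rw [addOrderOf_hStep]; exact NeZero.pos _)
      (hS.row_exists _) hS.row_unique
    rw [addOrderOf_hStep] at this
    simpa only [pull, pt_add_hStep] using this
  column s t := by
    have := isum_ind (Q := pt n p q (s, t)) (by rw [addOrderOf_vStep hpq]; exact NeZero.pos _)
      (hS.col_exists _) hS.col_unique
    rw [addOrderOf_vStep hpq] at this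
    simpa only [pull, pt_add_vStep] using this

/-- the representatives in the box of a point of the torus -/
def liftPoint (n p : ℕ) (q : ℤ) (c : ℤ × ℤ) (k : Fin p) : ℤ × ℤ :=
  ((c.1 + n * q * (k : ℕ)) % (n * p : ℤ), c.2 + n * (k : ℕ))

lemma sum_liftPoint (c : ℤ × ℤ) (h0 : 0 ≤ c.2) (h1 : c.2 < n) (φ : ℤ × ℤ → ℤ) :
    ∑ k, φ (liftPoint n p q c k) =
      ∑ v ∈ box (p * n : ℕ), (if pt n p q c = pt n p q v then 1 else 0) * φ v := by
  have hn : (0 : ℤ) < n := by exact_mod_cast NeZero.pos n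
  have hN : (0 : ℤ) < n * p := by exact_mod_cast NeZero.pos (n * p)
  have hNc : ((p * n : ℕ) : ℤ) = n * p := by push_cast; ring
  simp only [ite_mul, one_mul, zero_mul]
  rw [← Finset.sum_filter]
  refine Finset.sum_bij (fun k _ => liftPoint n p q c k) ?_ ?_ ?_ fun _ _ => rfl
  · intro k _
    have h2 : (n : ℤ) * (k : ℕ) + n ≤ n * p := by
      have : ((k : ℕ) : ℤ) + 1 ≤ p := by exact_mod_cast k.2
      nlinarith
    have h3 : (0 : ℤ) ≤ n * (k : ℕ) := by positivity
    rw [Finset.mem_filter, mem_box, pt_eq_iff, hNc]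
    refine ⟨⟨⟨Int.emod_nonneg _ hN.ne', Int.emod_lt_of_pos _ hN⟩, ?_, ?_⟩, ?_⟩
    · simp only [liftPoint]; omega
    · simp only [liftPoint]; omega
    · refine ⟨(k : ℕ), -((c.1 + n * q * (k : ℕ)) / (n * p : ℤ)), ?_⟩
      have := Int.emod_add_mul_ediv (c.1 + n * q * (k : ℕ)) (n * p : ℤ)
      ext
      · simp only [liftPoint]; linarith
      · rfl
  · intro k _ l _ h
    have h2 : c.2 + n * (k : ℕ) = c.2 + n * (l : ℕ) := congrArg Prod.snd h
    have h3 : ((k : ℕ) : ℤ) = (l : ℕ) := mul_left_cancel₀ hn.ne' (by linarith)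
    exact Fin.ext (by exact_mod_cast h3)
  · rintro ⟨s, t⟩ hv
    rw [Finset.mem_filter, mem_box, pt_eq_iff, hNc] at hv
    obtain ⟨⟨⟨hs, hs'⟩, ht, ht'⟩, k, m, h⟩ := hv
    obtain ⟨rfl, rfl⟩ := Prod.mk.inj h
    simp only at hs hs' ht ht'
    have hk : 0 ≤ k := by
      by_contra! hk
      nlinarith
    have hk' : k < p := by
      by_contra! hk
      nlinarith
    refine ⟨⟨k.toNat, by omega⟩, Finset.mem_univ _, ?_⟩
    simp only [liftPoint, Int.toNat_of_nonneg hk]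
    ext
    · simp only
      rw [← Int.emod_eq_of_lt hs hs', show c.1 + q * n * k + p * n * m =
        c.1 + n * q * k + n * p * m by ring, Int.add_mul_emod_self_left]
    · rfl

/-- Each point of the torus has `p` representatives in the box. -/
lemma sum_box_pull (f : Torus n p q → ℤ) :
    ∑ v ∈ box (p * n : ℕ), pull f v.1 v.2 = p * ∑ Q, f Q := by
  have h : ∀ v : ℤ × ℤ, pull f v.1 v.2 =
      ∑ Q : Torus n p q, (if Q = pt n p q v then 1 else 0) * f Q := fun v => by
    simp [pull]
  simp only [h]
  rw [Finset.sum_comm, Finset.mul_sum]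
  refine Finset.sum_congr rfl fun Q _ => ?_
  rw [← Finset.sum_mul]
  congr 1
  have := sum_liftPoint (n := n) (p := p) (q := q) (cellOf Q).toPlane
    (by simp only [Cell.toPlane]; omega)
    (by simp only [Cell.toPlane]; have := (cellOf Q).2.2; omega) fun _ => 1
  rw [pt_cellOf] at this
  simpa using this.symm

/-- The sum over the lifts of a transversal. -/
lemma IsTransversal.sum_lift {c : Fin n → ℤ × ℤ} (hc : IsTransversal c) (φ : ℤ × ℤ → ℤ) :
    ∑ s : Fin n × Fin p, φ (liftPoint n p q (c s.1) s.2) =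
      ∑ v ∈ box (p * n : ℕ), pull (ind (ptSet n p q c)) v.1 v.2 * φ v := by
  rw [Fintype.sum_prod_type]
  obtain ⟨f, -, hf⟩ := hc.row
  have h : ∀ i, ∑ k, φ (liftPoint n p q (c i) k) = _ := fun i =>
    sum_liftPoint (c i) (by rw [hf]; omega) (by rw [hf]; have := (f i).2; omega) φ
  simp only [h]
  rw [Finset.sum_comm]
  refine Finset.sum_congr rfl fun v _ => ?_
  rw [← Finset.sum_mul, pull, hc.ind_ptSet]

/-- The pairs of lifts of two transversals that are counted in the gradings; the relation `R`
encodes the strict inequality between the coordinates, displaced by `ε` and `ε'`. -/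
lemma countPairs_lift {c d : Fin n → ℤ × ℤ} (hc : IsTransversal c) (hd : IsTransversal d)
    {ε ε' : ℚ} {R : ℤ → ℤ → Prop} (hR : ∀ a b : ℤ, (a : ℚ) + ε < b + ε' ↔ R a b) :
    (countPairs (lift n p q ε c) (lift n p q ε' d) : ℤ) =
      pairSum (p * n : ℕ) R (pull (ind (ptSet n p q c))) (pull (ind (ptSet n p q d))) := by
  classical
  have h : (countPairs (lift n p q ε c) (lift n p q ε' d) : ℤ) =
      ∑ s : Fin n × Fin p, ∑ t : Fin n × Fin p,
        if R (liftPoint n p q (c s.1) s.2).1 (liftPoint n p q (d t.1) t.2).1 ∧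
          R (liftPoint n p q (c s.1) s.2).2 (liftPoint n p q (d t.1) t.2).2 then 1 else 0 := by
    rw [countPairs, Finset.card_filter, Fintype.sum_prod_type]
    push_cast
    refine Finset.sum_congr rfl fun s _ => Finset.sum_congr rfl fun t _ => ?_
    refine if_congr (and_congr ?_ ?_) rfl rfl
    · exact hR _ _
    · exact hR _ _
  rw [h, Finset.sum_congr rfl fun s _ => hd.sum_lift fun w =>
    if R (liftPoint n p q (c s.1) s.2).1 w.1 ∧ R (liftPoint n p q (c s.1) s.2).2 w.2
      then (1 : ℤ) else 0]
  rw [hc.sum_lift fun v => ∑ w ∈ box (p * n : ℕ), pull (ind (ptSet n p q d)) w.1 w.2 *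
    if R v.1 w.1 ∧ R v.2 w.2 then (1 : ℤ) else 0, pairSum]
  refine Finset.sum_congr rfl fun v _ => ?_
  rw [Finset.mul_sum]
  refine Finset.sum_congr rfl fun w _ => ?_
  split_ifs <;> ring

end Lifts

/-! ### The change of the pair counts along a rectangle -/

section Change

variable {n p : ℕ} {q : ℤ} [NeZero n] [NeZero p] {X Y S : Finset (Torus n p q)}
  {r : Rect (Torus n p q)}

/-- the multiplicities of a rectangle, as a function of the planar coordinates -/
noncomputable def pullCover (r : Rect (Torus n p q)) : ℤ → ℤ → ℤ :=
  pull fun Q => r.cover (hStep n p q) (vStep n p q) Q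

/-- Replacing `X` by `Y` along a rectangle changes the sum of the discrete integral of `S` by the
number of points of the shifted set `S` in the rectangle, up to a boundary term that does not depend
on `S` or the shift. -/
lemma sum_ind_sub_mul_cumul (hpq : IsCoprime (p : ℤ) q)
    (h : Joins (hStep n p q) (vStep n p q) r X Y)
    (hS : IsState (hStep n p q) (vStep n p q) S) (a : ℤ) :
    ∑ v ∈ box (p * n : ℕ), (pull (ind X) v.1 v.2 - pull (ind Y) v.1 v.2)
        * cumul (pull (ind S)) (v.1 + a) (v.2 + a) =
      p * ∑ Q ∈ S, r.cover (hStep n p q) (vStep n p q) (Q - a • hStep n p q - a • vStep n p q)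
        + boundaryTerm (p * n : ℕ) (pullCover r) := by
  have e1 : ((p * n : ℕ) : ℤ) • hStep n p q = 0 := (smul_hStep_eq_zero _).2 dvd_rfl
  have e2 : ((p * n : ℕ) : ℤ) • vStep n p q = 0 := (smul_vStep_eq_zero hpq _).2 dvd_rfl
  have := sum_box_by_parts (N := (p * n : ℕ)) (by positivity) (balanced_pull hpq hS) a
    (M := pullCover r)
    (fun t => by
      simp only [pullCover, pull]
      rw [sub_eq_add_neg, add_comm, pt_add_hStep, e1, add_zero])
    (fun s => by
      simp only [pullCover, pull]
      rw [sub_eq_add_neg, add_comm, pt_add_vStep, e2, add_zero])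
  have hs : ∑ Q ∈ S, r.cover (hStep n p q) (vStep n p q)
        (Q - a • hStep n p q - a • vStep n p q) =
      ∑ Q, r.cover (hStep n p q) (vStep n p q) Q
        * ind S (Q + a • hStep n p q + a • vStep n p q) := by
    rw [sum_mem_eq, ← sum_shift (fun Q => r.cover (hStep n p q) (vStep n p q) Q
        * ind S (Q + a • hStep n p q + a • vStep n p q)) (a • hStep n p q + a • vStep n p q)]
    refine Finset.sum_congr rfl fun Q _ => ?_
    rw [mul_comm, ← sub_sub]
    congr 2
    abel
  rw [hs, ← sum_box_pull]
  refine Eq.trans ?_ (this.trans ?_)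
  · refine Finset.sum_congr rfl fun v _ => ?_
    congr 1
    have h1 := h.ind_sub_cover (pt n p q v)
    have h2 : pt n p q (v.1 - 1, v.2) = pt n p q v - hStep n p q := by
      rw [hStep, ← pt_sub]; congr 1; ext <;> simp
    have h3 : pt n p q (v.1, v.2 - 1) = pt n p q v - vStep n p q := by
      rw [vStep, ← pt_sub]; congr 1; ext <;> simp
    have h4 : pt n p q (v.1 - 1, v.2 - 1) = pt n p q v - hStep n p q - vStep n p q := by
      rw [hStep, vStep, ← pt_sub, ← pt_sub]; congr 1; ext <;> simp
    simp only [pullCover, pull, h2, h3, h4]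
    exact h1
  · congr 1
    refine Finset.sum_congr rfl fun v _ => ?_
    simp only [pullCover, pull, ← pt_add_steps]

variable (hpq : IsCoprime (p : ℤ) q) (h : Joins (hStep n p q) (vStep n p q) r X Y)
  (hS : IsState (hStep n p q) (vStep n p q) S)
include hpq h hS

lemma pairSum_lt_change_right :
    pairSum (p * n : ℕ) (· < ·) (pull (ind S)) (pull (ind X))
        - pairSum (p * n : ℕ) (· < ·) (pull (ind S)) (pull (ind Y)) =
      p * ∑ Q ∈ S, r.cover (hStep n p q) (vStep n p q) Q
        + boundaryTerm (p * n : ℕ) (pullCover r) := by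
  have := sum_ind_sub_mul_cumul hpq h hS 0
  simp only [zero_smul, sub_zero, add_zero] at this
  rw [← this, pairSum_lt_right, pairSum_lt_right, ← Finset.sum_sub_distrib]
  exact Finset.sum_congr rfl fun v _ => by ring

lemma pairSum_le_change_left (hX : IsState (hStep n p q) (vStep n p q) X)
    (hY : IsState (hStep n p q) (vStep n p q) Y) :
    pairSum (p * n : ℕ) (· ≤ ·) (pull (ind X)) (pull (ind S))
        - pairSum (p * n : ℕ) (· ≤ ·) (pull (ind Y)) (pull (ind S)) =
      p * ∑ Q ∈ S, r.cover (hStep n p q) (vStep n p q) Q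
        + boundaryTerm (p * n : ℕ) (pullCover r) := by
  have := sum_ind_sub_mul_cumul hpq h hS 0
  simp only [zero_smul, sub_zero, add_zero] at this
  rw [← this, pairSum_le_left (by positivity) (balanced_pull hpq hX) (balanced_pull hpq hS),
    pairSum_le_left (by positivity) (balanced_pull hpq hY) (balanced_pull hpq hS),
    add_sub_add_right_eq_sub, ← Finset.sum_sub_distrib]
  exact Finset.sum_congr rfl fun v _ => by ring

lemma pairSum_lt_change_left (hX : IsState (hStep n p q) (vStep n p q) X)
    (hY : IsState (hStep n p q) (vStep n p q) Y) :
    pairSum (p * n : ℕ) (· < ·) (pull (ind X)) (pull (ind S))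
        - pairSum (p * n : ℕ) (· < ·) (pull (ind Y)) (pull (ind S)) =
      p * ∑ Q ∈ S, r.cover (hStep n p q) (vStep n p q) (Q - hStep n p q - vStep n p q)
        + boundaryTerm (p * n : ℕ) (pullCover r) := by
  have := sum_ind_sub_mul_cumul hpq h hS 1
  simp only [one_smul] at this
  rw [← this, pairSum_lt_left (by positivity) (balanced_pull hpq hX) (balanced_pull hpq hS),
    pairSum_lt_left (by positivity) (balanced_pull hpq hY) (balanced_pull hpq hS),
    add_sub_add_right_eq_sub, ← Finset.sum_sub_distrib]
  exact Finset.sum_congr rfl fun v _ => by ring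

end Change

end TorusGrid

namespace TorusGrid
open TwistedGrid

/-! ### The gradings of the differential -/

section Gradings

variable {n p : ℕ} {q : ℤ} [NeZero n] [NeZero p] (G : GridDiagram n p q)

lemma isTransversal_of_cells {c : Fin n → Cell n p} (hr : ∀ b : Fin n, ∃! i, (c i).2 = b)
    (hc : ∀ j : Fin n, ∃! i, ((c i).1 : ℕ) % n = j) : IsTransversal fun i => (c i).toPlane where
  row := ⟨fun i => (c i).2, (Function.bijective_iff_existsUnique _).2 hr, fun _ => rfl⟩
  column := by
    refine ⟨fun i => ⟨((c i).1 : ℕ) % n, Nat.mod_lt _ (NeZero.pos n)⟩,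
      (Function.bijective_iff_existsUnique _).2 fun j => ?_, fun i => ?_⟩
    · simpa only [Fin.ext_iff] using hc j
    · simp only [Cell.toPlane]
      push_cast
      rfl

lemma sum_cover_ptSet {c : Fin n → Cell n p} (hc : IsTransversal fun i => (c i).toPlane)
    (r : Rectangle n p) :
    ∑ Q ∈ ptSet n p q (fun i => (c i).toPlane),
        (torusRect q r).cover (hStep n p q) (vStep n p q) Q = (∑ i, r.mult q (c i) : ℕ) := by
  classical
  rw [ptSet, Finset.sum_image fun i _ j _ h => hc.pt_injective h]
  push_cast
  exact Finset.sum_congr rfl fun i _ => (mult_eq_cover r _).symm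

lemma isTransversal_O : IsTransversal fun i => (G.O i).toPlane :=
  isTransversal_of_cells G.row_O G.column_O

lemma isTransversal_X : IsTransversal fun i => (G.X i).toPlane :=
  isTransversal_of_cells G.row_X G.column_X

lemma lt_add_half_iff (a b : ℤ) : (a : ℚ) + 0 < b + 1 / 2 ↔ a ≤ b := by
  constructor
  · intro h
    have : (a : ℚ) < (b + 1 : ℤ) := by push_cast; linarith
    have : a < b + 1 := by exact_mod_cast this
    omega
  · intro h
    have : (a : ℚ) ≤ b := by exact_mod_cast h
    linarith

lemma half_add_lt_iff (a b : ℤ) : (a : ℚ) + 1 / 2 < b + 0 ↔ a < b := by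
  constructor
  · intro h
    have : (a : ℚ) < b := by linarith
    exact_mod_cast this
  · intro h
    have : ((a + 1 : ℤ) : ℚ) ≤ b := by exact_mod_cast h
    push_cast at this
    linarith

variable (hpq : IsCoprime (p : ℤ) q) {r : Rectangle n p} {x y : Generator n p}
  (h : r.ConnectsEmpty q x y)
include hpq h

/-- The change of the number of pairs of points of the generator is given by the index of the
rectangle, which is `1`. -/
lemma countPairs_gen_change :
    (countPairs (liftGen q x) (liftGen q x) : ℤ) - countPairs (liftGen q y) (liftGen q y) =
      p + 2 * boundaryTerm (p * n : ℕ) (pullCover (torusRect q r)) := by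
  obtain ⟨hj, hv⟩ := (connectsEmpty_iff hpq r x y).1 h
  have hX := isState_genSet hpq x
  have hY := isState_genSet hpq y
  have hi := hj.index_eq_one hX hY hv
  have e1 := pairSum_lt_change_left hpq hj hX hX hY
  have e2 := pairSum_lt_change_right hpq hj hY
  have hR : ∀ a b : ℤ, (a : ℚ) + 0 < b + 0 ↔ a < b := fun a b => by simp
  unfold liftGen
  rw [countPairs_lift (isTransversal_point x) (isTransversal_point x) hR,
    countPairs_lift (isTransversal_point y) (isTransversal_point y) hR]
  unfold index at hi
  unfold genSet at *
  linear_combination e1 + e2 + (p : ℤ) * hi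

lemma countPairs_gen_marking_change {c : Fin n → Cell n p}
    (hc : IsTransversal fun i => (c i).toPlane) :
    (countPairs (liftGen q x) (lift n p q (1 / 2) fun i => (c i).toPlane) : ℤ)
        - countPairs (liftGen q y) (lift n p q (1 / 2) fun i => (c i).toPlane) =
      p * (∑ i, r.mult q (c i) : ℕ)
        + boundaryTerm (p * n : ℕ) (pullCover (torusRect q r)) := by
  have hj := ((connectsEmpty_iff hpq r x y).1 h).1
  unfold liftGen
  rw [countPairs_lift (isTransversal_point x) hc lt_add_half_iff,
    countPairs_lift (isTransversal_point y) hc lt_add_half_iff, ← sum_cover_ptSet hc]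
  exact pairSum_le_change_left hpq hj (hc.isState hpq) (isState_genSet hpq x)
    (isState_genSet hpq y)

lemma countPairs_marking_gen_change {c : Fin n → Cell n p}
    (hc : IsTransversal fun i => (c i).toPlane) :
    (countPairs (lift n p q (1 / 2) fun i => (c i).toPlane) (liftGen q x) : ℤ)
        - countPairs (lift n p q (1 / 2) fun i => (c i).toPlane) (liftGen q y) =
      p * (∑ i, r.mult q (c i) : ℕ)
        + boundaryTerm (p * n : ℕ) (pullCover (torusRect q r)) := by
  have hj := ((connectsEmpty_iff hpq r x y).1 h).1
  unfold liftGen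
  rw [countPairs_lift hc (isTransversal_point x) half_add_lt_iff,
    countPairs_lift hc (isTransversal_point y) half_add_lt_iff, ← sum_cover_ptSet hc]
  exact pairSum_lt_change_right hpq hj (hc.isState hpq)

theorem maslov_sub_maslov :
    G.maslov x - G.maslov y = 1 - 2 * (∑ i, r.mult q (G.O i) : ℕ) := by
  have hp : (p : ℚ) ≠ 0 := by exact_mod_cast NeZero.ne p
  have e1 := congrArg (Int.cast (R := ℚ)) (countPairs_gen_change hpq h)
  have e2 := congrArg (Int.cast (R := ℚ))
    (countPairs_gen_marking_change hpq h (isTransversal_O G))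
  have e3 := congrArg (Int.cast (R := ℚ))
    (countPairs_marking_gen_change hpq h (isTransversal_O G))
  unfold GridDiagram.maslov GridDiagram.liftO
  simp only [Int.cast_sub, Int.cast_add, Int.cast_mul, Int.cast_natCast, Int.cast_ofNat]
    at e1 e2 e3
  field_simp
  linear_combination e1 - e2 - e3

theorem alexander_sub_alexander :
    G.alexander x - G.alexander y =
      (∑ i, r.mult q (G.X i) : ℕ) - (∑ i, r.mult q (G.O i) : ℕ) := by
  have hp : (p : ℚ) ≠ 0 := by exact_mod_cast NeZero.ne p
  have e2 := congrArg (Int.cast (R := ℚ))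
    (countPairs_marking_gen_change hpq h (isTransversal_X G))
  have e3 := congrArg (Int.cast (R := ℚ))
    (countPairs_marking_gen_change hpq h (isTransversal_O G))
  unfold GridDiagram.alexander GridDiagram.liftO GridDiagram.liftX
  simp only [Int.cast_sub, Int.cast_add, Int.cast_mul, Int.cast_natCast] at e2 e3
  field_simp
  linear_combination 2 * e2 - 2 * e3

omit hpq h in
/-- The horizontal position of a component of a generator determines its `p`-coordinate; the
lattice of the torus shifts it by multiples of `q` that the four corners of a rectangle cancel. -/
theorem spinc_eq (hc : r.Connects q x y) : G.spinc x = G.spinc y := by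
  obtain ⟨-, -, i, j, hij, ⟨k₁, m₁, h1⟩, ⟨k₂, m₂, h2⟩, ⟨k₃, m₃, h3⟩, ⟨k₄, m₄, h4⟩, h5⟩ := hc
  have hn : (n : ℤ) ≠ 0 := by exact_mod_cast NeZero.ne n
  simp only [Generator.point, Rectangle.pos, Prod.mk.injEq] at h1 h2 h3 h4
  obtain ⟨a1, b1⟩ := h1
  obtain ⟨a2, b2⟩ := h2
  obtain ⟨a3, b3⟩ := h3
  obtain ⟨a4, b4⟩ := h4
  push_cast at a1 a2 a3 a4 b1 b2 b3 b4
  have k13 : k₁ = k₃ := mul_left_cancel₀ hn (by linarith)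
  have k24 : k₂ = k₄ := mul_left_cancel₀ hn (by linarith)
  subst k13 k24
  -- the left side of the rectangle contains `x i` and `y j`, the right side `x j` and `y i`
  have c1 : x.1 i = y.1 j := fin_eq_of_dvd
    ⟨q * (k₁ - k₂) + p * (m₁ - m₄) + (y.2 j).val - (x.2 i).val, by linarith⟩
  have c2 : x.1 j = y.1 i := fin_eq_of_dvd
    ⟨q * (k₂ - k₁) + p * (m₂ - m₃) + (y.2 i).val - (x.2 j).val, by linarith⟩
  rw [c1] at a1
  rw [c2] at a2
  have key : ((x.2 i).val : ℤ) + (x.2 j).val - ((y.2 i).val + (y.2 j).val) =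
      p * (m₁ + m₂ - m₃ - m₄) := mul_left_cancel₀ hn (by linarith)
  have hsum : x.2 i + x.2 j = y.2 i + y.2 j := by
    have := congrArg (Int.cast (R := ZMod p)) key
    push_cast at this
    simp only [ZMod.natCast_val, ZMod.cast_id', id_eq, CharP.cast_eq_zero, zero_mul] at this
    exact sub_eq_zero.1 this
  have hrest : ∀ k, k ≠ i → k ≠ j → x.2 k = y.2 k := fun k hi hj =>
    (point_eq_of_pt (q := q) (congrArg _ (h5 k hi hj))).2.2
  have htot : ∑ k, x.2 k = ∑ k, y.2 k := by
    rw [← sub_eq_zero, ← Finset.sum_sub_distrib,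
      ← Finset.sum_subset (Finset.subset_univ {i, j}), Finset.sum_pair hij]
    · linear_combination hsum
    · intro k _ hk
      simp only [Finset.mem_insert, Finset.mem_singleton, not_or] at hk
      rw [hrest k hk.1 hk.2, sub_self]
  unfold GridDiagram.spinc
  rw [htot]

omit h in
theorem diff_mem_trigraded {A : Type} [CommRing A] [Algebra (ZMod 2) A] (V : Fin n → A)
    {m a : ℚ} {s : ZMod p} {c : Generator n p →₀ A} (hc : c ∈ G.trigraded V m a s) :
    G.diff V c ∈ G.trigraded V (m - 1) a s := by
  classical
  unfold GridDiagram.trigraded at hc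
  induction hc using Submodule.span_induction with
  | zero => rw [map_zero]; exact zero_mem _
  | add c d _ _ hc hd => rw [map_add]; exact add_mem hc hd
  | smul t c _ hc =>
    rw [LinearMap.map_smul_of_tower]
    exact Submodule.smul_mem _ _ hc
  | mem c hc =>
    obtain ⟨x, e, rfl, hm, ha, hs⟩ := hc
    rw [diff_single, diffGen_eq, Finset.smul_sum]
    refine sum_mem fun y _ => ?_
    rw [Finset.smul_sum]
    refine sum_mem fun r _ => ?_
    split_ifs with hr
    · have e1 := maslov_sub_maslov G hpq hr.1
      have e2 := alexander_sub_alexander G hpq hr.1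
      simp only [hr.2, Finset.sum_const_zero, Nat.cast_zero] at e2
      refine Submodule.subset_span ⟨y, fun i => e i + r.mult q (G.O i), ?_, ?_, ?_, ?_⟩
      · rw [Finsupp.smul_single, smul_eq_mul, monomialO, ← Finset.prod_mul_distrib]
        simp only [pow_add]
      · rw [Finset.sum_add_distrib, Nat.cast_add]
        linear_combination hm - e1
      · rw [Finset.sum_add_distrib, Nat.cast_add]
        linear_combination ha - e2
      · rw [← hs, spinc_eq G hr.1.1]
    · rw [smul_zero]
      exact zero_mem _

end Gradings

end TorusGrid

open TwistedGrid in
theorem mainTheorem2 {n p : ℕ} [NeZero n] [NeZero p] {q : ℤ} (hpq : IsCoprime (p : ℤ) q)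
    (G : GridDiagram n p q) :
    -- both flavors are chain complexes
    G.diffMinus ∘ₗ G.diffMinus = 0 ∧
    G.diffHat ∘ₗ G.diffHat = 0 ∧
    -- each empty polygon that is not a strip has exactly two decompositions
    (∀ (x z : Generator n p) (ψ : Cell n p → ℕ), (decompositions q x z ψ).Nonempty →
      ¬ IsAlphaStrip ψ → ¬ IsBetaStrip ψ → (decompositions q x z ψ).ncard = 2) ∧
    -- the differentials act on the trigradings with degree `(-1, 0, 0)`
    (∀ (m a : ℚ) (s : ZMod p), ∀ c ∈ G.trigraded (minusVar n) m a s,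
      G.diffMinus c ∈ G.trigraded (minusVar n) (m - 1) a s) ∧
    (∀ (m a : ℚ) (s : ZMod p), ∀ c ∈ G.trigraded (hatVar n) m a s,
      G.diffHat c ∈ G.trigraded (hatVar n) (m - 1) a s) := by
  refine ⟨TorusGrid.diff_comp_diff G _ hpq, TorusGrid.diff_comp_diff G _ hpq,
    fun x z ψ => TorusGrid.ncard_decompositions hpq x z ψ,
    fun m a s c hc => TorusGrid.diff_mem_trigraded G hpq _ hc,
    fun m a s c hc => TorusGrid.diff_mem_trigraded G hpq _ hc⟩
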